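/- **Conventions.** Fix Grothendieck universes $\mathcal U_1\in\mathcal U_2$; "small" means in $\mathcal U_1$, "large" means in $\mathcal U_2$. $\mathbf{VDBL}$ is the 2-category of large virtual double categories, virtual double functors and vertical transformations; $1$ is its terminal object. For $\mathbb A\in\mathbf{VDBL}$, $\mathbb{Fam}(\mathbb A)\in\mathbf{VDBL}$ is the following virtual double category. * Objects: pairs of a small set $I$ and a family $(A_i)_{i\in I}$ of objects of $\mathbb A$. Vertical morphisms $(I,A)\to(I',A')$: functions $v\colon I\to I'$ with a family of vertical morphisms $A_i\to A'_{v(i)}$. * Horizontal morphisms $(I,A)\to(I',A')$: spans $I\xleftarrow{(-)_-}S\xrightarrow{(-)_+}I'$ of small sets with a family of horizontal morphisms $\Gamma_s\colon A_{s_-}\to A'_{s_+}$ $(s\in S)$. * Multicells $(S_1,\Gamma_1),\dots,(S_n,\Gamma_n)\Rightarrow(S,\Gamma)$ with vertical edges $(v,f),(v',f')$: functions $m\colon S_1\times_{I_1}\cdots\times_{I_{n-1}}S_n\to S$ with $m(s_1,\dots,s_n)_-=v((s_1)_-)$ and $m(s_1,\dots,s_n)_+=v'((s_n)_+)$, together with,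 for each tuple, a multicell $\Gamma_{1,s_1},\dots,\Gamma_{n,s_n}\Rightarrow\Gamma_{m(s_1,\dots,s_n)}$ of $\mathbb A$ with vertical edges $f_{(s_1)_-}$ and $f'_{(s_n)_+}$ (for $n=0$ the fibre product is $I_0$, and both ends of $i\in I_0$ are $i$). $\mathbb{Fam}$ acts componentwise on virtual double functors, and $\mathbb{Span}=\mathbb{Fam}(1)$. A virtual double functor $P\colon\mathbb X\to\mathbb Y$ is a *discrete opfibration* if (i) each vertical morphism $v\colon PX\to Y$ of $\mathbb Y$ has a unique lift $\overline v_X\colon X\to v_*X$ along $P$ with domain $X$, and (ii) for each path $\Phi_1,\dots,\Phi_n$ $(n\ge 0)$ of horizontal morphisms of $\mathbb X$, each multicell $\nu$ of $\mathbb Y$ with top path $P\Phi_1,\dots,P\Phi_n$ has a unique lift $\overline\nu_{\Phi_1,\dots,\Phi_n}$ along $P$ with top path $\Phi_1,\dots,\Phi_n$; write $\nu_*(\Phi_1,\dots,\Phi_n)$ for its bottom edge. It has *small fibres* if, for every object $Y$ and every horizontal morphism $\Psi$ of $\mathbb Y$, the sets $P^{-1}(Y)$ of objects $X$ with $PX=Y$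 and $P^{-1}(\Psi)$ of horizontal morphisms $\Phi$ with $P\Phi=\Psi$ are small. Let $P\colon\mathbb X\to\mathbb Y$ be a discrete opfibration with small fibres. * $D_P\colon\mathbb Y\to\mathbb{Span}$ sends $Y$ to $P^{-1}(Y)$, $v$ to $X\mapsto v_*X$, $\Psi$ to the span $P^{-1}(\Psi)$ (with legs domain and codomain), and $\nu$ to $(\Phi_1,\dots,\Phi_n)\mapsto\nu_*(\Phi_1,\dots,\Phi_n)$. * $\overline P\colon\mathbb Y\to\mathbb{Fam}(\mathbb X)$ sends $Y$ to $(P^{-1}(Y),(X)_{X})$, $v$ to $(X\mapsto v_*X,(\overline v_X)_X)$, $\Psi$ to $(P^{-1}(\Psi),(\Phi)_{\Phi})$ and $\nu$ to the family of its lifts. * For $F\colon\mathbb A\to\mathbb X$, the virtual double category $\prod_P\mathbb A$, with its projection $\prod_PF\colon\prod_P\mathbb A\to\mathbb Y$, is as follows. An object is an object $Y$ of $\mathbb Y$ with a family $(A_X)_{X\in P^{-1}(Y)}$ of objects of $\mathbb A$ with $FA_X=X$; a vertical morphism is a vertical morphism $v\colon Y\to Y'$ with vertical morphisms $f_X\colon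 A_X\to A'_{v_*X}$ with $Ff_X=\overline v_X$; a horizontal morphism is a horizontal morphism $\Psi$ of $\mathbb Y$ with horizontal morphisms $\Gamma_\Phi\colon A_X\to A'_{X'}$ with $F\Gamma_\Phi=\Phi$, for all $(\Phi\colon X\to X')\in P^{-1}(\Psi)$; a multicell is a multicell $\nu$ of $\mathbb Y$ with top path $\Psi_1,\dots,\Psi_n$ and, for each composable tuple $\Phi_k\in P^{-1}(\Psi_k)$ (for $n=0$: each $X\in P^{-1}(Y_0)$), a multicell $\alpha_{\Phi_1,\dots,\Phi_n}$ of $\mathbb A$ of the induced boundary with $F\alpha_{\Phi_1,\dots,\Phi_n}=\overline\nu_{\Phi_1,\dots,\Phi_n}$. **Proposition.** Let $P\colon\mathbb X\to\mathbb Y$ be a discrete opfibration with small fibres in $\mathbf{VDBL}$. 1. $\overline P$ is the unit at $D_P$ of the adjunction $\mathbb{E}\mathrm{lts}\dashv\mathbb{Fam}_1$, where $\mathbb{Fam}_1\colon\mathbf{VDBL}\to\mathbf{VDBL}/\mathbb{Span}$ sends $\mathbb A$ to $\mathbb{Fam}(!)\colon\mathbb{Fam}(\mathbb A)\to\mathbb{Fam}(1)$,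 with $\mathbb{E}\mathrm{lts}(D_P)\cong\mathbb X$. That is, $\mathbb{Fam}(!_{\mathbb X})\circ\overline P=D_P$, and for every $\mathbb A\in\mathbf{VDBL}$ and every $G\colon\mathbb Y\to\mathbb{Fam}(\mathbb A)$ with $\mathbb{Fam}(!_{\mathbb A})\circ G=D_P$ there is a unique virtual double functor $K\colon\mathbb X\to\mathbb A$ with $\mathbb{Fam}(K)\circ\overline P=G$. 2. For every virtual double functor $F\colon\mathbb A\to\mathbb X$ in $\mathbf{VDBL}$ there is a virtual double functor $T\colon\prod_P\mathbb A\to\mathbb{Fam}(\mathbb A)$ such that $$\begin{array}{ccc}\prod_P\mathbb A&\xrightarrow{\;T\;}&\mathbb{Fam}(\mathbb A)\\ {\scriptstyle\prod_PF}\downarrow&&\downarrow{\scriptstyle\mathbb{Fam}(F)}\\ \mathbb Y&\xrightarrow{\;\overline P\;}&\mathbb{Fam}(\mathbb X)\end{array}$$ is a pullback in the 2-category $\mathbf{VDBL}$: it commutes, and it has the (strict) universal property of a pullback both for virtual double functors $\mathbb W\to\prod_P\mathbb A$ and for vertical transformations between them, for every $\mathbb W\in\mathbf{VDBL}$. -/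

import Mathlib

open CategoryTheory

universe i k u w w'

/-- Composable (possibly empty) sequences of horizontal morphisms. -/
inductive HPath {O : Type w} (H : O → O → Type w') : O → O → Type (max w w')
  | nil (a : O) : HPath H a a
  | cons {a b c : O} (Γ : H a b) (p : HPath H b c) : HPath H a c

namespace HPath

variable {O : Type w} {H : O → O → Type w'}

/-- Concatenation of paths. -/
def append : {a b c : O} → HPath H a b → HPath H b c → HPath H a c
  | _, _, _, nil _, q => q
  | _, _, _, cons Γ p, q => cons Γ (p.append q)

theorem append_nil : {a b : O} → (p : HPath H a b) → p.append (nil b) = p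
  | _, _, nil _ => rfl
  | _, _, cons Γ p => congrArg (cons Γ) (append_nil p)

theorem append_assoc : {a b c d : O} → (p : HPath H a b) → (q : HPath H b c) → (r : HPath H c d) →
    (p.append q).append r = p.append (q.append r)
  | _, _, _, _, nil _, _, _ => rfl
  | _, _, _, _, cons Γ p, q, r => congrArg (cons Γ) (append_assoc p q r)

/-- The path of length one. -/
abbrev single {a b : O} (Γ : H a b) : HPath H a b := cons Γ (nil b)

/-- The image of a path under a map of graphs. -/
def map {O₁ : Type i} {H₁ : O₁ → O₁ → Type k} (f : O → O₁)
    (h : ∀ {a b : O}, H a b → H₁ (f a) (f b)) :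
    {a b : O} → HPath H a b → HPath H₁ (f a) (f b)
  | _, _, nil a => nil (f a)
  | _, _, cons Γ p => cons (h Γ) (map f h p)

theorem map_append {O₁ : Type i} {H₁ : O₁ → O₁ → Type k} (f : O → O₁)
    (h : ∀ {a b : O}, H a b → H₁ (f a) (f b)) :
    {a b c : O} → (p : HPath H a b) → (q : HPath H b c) →
      (p.map f h).append (q.map f h) = (p.append q).map f h
  | _, _, _, nil _, _ => rfl
  | _, _, _, cons Γ p, q => congrArg (cons (h Γ)) (map_append f h p q)

theorem map_id : {a b : O} → (p : HPath H a b) → p.map (fun x => x) (fun x => x) = p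
  | _, _, nil _ => rfl
  | _, _, cons Γ p => congrArg (cons Γ) (map_id p)

end HPath

/-- The data of a virtual double category without its operations, except that the objects and
vertical morphisms already form a category: horizontal morphisms, and for each boundary a set of
multicells. `Cell p u u' Δ` is the set of multicells with top path `p`, left edge `u`, right edge
`u'` and bottom edge `Δ`. -/
structure VDGraph : Type (w + 1) where
  /-- Objects. -/
  Ob : Type w
  /-- The vertical category. -/
  [cat : Category.{w} Ob]
  /-- Horizontal morphisms. -/
  Hor : Ob → Ob → Type w
  /-- Multicells. -/
  Cell : {a b c d : Ob} → HPath Hor a b → (a ⟶ c) → (b ⟶ d) → Hor c d → Type w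

attribute [instance] VDGraph.cat

namespace VDGraph

/-- A horizontally composable sequence of multicells `θ₁, …, θₘ`. In `CellSeq p u u' q` the
path `p` is the concatenation of the top paths, `q` is the path of bottom edges, `u` is the left
edge of `θ₁` and `u'` is the right edge of `θₘ`. For `m = 0` it is just a vertical morphism. -/
inductive CellSeq (A : VDGraph.{w}) : {a b c d : A.Ob} → HPath A.Hor a b → (a ⟶ c) → (b ⟶ d) →
    HPath A.Hor c d → Type w
  | nil {a c : A.Ob} (u : a ⟶ c) : CellSeq A (.nil a) u u (.nil c)
  | cons {a a₁ b c c₁ d : A.Ob} {p₁ : HPath A.Hor a a₁} {u : a ⟶ c} {u₁ : a₁ ⟶ c₁}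
      {Δ : A.Hor c c₁} {p₂ : HPath A.Hor a₁ b} {u' : b ⟶ d} {q : HPath A.Hor c₁ d}
      {p : HPath A.Hor a b} (θ : A.Cell p₁ u u₁ Δ) (Θ : CellSeq A p₂ u₁ u' q)
      (hp : p₁.append p₂ = p) : CellSeq A p u u' (.cons Δ q)

/-- A multicell as a sequence of length one. -/
def CellSeq.single {A : VDGraph.{w}} {a b c d : A.Ob} {p : HPath A.Hor a b} {u : a ⟶ c}
    {u' : b ⟶ d} {Δ : A.Hor c d} (θ : A.Cell p u u' Δ) : A.CellSeq p u u' (.single Δ) :=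
  .cons θ (.nil u') p.append_nil

/-- Concatenation of sequences of multicells. -/
def CellSeq.append {A : VDGraph.{w}} : {a a₁ b c c₁ d : A.Ob} → {p₁ : HPath A.Hor a a₁} →
    {u : a ⟶ c} → {u₁ : a₁ ⟶ c₁} → {q₁ : HPath A.Hor c c₁} → {p₂ : HPath A.Hor a₁ b} →
    {u' : b ⟶ d} → {q₂ : HPath A.Hor c₁ d} → {p : HPath A.Hor a b} → {q : HPath A.Hor c d} →
    A.CellSeq p₁ u u₁ q₁ → A.CellSeq p₂ u₁ u' q₂ → p₁.append p₂ = p → q₁.append q₂ = q →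
    A.CellSeq p u u' q
  | _, _, _, _, _, _, _, _, _, _, _, _, _, _, _, .nil _, Θ', hp, hq => hp ▸ hq ▸ Θ'
  | _, _, _, _, _, _, _, _, _, _, p₂, _, _, _, _, .cons (p₁ := r₁) (p₂ := r₂) θ Θ hr, Θ', hp, hq =>
    hq ▸ .cons θ (Θ.append Θ' rfl rfl) (p := _)
      ((HPath.append_assoc r₁ r₂ p₂).symm.trans ((congrArg (HPath.append · p₂) hr).trans hp))

/-- A horizontally composable sequence of pairs `(κᵢ, (θᵢ₁, …, θᵢₙ))` where the sequence
`(θᵢ₁, …, θᵢₙ)` can be composed with `κᵢ`. -/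
inductive CellGrid (A : VDGraph.{w}) : {a b c d e f : A.Ob} → HPath A.Hor a b → (a ⟶ c) →
    (b ⟶ d) → HPath A.Hor c d → (c ⟶ e) → (d ⟶ f) → HPath A.Hor e f → Type w
  | nil {a c e : A.Ob} (u : a ⟶ c) (v : c ⟶ e) :
      CellGrid A (.nil a) u u (.nil c) v v (.nil e)
  | cons {a a₁ b c c₁ d e e₁ f : A.Ob} {p₁ : HPath A.Hor a a₁} {u : a ⟶ c} {u₁ : a₁ ⟶ c₁}
      {q₁ : HPath A.Hor c c₁} {v : c ⟶ e} {v₁ : c₁ ⟶ e₁} {Δ : A.Hor e e₁}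
      {p₂ : HPath A.Hor a₁ b} {u' : b ⟶ d} {q₂ : HPath A.Hor c₁ d} {v' : d ⟶ f}
      {r : HPath A.Hor e₁ f} {p : HPath A.Hor a b} {q : HPath A.Hor c d}
      (Θ : A.CellSeq p₁ u u₁ q₁) (κ : A.Cell q₁ v v₁ Δ) (G : CellGrid A p₂ u₁ u' q₂ v₁ v' r)
      (hp : p₁.append p₂ = p) (hq : q₁.append q₂ = q) :
      CellGrid A p u u' q v v' (.cons Δ r)

/-- The sequence of all the `θᵢⱼ`. -/
def CellGrid.top {A : VDGraph.{w}} : {a b c d e f : A.Ob} → {p : HPath A.Hor a b} → {u : a ⟶ c} →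
    {u' : b ⟶ d} → {q : HPath A.Hor c d} → {v : c ⟶ e} → {v' : d ⟶ f} → {r : HPath A.Hor e f} →
    A.CellGrid p u u' q v v' r → A.CellSeq p u u' q
  | _, _, _, _, _, _, _, _, _, _, _, _, _, .nil u _ => .nil u
  | _, _, _, _, _, _, _, _, _, _, _, _, _, .cons Θ _ G hp hq => Θ.append G.top hp hq

/-- The sequence of the `κᵢ`. -/
def CellGrid.bot {A : VDGraph.{w}} : {a b c d e f : A.Ob} → {p : HPath A.Hor a b} → {u : a ⟶ c} →
    {u' : b ⟶ d} → {q : HPath A.Hor c d} → {v : c ⟶ e} → {v' : d ⟶ f} → {r : HPath A.Hor e f} →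
    A.CellGrid p u u' q v v' r → A.CellSeq q v v' r
  | _, _, _, _, _, _, _, _, _, _, _, _, _, .nil _ v => .nil v
  | _, _, _, _, _, _, _, _, _, _, _, _, _, .cons _ κ G _ hq => .cons κ G.bot hq

/-- The type of a vertical composition operation. The edges of the composite multicell are any
vertical morphisms `x, x'` that are equal to the two composite edges. -/
abbrev CompOp (A : VDGraph.{w}) : Type w :=
  ∀ {a b c d e f : A.Ob} {p : HPath A.Hor a b} {u : a ⟶ c} {u' : b ⟶ d} {q : HPath A.Hor c d}
    {v : c ⟶ e} {v' : d ⟶ f} {Δ : A.Hor e f} {x : a ⟶ e} {x' : b ⟶ f},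
    A.CellSeq p u u' q → A.Cell q v v' Δ → u ≫ v = x → u' ≫ v' = x' → A.Cell p x x' Δ

/-- The type of an operation that provides vertical identity cells. -/
abbrev IdOp (A : VDGraph.{w}) : Type w :=
  ∀ {a b : A.Ob} (Γ : A.Hor a b) {x : a ⟶ a} {x' : b ⟶ b}, 𝟙 a = x → 𝟙 b = x' →
    A.Cell (.single Γ) x x' Γ

/-- The sequence of identity cells on a path. -/
def idSeq {A : VDGraph.{w}} (hid : A.IdOp) : {a b : A.Ob} → (p : HPath A.Hor a b) →
    A.CellSeq p (𝟙 a) (𝟙 b) p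
  | _, _, .nil a => .nil (𝟙 a)
  | _, _, .cons Γ p => .cons (hid Γ rfl rfl) (idSeq hid p) rfl

/-- The sequence of the composites `κᵢ ∘ (θᵢ₁, …, θᵢₙ)`. -/
def CellGrid.comps {A : VDGraph.{w}} (comp : A.CompOp) : {a b c d e f : A.Ob} →
    {p : HPath A.Hor a b} → {u : a ⟶ c} →
    {u' : b ⟶ d} → {q : HPath A.Hor c d} → {v : c ⟶ e} → {v' : d ⟶ f} → {r : HPath A.Hor e f} →
    A.CellGrid p u u' q v v' r → A.CellSeq p (u ≫ v) (u' ≫ v') r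
  | _, _, _, _, _, _, _, _, _, _, _, _, _, .nil u v => .nil (u ≫ v)
  | _, _, _, _, _, _, _, _, _, _, _, _, _, .cons Θ κ G hp _ =>
    .cons (comp Θ κ rfl rfl) (G.comps comp) hp

end VDGraph

/-- Virtual double categories whose sets of objects, vertical morphisms, horizontal morphisms and
multicells are in `Type w`. -/
structure VDC : Type (w + 1) extends VDGraph.{w} where
  /-- Vertical identity cells. -/
  hid : toVDGraph.IdOp
  /-- Composition `κ ∘ (θ₁, …, θₘ)` of multicells. -/
  comp : toVDGraph.CompOp
  comp_id : ∀ {a b c d : Ob} {p : HPath Hor a b} {u : a ⟶ c} {u' : b ⟶ d} {Δ : Hor c d}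
    (κ : Cell p u u' Δ),
    comp (VDGraph.idSeq hid p) κ (Category.id_comp u) (Category.id_comp u') = κ
  id_comp : ∀ {a b c d : Ob} {p : HPath Hor a b} {u : a ⟶ c} {u' : b ⟶ d} {Δ : Hor c d}
    (θ : Cell p u u' Δ),
    comp (VDGraph.CellSeq.single θ) (hid Δ rfl rfl) (Category.comp_id u) (Category.comp_id u') = θ
  assoc : ∀ {a b c d e f g h : Ob} {p : HPath Hor a b} {u : a ⟶ c} {u' : b ⟶ d}
    {q : HPath Hor c d} {v : c ⟶ e} {v' : d ⟶ f} {r : HPath Hor e f} {x : e ⟶ g} {x' : f ⟶ h}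
    {Δ : Hor g h} (G : toVDGraph.CellGrid p u u' q v v' r) (κ : Cell r x x' Δ),
    comp G.top (comp G.bot κ rfl rfl) rfl rfl =
      comp (G.comps comp) κ (Category.assoc u v x) (Category.assoc u' v' x')

namespace VDGraph

/-- A multicell together with its boundary. Used to compare multicells with different, but
propositionally equal, boundaries. -/
structure CellTot (A : VDGraph.{w}) : Type w where
  {a b c d : A.Ob}
  {p : HPath A.Hor a b}
  {u : a ⟶ c}
  {u' : b ⟶ d}
  {Δ : A.Hor c d}
  θ : A.Cell p u u' Δ

/-- A sequence of multicells together with its boundary. -/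
structure SeqTot (A : VDGraph.{w}) : Type w where
  {a b c d : A.Ob}
  {p : HPath A.Hor a b}
  {u : a ⟶ c}
  {u' : b ⟶ d}
  {q : HPath A.Hor c d}
  Θ : A.CellSeq p u u' q

/-- A horizontal morphism together with its domain and codomain. -/
structure HorTot (A : VDGraph.{w}) : Type w where
  {a b : A.Ob}
  Γ : A.Hor a b

/-- A vertical morphism together with its domain and codomain. -/
structure VerTot (A : VDGraph.{w}) : Type w where
  {a b : A.Ob}
  f : a ⟶ b

/-- A vertical morphism with domain `a`, together with its codomain. -/
structure VerFrom (A : VDGraph.{w}) (a : A.Ob) : Type w where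
  {b : A.Ob}
  f : a ⟶ b

/-- A multicell with top path `p`, together with the rest of its boundary. -/
structure CellFrom (A : VDGraph.{w}) {a b : A.Ob} (p : HPath A.Hor a b) : Type w where
  {c d : A.Ob}
  {u : a ⟶ c}
  {u' : b ⟶ d}
  {Δ : A.Hor c d}
  θ : A.Cell p u u' Δ

/-- Transport of a multicell along an equality of top paths. -/
def castTop {A : VDGraph.{w}} {a b c d : A.Ob} {p p' : HPath A.Hor a b} {u : a ⟶ c} {u' : b ⟶ d}
    {Δ : A.Hor c d} (h : p = p') (θ : A.Cell p u u' Δ) : A.Cell p' u u' Δ := h ▸ θ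

theorem tot_castTop {A : VDGraph.{w}} {a b c d : A.Ob} {p p' : HPath A.Hor a b} {u : a ⟶ c}
    {u' : b ⟶ d} {Δ : A.Hor c d} (h : p = p') (θ : A.Cell p u u' Δ) :
    CellTot.mk (castTop h θ) = CellTot.mk θ := by subst h; rfl

theorem eq_of_tot {A : VDGraph.{w}} {a b c d : A.Ob} {p : HPath A.Hor a b} {u : a ⟶ c}
    {u' : b ⟶ d} {Δ : A.Hor c d} {θ θ' : A.Cell p u u' Δ} (h : CellTot.mk θ = CellTot.mk θ') :
    θ = θ' := by cases h; rfl

theorem seqTot_cons {A : VDGraph.{w}}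
    {a a₁ b c c₁ d : A.Ob} {p₁ : HPath A.Hor a a₁} {u : a ⟶ c} {u₁ : a₁ ⟶ c₁}
    {Δ : A.Hor c c₁} {p₂ : HPath A.Hor a₁ b} {u' : b ⟶ d} {q : HPath A.Hor c₁ d}
    {p : HPath A.Hor a b} (θ : A.Cell p₁ u u₁ Δ) (Θ : CellSeq A p₂ u₁ u' q)
    (hp : p₁.append p₂ = p)
    {xa xa₁ xb xc xc₁ xd : A.Ob} {xp₁ : HPath A.Hor xa xa₁} {xu : xa ⟶ xc} {xu₁ : xa₁ ⟶ xc₁}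
    {xΔ : A.Hor xc xc₁} {xp₂ : HPath A.Hor xa₁ xb} {xu' : xb ⟶ xd} {xq : HPath A.Hor xc₁ xd}
    {xp : HPath A.Hor xa xb} (xθ : A.Cell xp₁ xu xu₁ xΔ) (xΘ : CellSeq A xp₂ xu₁ xu' xq)
    (xhp : xp₁.append xp₂ = xp) (h1 : CellTot.mk θ = CellTot.mk xθ)
    (h2 : SeqTot.mk Θ = SeqTot.mk xΘ) :
    SeqTot.mk (CellSeq.cons θ Θ hp) = SeqTot.mk (CellSeq.cons xθ xΘ xhp) := by
  cases h1; cases h2; subst hp xhp; rfl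

end VDGraph

namespace VDC
open VDGraph

theorem tot_comp (A : VDC.{w}) {a b c d e f : A.Ob} {p : HPath A.Hor a b} {u : a ⟶ c} {u' : b ⟶ d}
    {q : HPath A.Hor c d} {v : c ⟶ e} {v' : d ⟶ f} {Δ : A.Hor e f} {x : a ⟶ e} {x' : b ⟶ f}
    (Θ : A.CellSeq p u u' q) (κ : A.Cell q v v' Δ) (hx : u ≫ v = x) (hx' : u' ≫ v' = x')
    {a₁ b₁ c₁ d₁ e₁ f₁ : A.Ob} {p₁ : HPath A.Hor a₁ b₁} {u₁ : a₁ ⟶ c₁} {u₁' : b₁ ⟶ d₁}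
    {q₁ : HPath A.Hor c₁ d₁} {v₁ : c₁ ⟶ e₁} {v₁' : d₁ ⟶ f₁} {Δ₁ : A.Hor e₁ f₁} {x₁ : a₁ ⟶ e₁}
    {x₁' : b₁ ⟶ f₁}
    (Θ₁ : A.CellSeq p₁ u₁ u₁' q₁) (κ₁ : A.Cell q₁ v₁ v₁' Δ₁) (hx₁ : u₁ ≫ v₁ = x₁)
    (hx₁' : u₁' ≫ v₁' = x₁') (h1 : SeqTot.mk Θ = SeqTot.mk Θ₁) (h2 : CellTot.mk κ = CellTot.mk κ₁) :
    CellTot.mk (A.comp Θ κ hx hx') = CellTot.mk (A.comp Θ₁ κ₁ hx₁ hx₁') := by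
  cases h1; cases h2; subst hx hx' hx₁ hx₁'; rfl

theorem tot_hid (A : VDC.{w}) {a b : A.Ob} (Γ : A.Hor a b) {x : a ⟶ a} {x' : b ⟶ b}
    (h : 𝟙 a = x) (h' : 𝟙 b = x') :
    CellTot.mk (A.hid Γ h h') = CellTot.mk (A.hid Γ rfl rfl) := by
  subst h h'; rfl

end VDC

/-- Maps of the underlying graphs of virtual double categories. -/
structure VDGraphHom (A B : VDGraph.{w}) : Type w where
  /-- The functor between the vertical categories. -/
  toFunctor : A.Ob ⥤ B.Ob
  /-- The map on horizontal morphisms. -/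
  hor : {a b : A.Ob} → A.Hor a b → B.Hor (toFunctor.obj a) (toFunctor.obj b)
  /-- The map on multicells. -/
  cell : {a b c d : A.Ob} → {p : HPath A.Hor a b} → {u : a ⟶ c} → {u' : b ⟶ d} →
    {Δ : A.Hor c d} → A.Cell p u u' Δ →
    B.Cell (p.map toFunctor.obj hor) (toFunctor.map u) (toFunctor.map u') (hor Δ)

namespace VDGraphHom
open VDGraph

variable {A B C : VDGraph.{w}}

/-- The image of a path of horizontal morphisms. -/
abbrev path (F : VDGraphHom A B) {a b : A.Ob} (p : HPath A.Hor a b) :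
    HPath B.Hor (F.toFunctor.obj a) (F.toFunctor.obj b) := p.map F.toFunctor.obj F.hor

/-- The image of a sequence of multicells. -/
def seq (F : VDGraphHom A B) : {a b c d : A.Ob} → {p : HPath A.Hor a b} → {u : a ⟶ c} →
    {u' : b ⟶ d} → {q : HPath A.Hor c d} → A.CellSeq p u u' q →
    B.CellSeq (F.path p) (F.toFunctor.map u) (F.toFunctor.map u') (F.path q)
  | _, _, _, _, _, _, _, _, .nil u => .nil (F.toFunctor.map u)
  | _, _, _, _, _, _, _, _, .cons θ Θ hp =>
    .cons (F.cell θ) (F.seq Θ) ((HPath.map_append _ _ _ _).trans (congrArg F.path hp))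

/-- The action on horizontal morphisms with unspecified boundary. -/
def horTot (F : VDGraphHom A B) (Γ : A.HorTot) : B.HorTot := ⟨F.hor Γ.Γ⟩

/-- The action on vertical morphisms with unspecified boundary. -/
def verTot (F : VDGraphHom A B) (f : A.VerTot) : B.VerTot := ⟨F.toFunctor.map f.f⟩

/-- The action on multicells with unspecified boundary. -/
def cellTot (F : VDGraphHom A B) (θ : A.CellTot) : B.CellTot := ⟨F.cell θ.θ⟩

/-- The action on sequences of multicells with unspecified boundary. -/
def seqTot (F : VDGraphHom A B) (Θ : A.SeqTot) : B.SeqTot := ⟨F.seq Θ.Θ⟩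

/-- The action on vertical morphisms with a given domain. -/
def verFrom (F : VDGraphHom A B) (a : A.Ob) (f : A.VerFrom a) :
    B.VerFrom (F.toFunctor.obj a) := ⟨F.toFunctor.map f.f⟩

/-- The action on multicells with a given top path. -/
def cellFrom (F : VDGraphHom A B) {a b : A.Ob} (p : HPath A.Hor a b) (θ : A.CellFrom p) :
    B.CellFrom (F.path p) := ⟨F.cell θ.θ⟩

theorem path_comp (F : VDGraphHom A B) (G : VDGraphHom B C) : {a b : A.Ob} →
    (p : HPath A.Hor a b) → G.path (F.path p) =
      p.map (F.toFunctor ⋙ G.toFunctor).obj (fun Γ => G.hor (F.hor Γ))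
  | _, _, .nil _ => rfl
  | _, _, .cons Γ p => congrArg (HPath.cons (G.hor (F.hor Γ))) (path_comp F G p)

/-- The identity. -/
def id (A : VDGraph.{w}) : VDGraphHom A A where
  toFunctor := 𝟭 A.Ob
  hor Γ := Γ
  cell θ := castTop (HPath.map_id _).symm θ

/-- Composition. -/
def comp (F : VDGraphHom A B) (G : VDGraphHom B C) : VDGraphHom A C where
  toFunctor := F.toFunctor ⋙ G.toFunctor
  hor Γ := G.hor (F.hor Γ)
  cell θ := castTop (path_comp F G _) (G.cell (F.cell θ))

theorem tot_id {a b c d : A.Ob} {p : HPath A.Hor a b} {u : a ⟶ c} {u' : b ⟶ d} {Δ : A.Hor c d}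
    (θ : A.Cell p u u' Δ) : CellTot.mk ((id A).cell θ) = CellTot.mk θ := tot_castTop _ θ

theorem tot_comp (F : VDGraphHom A B) (G : VDGraphHom B C) {a b c d : A.Ob} {p : HPath A.Hor a b}
    {u : a ⟶ c} {u' : b ⟶ d} {Δ : A.Hor c d} (θ : A.Cell p u u' Δ) :
    CellTot.mk ((F.comp G).cell θ) = CellTot.mk (G.cell (F.cell θ)) := tot_castTop _ _

theorem seqTot_id {a b c d : A.Ob} {p : HPath A.Hor a b} {u : a ⟶ c} {u' : b ⟶ d}
    {q : HPath A.Hor c d} (Θ : A.CellSeq p u u' q) : SeqTot.mk ((id A).seq Θ) = SeqTot.mk Θ := by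
  induction Θ with
  | nil u => rfl
  | cons θ Θ hp ih => exact seqTot_cons _ _ _ _ _ _ (tot_id θ) ih

theorem seqTot_comp (F : VDGraphHom A B) (G : VDGraphHom B C) {a b c d : A.Ob}
    {p : HPath A.Hor a b} {u : a ⟶ c} {u' : b ⟶ d} {q : HPath A.Hor c d}
    (Θ : A.CellSeq p u u' q) : SeqTot.mk ((F.comp G).seq Θ) = SeqTot.mk (G.seq (F.seq Θ)) := by
  induction Θ with
  | nil u => rfl
  | cons θ Θ hp ih => exact seqTot_cons _ _ _ _ _ _ (tot_comp F G θ) ih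

theorem ext_cell {T : A.Ob ⥤ B.Ob} {h : ∀ {a b : A.Ob}, A.Hor a b → B.Hor (T.obj a) (T.obj b)}
    {c₁ c₂ : ∀ {a b c d : A.Ob} {p : HPath A.Hor a b} {u : a ⟶ c} {u' : b ⟶ d}
      {Δ : A.Hor c d}, A.Cell p u u' Δ → B.Cell (p.map T.obj h) (T.map u) (T.map u') (h Δ)}
    (H : ∀ {a b c d : A.Ob} {p : HPath A.Hor a b} {u : a ⟶ c} {u' : b ⟶ d}
      {Δ : A.Hor c d} (θ : A.Cell p u u' Δ), CellTot.mk (c₁ θ) = CellTot.mk (c₂ θ)) :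
    VDGraphHom.mk T h c₁ = VDGraphHom.mk T h c₂ := by
  congr 1
  funext a b c d p u u' Δ θ
  exact eq_of_tot (H θ)

end VDGraphHom

/-- Virtual double functors. -/
structure VDFunctor (A B : VDC.{w}) : Type w extends
    VDGraphHom A.toVDGraph B.toVDGraph where
  cell_hid : ∀ {a b : A.Ob} (Γ : A.Hor a b), cell (A.hid Γ rfl rfl) =
    B.hid (hor Γ) (toFunctor.map_id a).symm (toFunctor.map_id b).symm
  cell_comp : ∀ {a b c d e f : A.Ob} {p : HPath A.Hor a b} {u : a ⟶ c} {u' : b ⟶ d}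
    {q : HPath A.Hor c d} {v : c ⟶ e} {v' : d ⟶ f} {Δ : A.Hor e f}
    (Θ : A.CellSeq p u u' q) (κ : A.Cell q v v' Δ),
    cell (A.comp Θ κ rfl rfl) = B.comp (toVDGraphHom.seq Θ) (cell κ)
      (toFunctor.map_comp u v).symm (toFunctor.map_comp u' v').symm

namespace VDFunctor
open VDGraph

variable {A B C D : VDC.{w}}

theorem ext_graph {F G : VDFunctor A B} (h : F.toVDGraphHom = G.toVDGraphHom) : F = G := by
  cases F; cases G; cases h; rfl

theorem cellTot_hid (F : VDFunctor A B) {a b : A.Ob} (Γ : A.Hor a b) {x : a ⟶ a} {x' : b ⟶ b}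
    (h : 𝟙 a = x) (h' : 𝟙 b = x') :
    CellTot.mk (F.cell (A.hid Γ h h')) = CellTot.mk (B.hid (F.hor Γ) rfl rfl) := by
  subst h h'
  rw [F.cell_hid]
  exact B.tot_hid _ _ _

theorem cell_comp' (F : VDFunctor A B) {a b c d e f : A.Ob} {p : HPath A.Hor a b} {u : a ⟶ c}
    {u' : b ⟶ d} {q : HPath A.Hor c d} {v : c ⟶ e} {v' : d ⟶ f} {Δ : A.Hor e f} {x : a ⟶ e}
    {x' : b ⟶ f} (Θ : A.CellSeq p u u' q) (κ : A.Cell q v v' Δ) (hx : u ≫ v = x)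
    (hx' : u' ≫ v' = x') :
    F.cell (A.comp Θ κ hx hx') = B.comp (F.seq Θ) (F.cell κ)
      ((F.toFunctor.map_comp u v).symm.trans (congrArg F.toFunctor.map hx))
      ((F.toFunctor.map_comp u' v').symm.trans (congrArg F.toFunctor.map hx')) := by
  subst hx hx'
  exact F.cell_comp Θ κ

/-- The identity virtual double functor. -/
def id (A : VDC.{w}) : VDFunctor A A where
  toVDGraphHom := VDGraphHom.id A.toVDGraph
  cell_hid _ := eq_of_tot (VDGraphHom.tot_id _)
  cell_comp Θ κ := eq_of_tot ((VDGraphHom.tot_id _).trans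
    (A.tot_comp _ _ _ _ _ _ _ _ (VDGraphHom.seqTot_id Θ).symm (VDGraphHom.tot_id κ).symm))

/-- Composition of virtual double functors. -/
def comp (F : VDFunctor A B) (G : VDFunctor B C) : VDFunctor A C where
  toVDGraphHom := F.toVDGraphHom.comp G.toVDGraphHom
  cell_hid Γ := eq_of_tot ((VDGraphHom.tot_comp _ _ _).trans
    ((congrArg (fun θ => G.cellTot ⟨θ⟩) (F.cell_hid Γ)).trans
      ((G.cellTot_hid _ _ _).trans (C.tot_hid _ _ _).symm)))
  cell_comp Θ κ := eq_of_tot (by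
    refine (VDGraphHom.tot_comp _ _ _).trans ?_
    rw [F.cell_comp, cell_comp']
    exact C.tot_comp _ _ _ _ _ _ _ _ (VDGraphHom.seqTot_comp _ _ Θ).symm
      (VDGraphHom.tot_comp _ _ κ).symm)

/-- Virtual double categories and virtual double functors form a category, the underlying
category of the `2`-category of virtual double categories. -/
instance : Category VDC.{w} where
  Hom := VDFunctor
  id := id
  comp := comp
  id_comp F := ext_graph (VDGraphHom.ext_cell (fun θ => by
    refine (VDGraphHom.tot_comp _ _ _).trans ?_
    exact congrArg F.cellTot (VDGraphHom.tot_id θ)))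
  comp_id F := ext_graph (VDGraphHom.ext_cell (fun θ => by
    refine (VDGraphHom.tot_comp _ _ _).trans ?_
    exact VDGraphHom.tot_id _))
  assoc F G H := ext_graph (VDGraphHom.ext_cell (fun θ => by
    refine (VDGraphHom.tot_comp _ _ _).trans
      (Eq.trans ?_ (VDGraphHom.tot_comp _ _ _).symm)
    exact (congrArg H.cellTot (VDGraphHom.tot_comp _ _ θ)).trans
      (VDGraphHom.tot_comp G.toVDGraphHom H.toVDGraphHom (F.cell θ)).symm))

end VDFunctor

/-! ### Vertical transformations -/

/-- The sequence of the cells `α_Γ₁, …, α_Γₙ` for a path `Γ₁, …, Γₙ`. -/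
def transSeq {A B : VDC.{w}} {F G : VDFunctor A B} (nat : F.toFunctor ⟶ G.toFunctor)
    (cell : ∀ {a b : A.Ob} (Γ : A.Hor a b),
      B.Cell (.single (F.hor Γ)) (nat.app a) (nat.app b) (G.hor Γ)) :
    {a b : A.Ob} → (p : HPath A.Hor a b) →
      B.CellSeq (F.path p) (nat.app a) (nat.app b) (G.path p)
  | _, _, .nil a => .nil (nat.app a)
  | _, _, .cons Γ p => .cons (cell Γ) (transSeq nat cell p) rfl

/-- Vertical transformations, the `2`-cells of the `2`-category of virtual double categories. -/
structure VDTrans {A B : VDC.{w}} (F G : VDFunctor A B) : Type w where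
  /-- The natural transformation between the vertical parts. -/
  nat : F.toFunctor ⟶ G.toFunctor
  /-- The cells at the horizontal morphisms. -/
  cell : {a b : A.Ob} → (Γ : A.Hor a b) →
    B.Cell (.single (F.hor Γ)) (nat.app a) (nat.app b) (G.hor Γ)
  naturality : ∀ {a b c d : A.Ob} {p : HPath A.Hor a b} {u : a ⟶ c} {u' : b ⟶ d} {Δ : A.Hor c d}
    (θ : A.Cell p u u' Δ),
    B.comp (VDGraph.CellSeq.single (F.cell θ)) (cell Δ) (nat.naturality u) (nat.naturality u') =
      B.comp (transSeq nat cell p) (G.cell θ) rfl rfl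

namespace VDTrans
open VDGraph

theorem transSeq_whisker {A B C : VDC.{w}} {F G : VDFunctor A B} (α : VDTrans F G)
    (H : VDFunctor B C) {a b : A.Ob} (p : HPath A.Hor a b) :
    SeqTot.mk (transSeq (F := F.comp H) (G := G.comp H)
      (Functor.whiskerRight α.nat H.toFunctor) (fun Γ => H.cell (α.cell Γ)) p) =
    SeqTot.mk (H.seq (transSeq α.nat α.cell p)) := by
  induction p with
  | nil a => rfl
  | cons Γ p ih => exact seqTot_cons _ _ _ _ _ _ rfl ih

theorem seqTot_single {A : VDGraph.{w}} {a b c d : A.Ob} {p : HPath A.Hor a b} {u : a ⟶ c}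
    {u' : b ⟶ d} {Δ : A.Hor c d} {θ : A.Cell p u u' Δ} {a₁ b₁ c₁ d₁ : A.Ob}
    {p₁ : HPath A.Hor a₁ b₁} {u₁ : a₁ ⟶ c₁} {u₁' : b₁ ⟶ d₁} {Δ₁ : A.Hor c₁ d₁}
    {θ₁ : A.Cell p₁ u₁ u₁' Δ₁} (h : CellTot.mk θ = CellTot.mk θ₁) :
    SeqTot.mk (CellSeq.single θ) = SeqTot.mk (CellSeq.single θ₁) := by
  cases h; rfl

/-- Whiskering of a vertical transformation with a virtual double functor. -/
def whiskerRight {A B C : VDC.{w}} {F G : VDFunctor A B} (α : VDTrans F G) (H : VDFunctor B C) :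
    VDTrans (F.comp H) (G.comp H) where
  nat := Functor.whiskerRight α.nat H.toFunctor
  cell Γ := H.cell (α.cell Γ)
  naturality {a b c d p u u' Δ} θ := eq_of_tot (by
    have key := congrArg (fun θ => H.cellTot ⟨θ⟩) (α.naturality θ)
    refine Eq.trans ?_ (key.trans ?_)
    · refine Eq.trans ?_ (congrArg CellTot.mk (H.cell_comp' _ _ _ _)).symm
      refine C.tot_comp _ _ _ _ _ _ _ _ ?_ rfl
      exact (seqTot_single (VDGraphHom.tot_comp _ _ θ)).trans
        (seqTot_cons _ _ _ _ _ _ rfl rfl)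
    · refine (congrArg CellTot.mk (H.cell_comp' _ _ _ _)).trans ?_
      exact C.tot_comp _ _ _ _ _ _ _ _ (transSeq_whisker α H p).symm
        (VDGraphHom.tot_comp _ _ θ).symm)

end VDTrans

/-- A pullback square in the `2`-category of virtual double categories, in the strict
`2`-categorical sense: for every `W`, the category of virtual double functors `W ⟶ P` and vertical
transformations is the pullback of the corresponding categories for `A`, `B` and `C`. The
existence and uniqueness for functors is the first field, and that for transformations is the
second one. -/
structure Is2Pullback {P A B C : VDC.{w}} (fst : P ⟶ A) (snd : P ⟶ B) (f : A ⟶ C) (g : B ⟶ C) :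
    Prop where
  isPullback : IsPullback fst snd f g
  existsUnique_trans : ∀ {W : VDC.{w}} (H K : W ⟶ P) (α : VDTrans (H ≫ fst) (K ≫ fst))
    (β : VDTrans (H ≫ snd) (K ≫ snd)), HEq (α.whiskerRight f) (β.whiskerRight g) →
    ∃! σ : VDTrans H K, σ.whiskerRight fst = α ∧ σ.whiskerRight snd = β

/-! ### Discrete opfibrations -/

namespace VDFunctor

/-- Discrete opfibrations: each vertical morphism `P x ⟶ y` has a unique lift with domain `x`, and
each multicell with top path `P Φ₁, …, P Φₙ` has a unique lift with top path `Φ₁, …, Φₙ`. (The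
edges of the lifted multicell are necessarily the lifts of the given edges.) -/
structure IsDiscreteOpfibration {X Y : VDC.{w}} (P : VDFunctor X Y) : Prop where
  existsUnique_ver : ∀ (x : X.Ob) (v : Y.VerFrom (P.toFunctor.obj x)),
    ∃! u : X.VerFrom x, P.verFrom x u = v
  existsUnique_cell : ∀ {x x' : X.Ob} (p : HPath X.Hor x x') (ν : Y.CellFrom (P.path p)),
    ∃! χ : X.CellFrom p, P.cellFrom p χ = ν

/-- The fibre of a virtual double functor at an object. -/
abbrev ObFib {X Y : VDC.{w}} (P : VDFunctor X Y) (y : Y.Ob) : Type w :=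
  {x : X.Ob // P.toFunctor.obj x = y}

/-- The fibre of a virtual double functor at a horizontal morphism. -/
abbrev HorFib {X Y : VDC.{w}} (P : VDFunctor X Y) {y y' : Y.Ob} (Ψ : Y.Hor y y') : Type w :=
  {Φ : X.HorTot // P.horTot Φ = ⟨Ψ⟩}

/-- The domain of a horizontal morphism in a fibre. -/
def HorFib.src {X Y : VDC.{w}} {P : VDFunctor X Y} {y y' : Y.Ob} {Ψ : Y.Hor y y'}
    (Φ : P.HorFib Ψ) : P.ObFib y := ⟨Φ.1.a, congrArg VDGraph.HorTot.a Φ.2⟩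

/-- The codomain of a horizontal morphism in a fibre. -/
def HorFib.tgt {X Y : VDC.{w}} {P : VDFunctor X Y} {y y' : Y.Ob} {Ψ : Y.Hor y y'}
    (Φ : P.HorFib Ψ) : P.ObFib y' := ⟨Φ.1.b, congrArg VDGraph.HorTot.b Φ.2⟩

/-- The fibres at objects and at horizontal morphisms are small, that is, they are in bijection
with types in `Type u`. -/
structure HasSmallFibres {X Y : VDC.{w}} (P : VDFunctor X Y) : Prop where
  small_ob : ∀ y : Y.Ob, Small.{u} (P.ObFib y)
  small_hor : ∀ {y y' : Y.Ob} (Ψ : Y.Hor y y'), Small.{u} (P.HorFib Ψ)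

end VDFunctor

/-! ### Families in a virtual double category -/

/-- A graph of index sets: each vertex `z` has a set `El z` of elements, and each edge from `z`
to `z'` has a set of elements, each of which lies over an element of `z` and an element of `z'`. -/
structure IndexGraph where
  /-- Vertices. -/
  Ob : Type k
  /-- Elements of a vertex. -/
  El : Ob → Type i
  /-- Edges. -/
  Hor : Ob → Ob → Type k
  /-- Elements of an edge over given elements of its ends. -/
  HEl : {z z' : Ob} → Hor z z' → El z → El z' → Type i

namespace IndexGraph

variable (J : IndexGraph.{i, k}) (A : VDC.{w})

/-- A vertex `z` with a family of objects of `A` indexed by the elements of `z`. -/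
structure FOb : Type (max i k w) where
  z : J.Ob
  a : J.El z → A.Ob

variable {J A}

/-- A function `fn` between the index sets and a family of vertical morphisms `X_i ⟶ Y_(fn i)`. -/
structure FVer (X Y : J.FOb A) : Type (max i k w) where
  fn : J.El X.z → J.El Y.z
  mor : ∀ i : J.El X.z, X.a i ⟶ Y.a (fn i)

/-- An edge with a family of horizontal morphisms indexed by its elements. -/
structure FHor (X Y : J.FOb A) : Type (max i k w) where
  Ψ : J.Hor X.z Y.z
  Γ : {i : J.El X.z} → {j : J.El Y.z} → J.HEl Ψ i j → A.Hor (X.a i) (Y.a j)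

instance : Category.{max i k w} (J.FOb A) where
  Hom := FVer
  id X := ⟨fun i => i, fun i => 𝟙 (X.a i)⟩
  comp f g := ⟨fun i => g.fn (f.fn i), fun i => f.mor i ≫ g.mor (f.fn i)⟩
  id_comp f := congrArg (FVer.mk f.fn) (funext fun _ => Category.id_comp _)
  comp_id f := congrArg (FVer.mk f.fn) (funext fun _ => Category.comp_id _)
  assoc f g h := congrArg (FVer.mk fun i => h.fn (g.fn (f.fn i)))
    (funext fun _ => Category.assoc _ _ _)

/-- The elements of the iterated fibre product of the index sets of a path `S₁, …, Sₙ`, that is,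
the tuples `(s₁, …, sₙ)` where the domain of `s₁` is `i`, the codomain of `sₙ` is `j`, and the
codomain of each `sₖ` is the domain of `sₖ₊₁`. For `n = 0` they are the elements `i = j`. -/
inductive Tup : {X Y : J.FOb A} → HPath FHor X Y → J.El X.z → J.El Y.z → Type (max i k w)
  | nil {X : J.FOb A} (i : J.El X.z) : Tup (.nil X) i i
  | cons {X Y Z : J.FOb A} {S : FHor X Y} {p : HPath FHor Y Z} {i : J.El X.z} {j : J.El Y.z}
      {l : J.El Z.z} (s : J.HEl S.Ψ i j) (t : Tup p j l) : Tup (.cons S p) i l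

/-- The path of horizontal morphisms of `A` at a tuple. -/
def Tup.path : {X Y : J.FOb A} → {p : HPath FHor X Y} → {i : J.El X.z} → {j : J.El Y.z} →
    Tup p i j → HPath A.Hor (X.a i) (Y.a j)
  | _, _, _, _, _, .nil (X := X) i => .nil (X.a i)
  | _, _, _, _, _, .cons (S := S) s t => .cons (S.Γ s) t.path

/-- A multicell between families consists of a function from the tuples of the top path to the
elements of the bottom edge and a family of multicells of `A` indexed by the tuples. -/
structure FCell {X Y X' Y' : J.FOb A} (p : HPath FHor X Y) (f : X ⟶ X') (f' : Y ⟶ Y')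
    (S : FHor X' Y') : Type (max i k w) where
  fn : {i : J.El X.z} → {j : J.El Y.z} → Tup p i j → J.HEl S.Ψ (f.fn i) (f'.fn j)
  cell : {i : J.El X.z} → {j : J.El Y.z} → (t : Tup p i j) →
    A.Cell t.path (f.mor i) (f'.mor j) (S.Γ (fn t))

variable (J A) in
/-- The objects, vertical morphisms, horizontal morphisms and multicells of families. -/
abbrev famGraph : VDGraph.{max i k w} where
  Ob := J.FOb A
  Hor := FHor
  Cell := FCell

end IndexGraph

namespace IndexGraph
open VDGraph

variable {J : IndexGraph.{i, k}} {A : VDC.{w}}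

/-- Concatenation of tuples. -/
def Tup.append : {X Y Z : J.FOb A} → {p₁ : HPath FHor X Y} → {p₂ : HPath FHor Y Z} →
    {i : J.El X.z} → {j : J.El Y.z} → {l : J.El Z.z} → Tup p₁ i j → Tup p₂ j l →
    Tup (p₁.append p₂) i l
  | _, _, _, _, _, _, _, _, .nil _, t' => t'
  | _, _, _, _, _, _, _, _, .cons s t, t' => .cons s (t.append t')

theorem Tup.path_append {X Y Z : J.FOb A} {p₁ : HPath FHor X Y} {p₂ : HPath FHor Y Z}
    {i : J.El X.z} {j : J.El Y.z} {l : J.El Z.z} (t : Tup p₁ i j) (t' : Tup p₂ j l) :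
    t.path.append t'.path = (t.append t').path := by
  induction t with
  | nil _ => rfl
  | cons s t ih => exact congrArg (HPath.cons _) (ih t')

/-- A tuple over a concatenation, split into two tuples. -/
structure Split {X Y Z : J.FOb A} (p₁ : HPath FHor X Y) (p₂ : HPath FHor Y Z)
    (i : J.El X.z) (l : J.El Z.z) : Type (max i k w) where
  {j : J.El Y.z}
  fst : Tup p₁ i j
  snd : Tup p₂ j l

/-- Splitting of a tuple over a concatenation. -/
def splitAppend : {X Y Z : J.FOb A} → (p₁ : HPath FHor X Y) → {p₂ : HPath FHor Y Z} →
    {i : J.El X.z} → {l : J.El Z.z} → Tup (p₁.append p₂) i l → Split p₁ p₂ i l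
  | _, _, _, .nil _, _, i, _, t => ⟨.nil i, t⟩
  | _, _, _, .cons S p₁, p₂, _, _, t =>
    match (t : Tup (.cons S (p₁.append p₂)) _ _) with
    | .cons s t => ⟨.cons s (splitAppend p₁ t).fst, (splitAppend p₁ t).snd⟩

/-- Splitting of a tuple over a path that is equal to a concatenation. -/
def split {X Y Z : J.FOb A} (p₁ : HPath FHor X Y) {p₂ : HPath FHor Y Z}
    {p : HPath FHor X Z} (hp : p₁.append p₂ = p) {i : J.El X.z} {l : J.El Z.z}
    (t : Tup p i l) : Split p₁ p₂ i l :=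
  match p, hp, t with
  | _, rfl, t => splitAppend p₁ t

theorem split_append {X Y Z : J.FOb A} {p₁ : HPath FHor X Y} {p₂ : HPath FHor Y Z}
    {i : J.El X.z} {j : J.El Y.z} {l : J.El Z.z} (t : Tup p₁ i j) (t' : Tup p₂ j l) :
    split p₁ rfl (t.append t') = ⟨t, t'⟩ := by
  induction t with
  | nil _ => rfl
  | cons s t ih =>
    have := ih t'
    simp only [split] at this ⊢
    simp only [Tup.append]
    simp only [splitAppend]
    rw [this]

theorem append_split {X Y Z : J.FOb A} (p₁ : HPath FHor X Y) {p₂ : HPath FHor Y Z}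
    {i : J.El X.z} {l : J.El Z.z} (t : Tup (p₁.append p₂) i l) :
    (split p₁ rfl t).fst.append (split p₁ rfl t).snd = t := by
  induction p₁ with
  | nil _ => rfl
  | cons S p ih =>
    cases t with
    | cons s t => exact congrArg (Tup.cons s) (ih t)

theorem split_path {X Y Z : J.FOb A} (p₁ : HPath FHor X Y) {p₂ : HPath FHor Y Z}
    {p : HPath FHor X Z} (hp : p₁.append p₂ = p) {i : J.El X.z} {l : J.El Z.z} (t : Tup p i l) :
    (split p₁ hp t).fst.path.append (split p₁ hp t).snd.path = t.path := by
  subst hp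
  rw [Tup.path_append, append_split]

/-- The effect of a sequence of multicells between families on a tuple: a tuple over the bottom
path, and a sequence of multicells of `A`. -/
structure Act {X Y X' Y' : J.FOb A} (q : HPath FHor X' Y') (f : X ⟶ X') (f' : Y ⟶ Y')
    {i : J.El X.z} {j : J.El Y.z} (r : HPath A.Hor (X.a i) (Y.a j)) : Type (max i k w) where
  res : Tup q (f.fn i) (f'.fn j)
  cells : A.CellSeq r (f.mor i) (f'.mor j) res.path

/-- The effect of a sequence of multicells between families on a tuple. -/
def act : {X Y X' Y' : J.FOb A} → {p : HPath FHor X Y} → {f : X ⟶ X'} → {f' : Y ⟶ Y'} →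
    {q : HPath FHor X' Y'} → (J.famGraph A).CellSeq p f f' q → {i : J.El X.z} → {j : J.El Y.z} →
    (t : Tup p i j) → Act q f f' t.path
  | _, _, _, _, _, _, _, _, .nil f, _, _, .nil i => ⟨.nil (f.fn i), .nil (f.mor i)⟩
  | _, _, _, _, _, _, _, _, .cons (p₁ := p₁) θ Θ hp, _, _, t =>
    ⟨.cons (θ.fn (split p₁ hp t).fst) (act Θ (split p₁ hp t).snd).res,
      .cons (θ.cell (split p₁ hp t).fst) (act Θ (split p₁ hp t).snd).cells (split_path p₁ hp t)⟩

/-- Transport of a multicell along equalities of its edges. -/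
def castEdge {X Y X' Y' : J.FOb A} {p : HPath FHor X Y} {f g : X ⟶ X'} {f' g' : Y ⟶ Y'}
    {S : FHor X' Y'} (h : f = g) (h' : f' = g') (θ : FCell p f f' S) : FCell p g g' S :=
  h ▸ h' ▸ θ

/-- Identity cells between families. -/
def famId : (J.famGraph A).IdOp := fun {X Y} S _ _ h h' =>
  castEdge (f := 𝟙 X) (f' := 𝟙 Y) h h'
    ⟨fun t => match t with
      | .cons s (.nil _) => s,
    fun t => match t with
      | .cons s (.nil _) => A.hid (S.Γ s) rfl rfl⟩

/-- Composition of multicells between families: `fn` of the composite sends a tuple `t` to the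
result of applying first the functions of the sequence `Θ` and then that of `κ`, and the
multicells of `A` are composed accordingly. -/
def famComp : (J.famGraph A).CompOp := fun {_ _ _ _ _ _ _ f f' _ g g' _ _ _} Θ κ h h' =>
  castEdge (f := f ≫ g) (f' := f' ≫ g') h h'
    ⟨fun t => FCell.fn κ (act Θ t).res,
      fun t => A.comp (act Θ t).cells (FCell.cell κ (act Θ t).res) rfl rfl⟩

/-- The value of a multicell between families at a tuple, with unspecified boundary. -/
structure Val {X' Y' : J.FOb A} (S : FHor X' Y') : Type (max i k w) where
  {i : J.El X'.z}
  {j : J.El Y'.z}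
  s : J.HEl S.Ψ i j
  {a b : A.Ob}
  {p : HPath A.Hor a b}
  {u : a ⟶ X'.a i}
  {u' : b ⟶ Y'.a j}
  θ : A.Cell p u u' (S.Γ s)

/-- The value of a multicell between families at a tuple. -/
def FCell.val {X Y X' Y' : J.FOb A} {p : HPath FHor X Y} {f : X ⟶ X'} {f' : Y ⟶ Y'}
    {S : FHor X' Y'} (θ : FCell p f f' S) {i : J.El X.z} {j : J.El Y.z} (t : Tup p i j) :
    Val S := ⟨θ.fn t, θ.cell t⟩

theorem val_castEdge {X Y X' Y' : J.FOb A} {p : HPath FHor X Y} {f g : X ⟶ X'} {f' g' : Y ⟶ Y'}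
    {S : FHor X' Y'} (h : f = g) (h' : f' = g') (θ : FCell p f f' S) {i : J.El X.z}
    {j : J.El Y.z} (t : Tup p i j) : (castEdge h h' θ).val t = θ.val t := by
  subst h h'; rfl

theorem FCell.ext_val {X Y X' Y' : J.FOb A} {p : HPath FHor X Y} {f : X ⟶ X'} {f' : Y ⟶ Y'}
    {S : FHor X' Y'} {θ θ' : FCell p f f' S}
    (h : ∀ {i : J.El X.z} {j : J.El Y.z} (t : Tup p i j), θ.val t = θ'.val t) : θ = θ' := by
  obtain ⟨fn, cell⟩ := θ
  obtain ⟨fn', cell'⟩ := θ'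
  have h1 : @fn = @fn' := by
    funext i j t
    have := h t
    simp only [FCell.val, Val.mk.injEq, heq_eq_eq, true_and] at this
    exact this.1
  subst h1
  congr 1
  funext i j t
  have := h t
  simp only [FCell.val, Val.mk.injEq, heq_eq_eq, true_and] at this
  exact this


theorem val_famId {X Y : J.FOb A} (S : FHor X Y) {x : X ⟶ X} {x' : Y ⟶ Y} (h : 𝟙 X = x)
    (h' : 𝟙 Y = x') {i : J.El X.z} {j : J.El Y.z} (s : J.HEl S.Ψ i j) :
    FCell.val (famId S h h') (.cons s (.nil j)) = ⟨s, A.hid (S.Γ s) rfl rfl⟩ :=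
  val_castEdge _ _ _ _

/-- The value of a composite at a tuple. -/
def compVal {X Y X' Y' X'' Y'' : J.FOb A} {f : X ⟶ X'} {f' : Y ⟶ Y'} {q : HPath FHor X' Y'}
    {g : X' ⟶ X''} {g' : Y' ⟶ Y''} {S : FHor X'' Y''} (κ : FCell q g g' S) {i : J.El X.z}
    {j : J.El Y.z} {r : HPath A.Hor (X.a i) (Y.a j)} (α : Act q f f' r) : Val S :=
  ⟨κ.fn α.res, A.comp α.cells (κ.cell α.res) rfl rfl⟩

theorem val_famComp {X Y X' Y' X'' Y'' : J.FOb A} {p : HPath FHor X Y} {f : X ⟶ X'}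
    {f' : Y ⟶ Y'} {q : HPath FHor X' Y'} {g : X' ⟶ X''} {g' : Y' ⟶ Y''} {S : FHor X'' Y''}
    {x : X ⟶ X''} {x' : Y ⟶ Y''} (Θ : (J.famGraph A).CellSeq p f f' q) (κ : FCell q g g' S)
    (h : f ≫ g = x) (h' : f' ≫ g' = x') {i : J.El X.z} {j : J.El Y.z} (t : Tup p i j) :
    FCell.val (famComp Θ κ h h') t =
      compVal κ (act Θ t) :=
  val_castEdge _ _ _ _

theorem val_congr {X' Y' : J.FOb A} {S : FHor X' Y'} {i : J.El X'.z}
    {j : J.El Y'.z} (s : J.HEl S.Ψ i j) {a b a₁ b₁ : A.Ob} {p : HPath A.Hor a b}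
    {u : a ⟶ X'.a i} {u' : b ⟶ Y'.a j} {θ : A.Cell p u u' (S.Γ s)} {p₁ : HPath A.Hor a₁ b₁}
    {u₁ : a₁ ⟶ X'.a i} {u₁' : b₁ ⟶ Y'.a j} {θ₁ : A.Cell p₁ u₁ u₁' (S.Γ s)}
    (h : CellTot.mk θ = CellTot.mk θ₁) : Val.mk s θ = Val.mk s θ₁ := by
  cases h; rfl

theorem nil_append {A : VDGraph.{w}} {a b c d : A.Ob} {p : HPath A.Hor a b} (u : a ⟶ c)
    {u' : b ⟶ d} {q : HPath A.Hor c d} (Θ : A.CellSeq p u u' q) (hp : (HPath.nil a).append p = p)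
    (hq : (HPath.nil c).append q = q) : (CellSeq.nil u).append Θ hp hq = Θ := rfl

theorem append_cons {A : VDGraph.{w}} {a a₁ b b₁ c c₁ d d₁ : A.Ob} {r₁ : HPath A.Hor a a₁}
    {u : a ⟶ c} {u₁ : a₁ ⟶ c₁} {Δ : A.Hor c c₁} {r₂ : HPath A.Hor a₁ b} {g : b ⟶ d}
    {q₁ : HPath A.Hor c₁ d} {p₁ : HPath A.Hor a b} (θ : A.Cell r₁ u u₁ Δ)
    (Θ : A.CellSeq r₂ u₁ g q₁) (hp₁ : r₁.append r₂ = p₁) {p₂ : HPath A.Hor b b₁}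
    {u' : b₁ ⟶ d₁} {q₂ : HPath A.Hor d d₁} (Θ' : A.CellSeq p₂ g u' q₂) {p : HPath A.Hor a b₁}
    (hp : p₁.append p₂ = p) {q : HPath A.Hor c₁ d₁} (hq : q₁.append q₂ = q)
    {p' : HPath A.Hor a₁ b₁} (h2 : r₂.append p₂ = p') (h3 : r₁.append p' = p) :
    (CellSeq.cons θ Θ hp₁).append Θ' hp (congrArg (HPath.cons Δ) hq) =
      CellSeq.cons θ (Θ.append Θ' h2 hq) h3 := by
  subst hp₁ hp hq h2; rfl

theorem split_eq {X Y Z : J.FOb A} {p₁ : HPath FHor X Y} {p₂ : HPath FHor Y Z}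
    {p : HPath FHor X Z} (hp : p₁.append p₂ = p)
    {i : J.El X.z} {j : J.El Y.z} {l : J.El Z.z} (t : Tup p i l) (t₁ : Tup p₁ i j)
    (t₂ : Tup p₂ j l) (h : HEq (t₁.append t₂) t) : split p₁ hp t = ⟨t₁, t₂⟩ := by
  subst hp; cases h; exact split_append t₁ t₂

theorem cons_heq {X Y Z : J.FOb A} {S : FHor X Y} {p p' : HPath FHor Y Z} (hp : p = p')
    {i : J.El X.z} {j : J.El Y.z} {l : J.El Z.z} (s : J.HEl S.Ψ i j) {t : Tup p j l}
    {t' : Tup p' j l} (h : HEq t t') : HEq (Tup.cons s t) (Tup.cons s t') := by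
  subst hp; cases h; rfl

theorem append_nil_heq {X Y : J.FOb A} {p : HPath FHor X Y} {i : J.El X.z} {j : J.El Y.z}
    (t : Tup p i j) : HEq (t.append (.nil j)) t := by
  induction t with
  | nil _ => rfl
  | cons s t ih => exact cons_heq (HPath.append_nil _) s ih

theorem append_assoc_heq {X Y Z W : J.FOb A} {p₁ : HPath FHor X Y} {p₂ : HPath FHor Y Z}
    {p₃ : HPath FHor Z W} {i : J.El X.z} {j : J.El Y.z} {l : J.El Z.z} {m : J.El W.z}
    (t₁ : Tup p₁ i j) (t₂ : Tup p₂ j l) (t₃ : Tup p₃ l m) :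
    HEq (t₁.append (t₂.append t₃)) ((t₁.append t₂).append t₃) := by
  induction t₁ with
  | nil _ => rfl
  | cons s t ih => exact cons_heq (HPath.append_assoc _ _ _).symm s (ih t₂)

theorem act_cons {X Y Z X' Y' Z' : J.FOb A} {p₁ : HPath FHor X Y} {f : X ⟶ X'} {g : Y ⟶ Y'}
    {S : FHor X' Y'} {p₂ : HPath FHor Y Z} {f' : Z ⟶ Z'} {q : HPath FHor Y' Z'}
    {p : HPath FHor X Z} (θ : FCell p₁ f g S) (Θ : (J.famGraph A).CellSeq p₂ g f' q)
    (hp : p₁.append p₂ = p) {i : J.El X.z} {l : J.El Z.z} (t : Tup p i l)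
    {j : J.El Y.z} (t₁ : Tup p₁ i j) (t₂ : Tup p₂ j l) (h : split p₁ hp t = ⟨t₁, t₂⟩)
    (ht : t₁.path.append t₂.path = t.path) :
    act (VDGraph.CellSeq.cons (A := J.famGraph A) θ Θ hp) t =
      ⟨.cons (θ.fn t₁) (act Θ t₂).res, .cons (θ.cell t₁) (act Θ t₂).cells ht⟩ := by
  have key : ∀ (s : Split p₁ p₂ i l), split p₁ hp t = s →
      ∀ (hs : s.fst.path.append s.snd.path = t.path),
      act (VDGraph.CellSeq.cons (A := J.famGraph A) θ Θ hp) t =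
      ⟨.cons (θ.fn s.fst) (act Θ s.snd).res, .cons (θ.cell s.fst) (act Θ s.snd).cells hs⟩ := by
    rintro s rfl hs
    rfl
  exact key _ h ht

theorem act_idSeq {X Y : J.FOb A} {p : HPath FHor X Y} {i : J.El X.z} {j : J.El Y.z}
    (t : Tup p i j) : act (idSeq (famId (J := J) (A := A)) p) t = ⟨t, idSeq A.hid t.path⟩ := by
  induction t with
  | nil i => rfl
  | @cons X Y Z S p i j l s t ih =>
    refine (act_cons (famId S rfl rfl) (idSeq famId p) rfl (.cons s t) (.cons s (.nil j)) t
      rfl rfl).trans ?_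
    rw [ih]
    rfl

theorem act_append {X Y Z X' Y' Z' : (J.famGraph A).Ob} {p₁ : HPath FHor X Y} {p₂ : HPath FHor Y Z}
    {f : X ⟶ X'} {g : Y ⟶ Y'} {f' : Z ⟶ Z'} {q₁ : HPath FHor X' Y'} {q₂ : HPath FHor Y' Z'}
    (Θ : (J.famGraph A).CellSeq p₁ f g q₁) (Θ' : (J.famGraph A).CellSeq p₂ g f' q₂)
    {i : J.El X.z} {j : J.El Y.z} {l : J.El Z.z} (t : Tup p₁ i j) (t' : Tup p₂ j l) :
    act (Θ.append Θ' rfl rfl) (t.append t') =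
      ⟨(act Θ t).res.append (act Θ' t').res,
        (act Θ t).cells.append (act Θ' t').cells (Tup.path_append _ _) (Tup.path_append _ _)⟩ := by
  induction Θ with
  | nil u =>
    cases t with
    | nil i => exact congrArg (Act.mk _) (nil_append _ (act Θ' t').cells rfl rfl).symm
  | cons θ Θ hp ih =>
    rename_i r₁ _ _ _ r₂ _ _ _
    subst hp
    obtain ⟨j₁, t₁, t₂, rfl⟩ : ∃ (j₁ : _) (t₁ : Tup r₁ i j₁) (t₂ : Tup r₂ j₁ j),
        t = t₁.append t₂ := ⟨_, _, _, (append_split r₁ t).symm⟩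
    rw [act_cons θ Θ rfl (t₁.append t₂) t₁ t₂ (split_append t₁ t₂) (Tup.path_append _ _)]
    have h := split_eq (HPath.append_assoc r₁ r₂ p₂).symm ((t₁.append t₂).append t') t₁
      (t₂.append t') (append_assoc_heq t₁ t₂ t')
    have h' := split_path r₁ (HPath.append_assoc r₁ r₂ p₂).symm ((t₁.append t₂).append t')
    rw [h] at h'
    refine (act_cons θ (Θ.append Θ' rfl rfl) (HPath.append_assoc r₁ r₂ p₂).symm
      ((t₁.append t₂).append t') t₁ (t₂.append t') h h').trans ?_
    rw [ih Θ' t₂ t']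
    refine congrArg (Act.mk _) ?_
    exact (append_cons _ _ _ _ _ _ _ _).symm

theorem act_grid {X Y X' Y' X'' Y'' : (J.famGraph A).Ob} {p : HPath FHor X Y} {u : X ⟶ X'} {u' : Y ⟶ Y'}
    {q : HPath FHor X' Y'} {v : X' ⟶ X''} {v' : Y' ⟶ Y''} {r : HPath FHor X'' Y''}
    (G : (J.famGraph A).CellGrid p u u' q v v' r) {i : J.El X.z} {j : J.El Y.z} (t : Tup p i j)
    (r₁ : Act q u u' t.path) (h₁ : act G.top t = r₁) (r₂ : Act r v v' r₁.res.path)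
    (h₂ : act G.bot r₁.res = r₂) :
    ∃ H : A.CellGrid t.path (u.mor i) (u'.mor j) r₁.res.path (v.mor (u.fn i)) (v'.mor (u'.fn j))
      r₂.res.path, H.top = r₁.cells ∧ H.bot = r₂.cells ∧
        act (G.comps famComp) t = ⟨r₂.res, H.comps A.comp⟩ := by
  induction G with
  | nil u v =>
    cases t with
    | nil i =>
      subst h₁ h₂
      exact ⟨.nil _ _, rfl, rfl, rfl⟩
  | cons Θ κ G hp hq ih =>
    rename_i p₁ _ _ q₁ _ _ _ p₂ _ q₂ _ _ _ _
    subst hp hq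
    obtain ⟨j₁, t₁, t₂, rfl⟩ : ∃ (j₁ : _) (t₁ : Tup p₁ i j₁) (t₂ : Tup p₂ j₁ j),
        t = t₁.append t₂ := ⟨_, _, _, (append_split p₁ t).symm⟩
    have e₁ := act_append Θ G.top t₁ t₂
    obtain rfl := e₁.symm.trans h₁
    have e₂ := act_cons κ G.bot rfl ((act Θ t₁).res.append (act G.top t₂).res) (act Θ t₁).res
      (act G.top t₂).res (split_append _ _) (Tup.path_append _ _)
    obtain rfl := e₂.symm.trans h₂
    obtain ⟨H, k₁, k₂, k₃⟩ := ih t₂ _ rfl _ rfl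
    refine ⟨.cons (act Θ t₁).cells (FCell.cell κ (act Θ t₁).res) H (Tup.path_append _ _)
      (Tup.path_append _ _), ?_, ?_, ?_⟩
    · change CellSeq.append _ H.top _ _ = _
      rw [k₁]
    · change CellSeq.cons _ H.bot _ = _
      rw [k₂]
    · refine (act_cons (famComp Θ κ rfl rfl) (G.comps famComp) rfl _ t₁ t₂ (split_append _ _)
        (Tup.path_append _ _)).trans ?_
      rw [k₃]
      rfl

variable (J A) in
/-- The virtual double category of families in `A` indexed by the vertices of `J`. -/
def fam : VDC.{max i k w} where
  toVDGraph := J.famGraph A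
  hid := famId
  comp := famComp
  comp_id κ := FCell.ext_val (fun t => by
    refine (val_famComp _ _ _ _ t).trans ?_
    rw [act_idSeq t]
    refine val_congr _ ?_
    exact (A.tot_comp _ _ _ _ _ _ (Category.id_comp _) (Category.id_comp _) rfl rfl).trans
      (congrArg CellTot.mk (A.comp_id _)))
  id_comp {a b c d p u u' Δ} θ := FCell.ext_val (fun t => by
    refine (val_famComp _ _ _ _ t).trans ?_
    have e := act_cons θ (.nil u') (HPath.append_nil p) t t (.nil _)
      (split_eq _ _ _ _ (append_nil_heq t)) (HPath.append_nil _)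
    refine (congrArg (compVal (famId Δ rfl rfl)) e).trans ?_
    refine val_congr _ ?_
    exact (A.tot_comp _ _ _ _ _ _ (Category.comp_id _) (Category.comp_id _) rfl rfl).trans
      (congrArg CellTot.mk (A.id_comp _)))
  assoc G κ := FCell.ext_val (fun t => by
    obtain ⟨H, h₁, h₂, h₃⟩ := act_grid G t _ rfl _ rfl
    refine (val_famComp _ _ _ _ t).trans (Eq.trans ?_ (val_famComp _ _ _ _ t).symm)
    rw [h₃]
    refine val_congr _ ?_
    change CellTot.mk (A.comp _ (A.comp _ _ _ _) _ _) = CellTot.mk (A.comp _ _ _ _)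
    rw [← h₁, ← h₂]
    refine (congrArg CellTot.mk (A.assoc H (FCell.cell κ _))).trans ?_
    exact A.tot_comp _ _ _ _ _ _ _ _ rfl rfl)


end IndexGraph

/-! ### Functoriality of families -/

namespace IndexGraph
open VDGraph

variable {J : IndexGraph.{i, k}} {A B : VDC.{w}} (F : VDFunctor A B)

/-- The image of a family of objects. -/
def mapOb (X : J.FOb A) : J.FOb B := ⟨X.z, fun i => F.toFunctor.obj (X.a i)⟩

/-- The image of a family of horizontal morphisms. -/
def mapHor {X Y : J.FOb A} (S : FHor X Y) : FHor (mapOb F X) (mapOb F Y) :=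
  ⟨S.Ψ, fun s => F.hor (S.Γ s)⟩

/-- The action on families of objects and of vertical morphisms. -/
def mapFunctor : J.FOb A ⥤ J.FOb B where
  obj := mapOb F
  map f := ⟨f.fn, fun i => F.toFunctor.map (f.mor i)⟩
  map_id _ := congrArg (FVer.mk _) (funext fun _ => F.toFunctor.map_id _)
  map_comp _ _ := congrArg (FVer.mk _) (funext fun _ => F.toFunctor.map_comp _ _)

/-- A tuple of positive length, decomposed. -/
structure Uncons {X Y Z : J.FOb A} (S : FHor X Y) (p : HPath FHor Y Z) (i : J.El X.z)
    (l : J.El Z.z) : Type (max i k w) where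
  {j : J.El Y.z}
  s : J.HEl S.Ψ i j
  t : Tup p j l

/-- Decomposition of a tuple of positive length. -/
def Tup.uncons {X Y Z : J.FOb A} {S : FHor X Y} {p : HPath FHor Y Z} {i : J.El X.z}
    {l : J.El Z.z} : Tup (.cons S p) i l → Uncons S p i l
  | .cons s t => ⟨s, t⟩

theorem Tup.exists_cons {X Y Z : J.FOb A} {S : FHor X Y} {p : HPath FHor Y Z} {i : J.El X.z}
    {l : J.El Z.z} (t : Tup (.cons S p) i l) :
    ∃ (j : J.El Y.z) (s : J.HEl S.Ψ i j) (t' : Tup p j l), t = .cons s t' := by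
  cases t with
  | cons s t => exact ⟨_, s, t, rfl⟩

theorem Tup.nil_eq {X : J.FOb A} {i j : J.El X.z} (t : Tup (.nil X) i j) : i = j := by
  cases t; rfl

theorem Tup.eq_nil {X : J.FOb A} {i : J.El X.z} (t : Tup (.nil X) i i) : t = .nil i := by
  cases t; rfl

/-- A path of families of horizontal morphisms and its image have the same tuples. -/
def unmapTup : {X Y : J.FOb A} → (p : HPath FHor X Y) → {i : J.El X.z} → {j : J.El Y.z} →
    Tup (p.map (mapOb F) (mapHor F)) i j → Tup p i j
  | X, _, .nil _, i, _, t => Tup.nil_eq (X := mapOb F X) t ▸ .nil (X := X) i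
  | _, _, .cons S p, _, _, t =>
    .cons (S := S) (Tup.uncons (S := mapHor F S) t).s
      (unmapTup p (Tup.uncons (S := mapHor F S) t).t)

theorem unmapTup_path {X Y : J.FOb A} (p : HPath FHor X Y) {i : J.El X.z} {j : J.El Y.z}
    (t : Tup (p.map (mapOb F) (mapHor F)) i j) : F.path (unmapTup F p t).path = t.path := by
  induction p with
  | nil X =>
    obtain rfl := Tup.nil_eq (X := mapOb F X) t
    obtain rfl := Tup.eq_nil (X := mapOb F X) t
    rfl
  | cons S p ih =>
    obtain ⟨j, s, t, rfl⟩ := Tup.exists_cons (S := mapHor F S) t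
    exact congrArg (HPath.cons (F.hor (S.Γ s))) (ih t)

theorem unmapTup_append {X Y Z : J.FOb A} (p₁ : HPath FHor X Y) (p₂ : HPath FHor Y Z)
    {i : J.El X.z} {l : J.El Z.z} (t : Tup ((p₁.append p₂).map (mapOb F) (mapHor F)) i l) :
    ∃ (j : J.El Y.z) (t₁ : Tup (p₁.map (mapOb F) (mapHor F)) i j)
      (t₂ : Tup (p₂.map (mapOb F) (mapHor F)) j l), HEq (t₁.append t₂) t ∧
      unmapTup F (p₁.append p₂) t = (unmapTup F p₁ t₁).append (unmapTup F p₂ t₂) := by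
  induction p₁ with
  | nil X => exact ⟨i, .nil (X := mapOb F X) i, t, HEq.rfl, rfl⟩
  | cons S p ih =>
    obtain ⟨j, s, t, rfl⟩ := Tup.exists_cons (S := mapHor F S) t
    obtain ⟨j, t₁, t₂, h₁, h₂⟩ := ih p₂ t
    refine ⟨j, .cons (S := mapHor F S) s t₁, t₂,
      cons_heq (HPath.map_append _ _ p p₂) s h₁, ?_⟩
    exact congrArg (Tup.cons (S := S) s) h₂

/-- The action on families of multicells. -/
def mapCell {X Y X' Y' : J.FOb A} {p : HPath FHor X Y} {f : X ⟶ X'} {f' : Y ⟶ Y'}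
    {S : FHor X' Y'} (θ : FCell p f f' S) :
    FCell (p.map (mapOb F) (mapHor F)) ((mapFunctor F).map f) ((mapFunctor F).map f')
      (mapHor F S) where
  fn t := θ.fn (unmapTup F p t)
  cell t := castTop (unmapTup_path F p t) (F.cell (θ.cell (unmapTup F p t)))

variable (J) in
/-- The map of graphs between families that is induced by a virtual double functor. -/
def famMapGraph : VDGraphHom (J.famGraph A) (J.famGraph B) where
  toFunctor := mapFunctor F
  hor := mapHor F
  cell := mapCell F

theorem act_map {X Y X' Y' : (J.famGraph A).Ob} {p : HPath FHor X Y} {f : X ⟶ X'} {f' : Y ⟶ Y'}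
    {q : HPath FHor X' Y'} (Θ : (J.famGraph A).CellSeq p f f' q) {i : J.El X.z} {j : J.El Y.z}
    (t : Tup (p.map (mapOb F) (mapHor F)) i j) :
    unmapTup F q (act ((famMapGraph J F).seq Θ) t).res = (act Θ (unmapTup F p t)).res ∧
    SeqTot.mk (act ((famMapGraph J F).seq Θ) t).cells =
      SeqTot.mk (F.seq (act Θ (unmapTup F p t)).cells) := by
  induction Θ with
  | nil u =>
    rename_i X _
    obtain rfl := Tup.nil_eq (X := mapOb F X) t
    obtain rfl := Tup.eq_nil (X := mapOb F X) t
    exact ⟨rfl, rfl⟩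
  | cons θ Θ hp ih =>
    rename_i p₁ _ _ _ p₂ _ _ _
    subst hp
    obtain ⟨l, t₁, t₂, h₁, h₂⟩ := unmapTup_append F p₁ p₂ t
    have hp := HPath.map_append (mapOb F) (mapHor F) p₁ p₂
    have e₁ := split_eq hp t t₁ t₂ h₁
    have e₂ := split_path _ hp t
    rw [e₁] at e₂
    have a₁ := act_cons (mapCell F θ) ((famMapGraph J F).seq Θ) hp t t₁ t₂ e₁ e₂
    have a₂ := act_cons θ Θ rfl ((unmapTup F p₁ t₁).append (unmapTup F p₂ t₂)) _ _
      (split_append _ _) (Tup.path_append _ _)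
    obtain ⟨k₁, k₂⟩ := ih t₂
    rw [h₂, a₂]
    constructor
    · refine (congrArg (fun r => unmapTup F (.cons _ _) (Act.res r)) a₁).trans ?_
      exact congrArg (Tup.cons _) k₁
    · refine (congrArg (fun r => SeqTot.mk r.cells) a₁).trans ?_
      exact seqTot_cons _ _ _ _ _ _ (tot_castTop _ _) k₂

/-- The image of a value. -/
def mapVal {X Y : J.FOb A} {S : FHor X Y} (v : Val S) : Val (mapHor F S) :=
  ⟨v.s, F.cell v.θ⟩

theorem compVal_map {X Y X' Y' X'' Y'' : J.FOb A} {f : X ⟶ X'} {f' : Y ⟶ Y'}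
    {q : HPath FHor X' Y'} {g : X' ⟶ X''} {g' : Y' ⟶ Y''} {S : FHor X'' Y''}
    (κ : FCell q g g' S) {i : J.El X.z} {j : J.El Y.z} {r : HPath A.Hor (X.a i) (Y.a j)}
    {r' : HPath B.Hor (F.toFunctor.obj (X.a i)) (F.toFunctor.obj (Y.a j))}
    (α : Act (q.map (mapOb F) (mapHor F)) ((mapFunctor F).map f) ((mapFunctor F).map f') r')
    (β : Act q f f' r) (h₁ : unmapTup F q α.res = β.res)
    (h₂ : SeqTot.mk α.cells = SeqTot.mk (F.seq β.cells)) :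
    mapVal F (compVal κ β) = compVal (mapCell F κ) α := by
  obtain ⟨res, cells⟩ := β
  dsimp only at h₁
  subst h₁
  refine val_congr (S := mapHor F S) _ ?_
  refine (congrArg CellTot.mk (F.cell_comp' _ _ _ _)).trans ?_
  exact B.tot_comp _ _ _ _ _ _ _ _ h₂.symm (tot_castTop _ _).symm

variable (J) in
/-- The virtual double functor between families that is induced by a virtual double functor. -/
def famMap : VDFunctor (J.fam A) (J.fam B) where
  toVDGraphHom := famMapGraph J F
  cell_hid {X Y} S := FCell.ext_val (fun t => by
    obtain ⟨j, s, t, rfl⟩ := Tup.exists_cons (S := mapHor F S) t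
    obtain rfl := Tup.nil_eq (X := mapOb F Y) t
    obtain rfl := Tup.eq_nil (X := mapOb F Y) t
    refine Eq.trans ?_ (val_famId (mapHor F S) _ _ s).symm
    exact val_congr (S := mapHor F S) s ((tot_castTop
      (unmapTup_path F (HPath.single S) (.cons (S := mapHor F S) s (.nil (X := mapOb F Y) j)))
      (F.cell (A.hid (S.Γ s) rfl rfl))).trans (F.cellTot_hid (S.Γ s) rfl rfl)))
  cell_comp Θ κ := FCell.ext_val (fun t => by
    refine Eq.trans ?_ (val_famComp _ _ _ _ t).symm
    obtain ⟨h₁, h₂⟩ := act_map F Θ t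
    refine Eq.trans (b := mapVal F (compVal κ (act Θ (unmapTup F _ t)))) ?_ ?_
    · exact val_congr (S := mapHor F _) _ (tot_castTop _ _)
    · exact compVal_map F κ _ _ h₁ h₂)

end IndexGraph

/-! ### The families construction -/

/-- Spans of sets in `Type u`. -/
structure SetSpan (I I' : Type u) : Type (u + 1) where
  S : Type u
  left : S → I
  right : S → I'

/-- `T.El i i'` is the set of the elements `s` of the span with `left s = i` and
`right s = i'`. -/
inductive SetSpan.El {I I' : Type u} (T : SetSpan I I') : I → I' → Type u
  | mk (s : T.S) : T.El (T.left s) (T.right s)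

/-- The underlying element of the apex. -/
def SetSpan.El.elem {I I' : Type u} {T : SetSpan I I'} : {i : I} → {i' : I'} → T.El i i' → T.S
  | _, _, .mk s => s

/-- Sets and spans of sets, with their elements. -/
def setIndex : IndexGraph.{u, u + 1} where
  Ob := Type u
  El I := I
  Hor := SetSpan
  HEl T := T.El

/-- The virtual double category of families in `A`. Its objects are the families of objects of `A`
indexed by sets in `Type u`, and its horizontal morphisms are spans `S` of sets together with an
`S`-indexed family of horizontal morphisms of `A`. -/
def Fam (A : VDC.{w}) : VDC.{max (u + 1) w} := setIndex.{u}.fam A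

/-- The families construction on virtual double functors. -/
def Fam.map {A B : VDC.{w}} (F : A ⟶ B) : Fam.{u} A ⟶ Fam.{u} B := setIndex.{u}.famMap F

/-- The terminal virtual double category. -/
def terminalVDC : VDC.{w} where
  Ob := PUnit
  cat :=
    { Hom := fun _ _ => PUnit
      id := fun _ => ⟨⟩
      comp := fun _ _ => ⟨⟩ }
  Hor _ _ := PUnit
  Cell _ _ _ _ := PUnit
  hid _ _ _ _ _ := PUnit.unit
  comp _ _ _ _ := PUnit.unit
  comp_id _ := rfl
  id_comp _ := rfl
  assoc _ _ := rfl

/-- The unique virtual double functor to the terminal virtual double category. -/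
def toTerminal (A : VDC.{w}) : A ⟶ terminalVDC.{w} where
  toFunctor :=
    { obj := fun _ => PUnit.unit
      map := fun _ => PUnit.unit
      map_id := fun _ => rfl
      map_comp := fun _ _ => rfl }
  hor _ := ⟨⟩
  cell _ := ⟨⟩
  cell_hid _ := rfl
  cell_comp _ _ := rfl

/-- The virtual double category of sets in `Type u`, functions, spans and multimaps of spans, that
is, the families in the terminal virtual double category. -/
abbrev SpanVDC : VDC.{max (u + 1) w} := Fam.{u} terminalVDC.{w}

/-! ### Virtual double categories from maps of graphs -/

namespace VDGraphHom
open VDGraph IndexGraph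

variable {S : VDGraph.{w}} {V : VDC.{w}} (T : VDGraphHom S V.toVDGraph)

theorem seq_append {a a₁ b c c₁ d : S.Ob} {p₁ : HPath S.Hor a a₁} {u : a ⟶ c} {u₁ : a₁ ⟶ c₁}
    {q₁ : HPath S.Hor c c₁} {p₂ : HPath S.Hor a₁ b} {u' : b ⟶ d} {q₂ : HPath S.Hor c₁ d}
    (Θ : S.CellSeq p₁ u u₁ q₁) (Θ' : S.CellSeq p₂ u₁ u' q₂) :
    T.seq (Θ.append Θ' rfl rfl) =
      (T.seq Θ).append (T.seq Θ') (HPath.map_append _ _ _ _) (HPath.map_append _ _ _ _) := by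
  induction Θ with
  | nil u => exact (nil_append _ _ _ _).symm
  | cons θ Θ hp ih =>
    rename_i r₁ _ _ _ r₂ _ _ _
    subst hp
    have e := append_cons θ Θ rfl Θ' rfl rfl rfl (HPath.append_assoc r₁ r₂ p₂).symm
    refine (congrArg T.seq e).trans ?_
    change CellSeq.cons (T.cell θ) (T.seq (Θ.append Θ' rfl rfl)) _ = _
    rw [ih Θ']
    exact (append_cons _ _ _ _ _ _ _ _).symm

theorem seq_idSeq (hid : S.IdOp)
    (hI : ∀ {a b : S.Ob} (Γ : S.Hor a b),
      CellTot.mk (T.cell (hid Γ rfl rfl)) = CellTot.mk (V.hid (T.hor Γ) rfl rfl))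
    {a b : S.Ob} (p : HPath S.Hor a b) :
    SeqTot.mk (T.seq (idSeq hid p)) = SeqTot.mk (idSeq V.hid (T.path p)) := by
  induction p with
  | nil a =>
    change SeqTot.mk (CellSeq.nil (T.toFunctor.map (𝟙 a))) = SeqTot.mk (CellSeq.nil (𝟙 _))
    rw [T.toFunctor.map_id]
  | cons Γ p ih => exact seqTot_cons _ _ _ _ _ _ (hI Γ) ih

theorem seq_grid (comp : S.CompOp)
    (hC : ∀ {a b c d e f : S.Ob} {p : HPath S.Hor a b} {u : a ⟶ c} {u' : b ⟶ d}
      {q : HPath S.Hor c d} {v : c ⟶ e} {v' : d ⟶ f} {Δ : S.Hor e f} {x : a ⟶ e} {x' : b ⟶ f}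
      (Θ : S.CellSeq p u u' q) (κ : S.Cell q v v' Δ) (hx : u ≫ v = x) (hx' : u' ≫ v' = x'),
      CellTot.mk (T.cell (comp Θ κ hx hx')) = CellTot.mk (V.comp (T.seq Θ) (T.cell κ) rfl rfl))
    {a b c d e f : S.Ob} {p : HPath S.Hor a b} {u : a ⟶ c} {u' : b ⟶ d}
    {q : HPath S.Hor c d} {v : c ⟶ e} {v' : d ⟶ f} {r : HPath S.Hor e f}
    (G : S.CellGrid p u u' q v v' r) :
    ∃ H : V.CellGrid (T.path p) (T.toFunctor.map u) (T.toFunctor.map u') (T.path q)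
      (T.toFunctor.map v) (T.toFunctor.map v') (T.path r),
      H.top = T.seq G.top ∧ H.bot = T.seq G.bot ∧
        SeqTot.mk (H.comps V.comp) = SeqTot.mk (T.seq (G.comps comp)) := by
  induction G with
  | nil u v =>
    refine ⟨.nil _ _, rfl, rfl, ?_⟩
    change SeqTot.mk (CellSeq.nil _) = SeqTot.mk (CellSeq.nil (T.toFunctor.map (u ≫ v)))
    rw [T.toFunctor.map_comp]
  | cons Θ κ G hp hq ih =>
    subst hp hq
    obtain ⟨H, h₁, h₂, h₃⟩ := ih
    refine ⟨.cons (T.seq Θ) (T.cell κ) H (HPath.map_append _ _ _ _) (HPath.map_append _ _ _ _),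
      ?_, ?_, ?_⟩
    · refine Eq.trans ?_ (seq_append T Θ G.top).symm
      change CellSeq.append _ H.top _ _ = _
      rw [h₁]
    · change CellSeq.cons _ H.bot _ = CellSeq.cons _ (T.seq G.bot) _
      rw [h₂]
    · exact seqTot_cons _ _ _ _ _ _ (hC Θ κ rfl rfl).symm h₃

theorem cell_comp_id (hid : S.IdOp) (comp : S.CompOp)
    (hI : ∀ {a b : S.Ob} (Γ : S.Hor a b),
      CellTot.mk (T.cell (hid Γ rfl rfl)) = CellTot.mk (V.hid (T.hor Γ) rfl rfl))
    (hC : ∀ {a b c d e f : S.Ob} {p : HPath S.Hor a b} {u : a ⟶ c} {u' : b ⟶ d}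
      {q : HPath S.Hor c d} {v : c ⟶ e} {v' : d ⟶ f} {Δ : S.Hor e f} {x : a ⟶ e} {x' : b ⟶ f}
      (Θ : S.CellSeq p u u' q) (κ : S.Cell q v v' Δ) (hx : u ≫ v = x) (hx' : u' ≫ v' = x'),
      CellTot.mk (T.cell (comp Θ κ hx hx')) = CellTot.mk (V.comp (T.seq Θ) (T.cell κ) rfl rfl))
    {a b c d : S.Ob} {p : HPath S.Hor a b} {u : a ⟶ c} {u' : b ⟶ d}
    {Δ : S.Hor c d} (κ : S.Cell p u u' Δ) :
    T.cell (comp (idSeq hid p) κ (Category.id_comp u) (Category.id_comp u')) = T.cell κ :=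
  eq_of_tot ((hC _ _ _ _).trans ((V.tot_comp _ _ _ _ _ _ (Category.id_comp _)
    (Category.id_comp _) (seq_idSeq T hid hI p) rfl).trans (congrArg CellTot.mk (V.comp_id _))))

theorem cell_id_comp (hid : S.IdOp) (comp : S.CompOp)
    (hI : ∀ {a b : S.Ob} (Γ : S.Hor a b),
      CellTot.mk (T.cell (hid Γ rfl rfl)) = CellTot.mk (V.hid (T.hor Γ) rfl rfl))
    (hC : ∀ {a b c d e f : S.Ob} {p : HPath S.Hor a b} {u : a ⟶ c} {u' : b ⟶ d}
      {q : HPath S.Hor c d} {v : c ⟶ e} {v' : d ⟶ f} {Δ : S.Hor e f} {x : a ⟶ e} {x' : b ⟶ f}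
      (Θ : S.CellSeq p u u' q) (κ : S.Cell q v v' Δ) (hx : u ≫ v = x) (hx' : u' ≫ v' = x'),
      CellTot.mk (T.cell (comp Θ κ hx hx')) = CellTot.mk (V.comp (T.seq Θ) (T.cell κ) rfl rfl))
    {a b c d : S.Ob} {p : HPath S.Hor a b} {u : a ⟶ c} {u' : b ⟶ d}
    {Δ : S.Hor c d} (θ : S.Cell p u u' Δ) :
    T.cell (comp (CellSeq.single θ) (hid Δ rfl rfl) (Category.comp_id u) (Category.comp_id u')) =
      T.cell θ :=
  eq_of_tot ((hC _ _ _ _).trans ((V.tot_comp _ _ _ _ _ _ (Category.comp_id _)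
    (Category.comp_id _) (seqTot_cons _ _ _ _ _ _ rfl rfl) (hI Δ)).trans
      (congrArg CellTot.mk (V.id_comp (T.cell θ)))))

theorem cell_assoc (comp : S.CompOp)
    (hC : ∀ {a b c d e f : S.Ob} {p : HPath S.Hor a b} {u : a ⟶ c} {u' : b ⟶ d}
      {q : HPath S.Hor c d} {v : c ⟶ e} {v' : d ⟶ f} {Δ : S.Hor e f} {x : a ⟶ e} {x' : b ⟶ f}
      (Θ : S.CellSeq p u u' q) (κ : S.Cell q v v' Δ) (hx : u ≫ v = x) (hx' : u' ≫ v' = x'),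
      CellTot.mk (T.cell (comp Θ κ hx hx')) = CellTot.mk (V.comp (T.seq Θ) (T.cell κ) rfl rfl))
    {a b c d e f g h : S.Ob} {p : HPath S.Hor a b} {u : a ⟶ c} {u' : b ⟶ d}
    {q : HPath S.Hor c d} {v : c ⟶ e} {v' : d ⟶ f} {r : HPath S.Hor e f} {x : e ⟶ g} {x' : f ⟶ h}
    {Δ : S.Hor g h} (G : S.CellGrid p u u' q v v' r) (κ : S.Cell r x x' Δ) :
    T.cell (comp G.top (comp G.bot κ rfl rfl) rfl rfl) =
      T.cell (comp (G.comps comp) κ (Category.assoc u v x) (Category.assoc u' v' x')) := by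
  obtain ⟨H, h₁, h₂, h₃⟩ := seq_grid T comp hC G
  refine eq_of_tot ((hC _ _ _ _).trans (Eq.trans ?_ (hC _ _ _ _).symm))
  refine (V.tot_comp _ _ _ _ H.top (V.comp H.bot (T.cell κ) rfl rfl) rfl rfl
    (congrArg SeqTot.mk h₁.symm) ((hC _ _ _ _).trans
      (V.tot_comp _ _ _ _ _ _ _ _ (congrArg SeqTot.mk h₂.symm) rfl))).trans ?_
  refine (congrArg CellTot.mk (V.assoc H (T.cell κ))).trans ?_
  exact V.tot_comp _ _ _ _ _ _ _ _ h₃ rfl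

end VDGraphHom

/-! ### Families over a given multicell -/

namespace VDGraph

theorem verTot_comp {A : VDGraph.{w}} {a b c a' b' c' : A.Ob} {f : a ⟶ b} {g : b ⟶ c}
    {f' : a' ⟶ b'} {g' : b' ⟶ c'} (h : VerTot.mk f = VerTot.mk f')
    (h' : VerTot.mk g = VerTot.mk g') : VerTot.mk (f ≫ g) = VerTot.mk (f' ≫ g') := by
  cases h; cases h'; rfl

theorem seqTot_nil {A : VDGraph.{w}} {a b a' b' : A.Ob} {f : a ⟶ b}
    {f' : a' ⟶ b'} (h : VerTot.mk f = VerTot.mk f') :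
    SeqTot.mk (CellSeq.nil f) = SeqTot.mk (CellSeq.nil f') := by
  cases h; rfl

theorem tot_hid_congr {A : VDC.{w}} {a b a' b' : A.Ob} {Γ : A.Hor a b} {Γ' : A.Hor a' b'}
    (h : HorTot.mk Γ = HorTot.mk Γ') :
    CellTot.mk (A.hid Γ rfl rfl) = CellTot.mk (A.hid Γ' rfl rfl) := by
  cases h; rfl

end VDGraph

namespace IndexGraph
open VDGraph

variable {J : IndexGraph.{i, k}} {A B : VDC.{w}} (G : VDFunctor A B)

/-- All members of the family `θ` of multicells are mapped to `ν` by `G`. -/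
def COver {X Y X' Y' : J.FOb A} {p : HPath FHor X Y} {f : X ⟶ X'} {f' : Y ⟶ Y'}
    {S : FHor X' Y'} (θ : FCell p f f' S) (ν : B.CellTot) : Prop :=
  ∀ {i : J.El X.z} {j : J.El Y.z} (t : Tup p i j), G.cellTot ⟨θ.cell t⟩ = ν

/-- All sequences of multicells given by `Θ` are mapped to `N` by `G`. -/
def SOver {X Y X' Y' : J.FOb A} {p : HPath FHor X Y} {f : X ⟶ X'} {f' : Y ⟶ Y'}
    {q : HPath FHor X' Y'} (Θ : (J.famGraph A).CellSeq p f f' q) (N : B.SeqTot) : Prop :=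
  ∀ {i : J.El X.z} {j : J.El Y.z} (t : Tup p i j), G.seqTot ⟨(act Θ t).cells⟩ = N

theorem cOver_of_val {X Y X' Y' : J.FOb A} {p : HPath FHor X Y} {f : X ⟶ X'} {f' : Y ⟶ Y'}
    {g : X ⟶ X'} {g' : Y ⟶ Y'} {S : FHor X' Y'} (θ : FCell p f f' S) (ν : B.CellTot)
    (h : f = g) (h' : f' = g') (hθ : COver G θ ν) : COver G (castEdge h h' θ) ν := by
  subst h h'; exact hθ

theorem sOver_nil {X X' : J.FOb A} (f : X ⟶ X') {y y' : B.Ob} (v : y ⟶ y')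
    (h : ∀ i, G.verTot ⟨f.mor i⟩ = ⟨v⟩) :
    SOver G (VDGraph.CellSeq.nil (A := J.famGraph A) f) ⟨.nil v⟩ := by
  intro i j t
  obtain rfl := Tup.nil_eq t
  obtain rfl := Tup.eq_nil t
  exact seqTot_nil (h _)

theorem sOver_cons {X Y Z X' Y' Z' : J.FOb A} {p₁ : HPath FHor X Y} {f : X ⟶ X'} {g : Y ⟶ Y'}
    {S : FHor X' Y'} {p₂ : HPath FHor Y Z} {f' : Z ⟶ Z'} {q : HPath FHor Y' Z'}
    {p : HPath FHor X Z} (θ : FCell p₁ f g S) (Θ : (J.famGraph A).CellSeq p₂ g f' q)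
    (hp : p₁.append p₂ = p) {a a₁ b c c₁ d : B.Ob} {r₁ : HPath B.Hor a a₁} {u : a ⟶ c}
    {u₁ : a₁ ⟶ c₁} {Δ : B.Hor c c₁} {r₂ : HPath B.Hor a₁ b} {u' : b ⟶ d} {s : HPath B.Hor c₁ d}
    {r : HPath B.Hor a b} (ν : B.Cell r₁ u u₁ Δ) (N : B.CellSeq r₂ u₁ u' s)
    (hr : r₁.append r₂ = r) (h₁ : COver G θ ⟨ν⟩) (h₂ : SOver G Θ ⟨N⟩) :
    SOver G (VDGraph.CellSeq.cons (A := J.famGraph A) θ Θ hp) ⟨.cons ν N hr⟩ := by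
  intro i j t
  exact seqTot_cons _ _ _ _ _ _ (h₁ _) (h₂ _)

theorem cOver_famId {X Y : J.FOb A} (S : FHor X Y) {x : X ⟶ X} {x' : Y ⟶ Y} (h : 𝟙 X = x)
    (h' : 𝟙 Y = x') {y y' : B.Ob} {Ψ : B.Hor y y'} {w : y ⟶ y} {w' : y' ⟶ y'} (k : 𝟙 y = w)
    (k' : 𝟙 y' = w') (hS : ∀ {i j} (s : J.HEl S.Ψ i j), G.horTot ⟨S.Γ s⟩ = ⟨Ψ⟩) :
    COver G (famId S h h') ⟨B.hid Ψ k k'⟩ := by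
  subst h h' k k'
  intro i j t
  obtain ⟨l, s, t, rfl⟩ := Tup.exists_cons t
  obtain rfl := Tup.nil_eq t
  obtain rfl := Tup.eq_nil t
  exact (G.cellTot_hid (S.Γ s) rfl rfl).trans (tot_hid_congr (hS s))

theorem cOver_famComp {X Y X' Y' X'' Y'' : J.FOb A} {p : HPath FHor X Y} {f : X ⟶ X'}
    {f' : Y ⟶ Y'} {q : HPath FHor X' Y'} {g : X' ⟶ X''} {g' : Y' ⟶ Y''} {S : FHor X'' Y''}
    {x : X ⟶ X''} {x' : Y ⟶ Y''} (Θ : (J.famGraph A).CellSeq p f f' q) (κ : FCell q g g' S)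
    (h : f ≫ g = x) (h' : f' ≫ g' = x')
    {a b c d e l : B.Ob} {r : HPath B.Hor a b} {u : a ⟶ c} {u' : b ⟶ d} {s : HPath B.Hor c d}
    {v : c ⟶ e} {v' : d ⟶ l} {Δ : B.Hor e l} {w : a ⟶ e} {w' : b ⟶ l} (N : B.CellSeq r u u' s)
    (ν : B.Cell s v v' Δ) (k : u ≫ v = w) (k' : u' ≫ v' = w')
    (hΘ : SOver G Θ ⟨N⟩) (hκ : COver G κ ⟨ν⟩) :
    COver G (famComp Θ κ h h') ⟨B.comp N ν k k'⟩ := by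
  subst h h'
  intro i j t
  refine (congrArg CellTot.mk (G.cell_comp' (act Θ t).cells (κ.cell (act Θ t).res) rfl rfl)).trans ?_
  exact B.tot_comp _ _ _ _ _ _ _ _ (hΘ t) (hκ _)

end IndexGraph

/-! ### The dependent product along a virtual double functor -/

/-- The fibres of `P`. The vertices are the objects of `Y`, the edges are the horizontal morphisms of
`Y`, the elements of `y` are the objects of `X` over `y`, and the elements of `Ψ` are the horizontal
morphisms of `X` over `Ψ`. -/
def fibIndex {X Y : VDC.{w}} (P : VDFunctor X Y) : IndexGraph.{w, w} where
  Ob := Y.Ob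
  El := P.ObFib
  Hor := Y.Hor
  HEl Ψ x x' := {Φ : X.Hor x.1 x'.1 // P.horTot ⟨Φ⟩ = ⟨Ψ⟩}

namespace PiProd
open VDGraph IndexGraph

variable {X Y A : VDC.{w}}

/-- An object `z` of `Y` with a family of objects `a x` of `A` indexed by the objects `x` of `X` over
`z`, such that `F (a x) = x`. -/
structure PiOb (P : VDFunctor X Y) (F : VDFunctor A X) : Type w extends
    IndexGraph.FOb (fibIndex P) A where
  map_a : ∀ x : P.ObFib z, F.toFunctor.obj (a x) = x.1

variable {P : VDFunctor X Y} {F : VDFunctor A X}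

/-- The underlying object of `Y`. -/
abbrev PiOb.base (a : PiOb P F) : Y.Ob := a.z

/-- A vertical morphism `v` of `Y` with a family of vertical morphisms `f x : a x ⟶ a' (fn x)` such
that `P (F (f x)) = v`. If `P` is a discrete opfibration, this says that `F (f x)` is the lift of
`v` with domain `x`, and that `fn x` is the codomain of this lift. -/
structure PiVer (a a' : PiOb P F) : Type w extends FVer a.toFOb a'.toFOb where
  v : a.base ⟶ a'.base
  map_mor : ∀ x : P.ObFib a.z, (F.comp P).verTot ⟨mor x⟩ = ⟨v⟩

/-- A horizontal morphism `Ψ` of `Y` with a family of horizontal morphisms `Γ Φ` of `A` indexed by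
the horizontal morphisms `Φ` of `X` over `Ψ`, such that `F (Γ Φ) = Φ`. -/
structure PiHor (a a' : PiOb P F) : Type w extends FHor a.toFOb a'.toFOb where
  map_Γ : ∀ {x : P.ObFib a.z} {x' : P.ObFib a'.z} (Φ : (fibIndex P).HEl Ψ x x'),
    F.horTot ⟨Γ Φ⟩ = ⟨Φ.1⟩

/-- The underlying horizontal morphism of `Y`. -/
abbrev PiHor.base {a a' : PiOb P F} (S : PiHor a a') : Y.Hor a.base a'.base := S.Ψ

theorem PiVer.ext_ver {a a' : PiOb P F} {f g : PiVer a a'} (h : f.toFVer = g.toFVer)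
    (h' : f.v = g.v) : f = g := by
  cases f; cases g; cases h; cases h'; rfl

theorem verTot_id_base (a : PiOb P F) (x : P.ObFib a.z) :
    (F.comp P).verTot ⟨𝟙 (a.a x)⟩ = ⟨𝟙 a.base⟩ := by
  have h : (F.comp P).toFunctor.obj (a.a x) = a.base :=
    (congrArg P.toFunctor.obj (a.map_a x)).trans x.2
  refine (congrArg VerTot.mk ((F.comp P).toFunctor.map_id (a.a x))).trans ?_
  rw [h]

instance : Category.{w} (PiOb P F) where
  Hom := PiVer
  id a := PiVer.mk (𝟙 a.toFOb) (𝟙 a.base) (verTot_id_base a)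
  comp f g := PiVer.mk (FVer.mk (fun i => g.fn (f.fn i)) (fun i => f.mor i ≫ g.mor (f.fn i)))
    (f.v ≫ g.v) fun x =>
      (congrArg VerTot.mk ((F.comp P).toFunctor.map_comp _ _)).trans
        (verTot_comp (f.map_mor x) (g.map_mor (f.fn x)))
  id_comp {a _} f := PiVer.ext_ver (Category.id_comp (X := a.toFOb) f.toFVer) (Category.id_comp f.v)
  comp_id {a _} f := PiVer.ext_ver (Category.comp_id (X := a.toFOb) f.toFVer) (Category.comp_id f.v)
  assoc {a b _ _} f g h := PiVer.ext_ver
    (Category.assoc (W := a.toFOb) (X := b.toFOb) f.toFVer g.toFVer h.toFVer)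
    (Category.assoc f.v g.v h.v)

/-- The underlying path of families. -/
abbrev famPath {a b : PiOb P F} (p : HPath PiHor a b) : HPath FHor a.toFOb b.toFOb :=
  p.map PiOb.toFOb PiHor.toFHor

/-- The underlying path of `Y`. -/
abbrev basePath {a b : PiOb P F} (p : HPath PiHor a b) : HPath Y.Hor a.base b.base :=
  p.map PiOb.base PiHor.base

/-- A multicell `ν` of `Y` with a family of multicells of `A` indexed by the tuples `Φ₁, …, Φₙ` over
the top path of `ν`, whose members `α` satisfy `P (F α) = ν`. If `P` is a discrete opfibration, this
says that `F α` is the lift of `ν` with top path `Φ₁, …, Φₙ`, and that `fn` sends the tuple to the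
bottom edge of this lift. -/
structure PiCell {a b a' b' : PiOb P F} (p : HPath PiHor a b) (f : a ⟶ a') (f' : b ⟶ b')
    (S : PiHor a' b') : Type w extends
    FCell (famPath p) (PiVer.toFVer f) (PiVer.toFVer f') S.toFHor where
  ν : Y.Cell (basePath p) (PiVer.v f) (PiVer.v f') S.base
  map_cell : COver (F.comp P) toFCell ⟨ν⟩

/-- The objects, vertical morphisms, horizontal morphisms and multicells of the dependent
product. -/
abbrev graph (P : VDFunctor X Y) (F : VDFunctor A X) : VDGraph.{w} where
  Ob := PiOb P F
  Hor := PiHor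
  Cell := PiCell

/-- The underlying families. -/
def toFam (P : VDFunctor X Y) (F : VDFunctor A X) :
    VDGraphHom (graph P F) ((fibIndex P).fam A).toVDGraph where
  toFunctor :=
    { obj := PiOb.toFOb
      map := PiVer.toFVer
      map_id := fun _ => rfl
      map_comp := fun _ _ => rfl }
  hor := PiHor.toFHor
  cell := PiCell.toFCell

/-- The underlying objects, morphisms and multicells of `Y`. -/
def toBase (P : VDFunctor X Y) (F : VDFunctor A X) :
    VDGraphHom (graph P F) Y.toVDGraph where
  toFunctor :=
    { obj := PiOb.base
      map := PiVer.v
      map_id := fun _ => rfl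
      map_comp := fun _ _ => rfl }
  hor := PiHor.base
  cell := PiCell.ν

theorem PiCell.ext_cell {a b a' b' : PiOb P F} {p : HPath PiHor a b} {f : a ⟶ a'} {f' : b ⟶ b'}
    {S : PiHor a' b'} {θ θ' : PiCell p f f' S} (h : θ.toFCell = θ'.toFCell) (h' : θ.ν = θ'.ν) :
    θ = θ' := by
  cases θ; cases θ'; cases h; cases h'; rfl

theorem sOver {a b a' b' : (graph P F).Ob} {p : HPath PiHor a b} {f : a ⟶ a'} {f' : b ⟶ b'}
    {q : HPath PiHor a' b'} (Θ : (graph P F).CellSeq p f f' q) :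
    SOver (F.comp P) ((toFam P F).seq Θ) ⟨(toBase P F).seq Θ⟩ := by
  induction Θ with
  | nil f => exact sOver_nil (F.comp P) (PiVer.toFVer f) (PiVer.v f) (PiVer.map_mor f)
  | cons θ Θ hp ih =>
    exact sOver_cons (F.comp P) θ.toFCell ((toFam P F).seq Θ) _ θ.ν ((toBase P F).seq Θ) _
      θ.map_cell ih

theorem horTot_base {a b : PiOb P F} (S : PiHor a b) {x : P.ObFib a.z} {x' : P.ObFib b.z}
    (Φ : (fibIndex P).HEl S.Ψ x x') : (F.comp P).horTot ⟨S.Γ Φ⟩ = ⟨S.base⟩ :=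
  (congrArg P.horTot (S.map_Γ Φ)).trans Φ.2

/-- Identity cells. -/
def idOp (P : VDFunctor X Y) (F : VDFunctor A X) : (graph P F).IdOp :=
  fun {_ _} S {x x'} h h' =>
    ⟨famId (S.toFHor : FHor (J := fibIndex P) _ _) (x := PiVer.toFVer x) (x' := PiVer.toFVer x')
        (congrArg PiVer.toFVer h) (congrArg PiVer.toFVer h'),
      Y.hid S.base (x := PiVer.v x) (x' := PiVer.v x') (congrArg PiVer.v h) (congrArg PiVer.v h'),
      cOver_famId _ _ _ _ _ _ fun Φ => horTot_base S Φ⟩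

/-- Composition of multicells. -/
def compOp (P : VDFunctor X Y) (F : VDFunctor A X) : (graph P F).CompOp :=
  fun {_ _ _ _ _ _ _ _ _ _ _ _ _ x x'} Θ κ h h' =>
    ⟨famComp ((toFam P F).seq Θ) (PiCell.toFCell κ) (x := PiVer.toFVer x) (x' := PiVer.toFVer x')
        (congrArg PiVer.toFVer h) (congrArg PiVer.toFVer h'),
      Y.comp ((toBase P F).seq Θ) (PiCell.ν κ) (x := PiVer.v x) (x' := PiVer.v x')
        (congrArg PiVer.v h) (congrArg PiVer.v h'),
      cOver_famComp _ _ _ _ _ _ _ _ _ (sOver Θ) (PiCell.map_cell κ)⟩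

theorem toFam_comp {a b c d e f : (graph P F).Ob} {p : HPath PiHor a b} {u : a ⟶ c} {u' : b ⟶ d}
    {q : HPath PiHor c d} {v : c ⟶ e} {v' : d ⟶ f} {Δ : PiHor e f} {x : a ⟶ e} {x' : b ⟶ f}
    (Θ : (graph P F).CellSeq p u u' q) (κ : (graph P F).Cell q v v' Δ) (hx : u ≫ v = x)
    (hx' : u' ≫ v' = x') :
    CellTot.mk ((toFam P F).cell (compOp P F Θ κ hx hx')) =
      CellTot.mk (((fibIndex P).fam A).comp ((toFam P F).seq Θ) ((toFam P F).cell κ) rfl rfl) := by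
  subst hx hx'; rfl

theorem toBase_comp {a b c d e f : (graph P F).Ob} {p : HPath PiHor a b} {u : a ⟶ c} {u' : b ⟶ d}
    {q : HPath PiHor c d} {v : c ⟶ e} {v' : d ⟶ f} {Δ : PiHor e f} {x : a ⟶ e} {x' : b ⟶ f}
    (Θ : (graph P F).CellSeq p u u' q) (κ : (graph P F).Cell q v v' Δ) (hx : u ≫ v = x)
    (hx' : u' ≫ v' = x') :
    CellTot.mk ((toBase P F).cell (compOp P F Θ κ hx hx')) =
      CellTot.mk (Y.comp ((toBase P F).seq Θ) ((toBase P F).cell κ) rfl rfl) := by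
  subst hx hx'; rfl

end PiProd

/-- The dependent product of `F : A ⟶ X` along `P : X ⟶ Y`, where `P` is a discrete opfibration. -/
def PiProd {X Y A : VDC.{w}} (P : X ⟶ Y) (F : A ⟶ X) : VDC.{w} where
  toVDGraph := PiProd.graph P F
  hid := PiProd.idOp P F
  comp := PiProd.compOp P F
  comp_id κ := PiProd.PiCell.ext_cell
    (VDGraphHom.cell_comp_id (PiProd.toFam P F) _ _ (fun _ => rfl) PiProd.toFam_comp κ)
    (VDGraphHom.cell_comp_id (PiProd.toBase P F) _ _ (fun _ => rfl) PiProd.toBase_comp κ)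
  id_comp κ := PiProd.PiCell.ext_cell
    (VDGraphHom.cell_id_comp (PiProd.toFam P F) _ _ (fun _ => rfl) PiProd.toFam_comp κ)
    (VDGraphHom.cell_id_comp (PiProd.toBase P F) _ _ (fun _ => rfl) PiProd.toBase_comp κ)
  assoc G κ := PiProd.PiCell.ext_cell
    (VDGraphHom.cell_assoc (PiProd.toFam P F) _ PiProd.toFam_comp G κ)
    (VDGraphHom.cell_assoc (PiProd.toBase P F) _ PiProd.toBase_comp G κ)

/-- The projection from the dependent product to `Y`. -/
def PiProd.proj {X Y A : VDC.{w}} (P : X ⟶ Y) (F : A ⟶ X) : PiProd P F ⟶ Y where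
  toVDGraphHom := PiProd.toBase P F
  cell_hid _ := rfl
  cell_comp _ _ := rfl

/-! ### The family of fibres of a discrete opfibration -/

namespace VDFunctor
open VDGraph

variable {X Y : VDC.{w}} {P : VDFunctor X Y}

/-- A path of horizontal morphisms together with its ends. -/
structure PathTot (A : VDGraph.{w}) : Type w where
  {a b : A.Ob}
  p : HPath A.Hor a b

theorem pathTot_cons {A : VDGraph.{w}} {a b c a' b' c' : A.Ob} {Γ : A.Hor a b} {p : HPath A.Hor b c}
    {Γ' : A.Hor a' b'} {p' : HPath A.Hor b' c'} (h : HorTot.mk Γ = HorTot.mk Γ')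
    (h' : PathTot.mk p = PathTot.mk p') :
    PathTot.mk (HPath.cons Γ p) = PathTot.mk (HPath.cons Γ' p') := by
  cases h; cases h'; rfl

theorem pathTot_nil {A : VDGraph.{w}} {a a' : A.Ob} (h : a = a') :
    PathTot.mk (HPath.nil (H := A.Hor) a) = PathTot.mk (HPath.nil a') := by
  cases h; rfl

theorem IsDiscreteOpfibration.ver_lift (hP : P.IsDiscreteOpfibration) {y y' : Y.Ob} (v : y ⟶ y')
    (x : X.Ob) (h : P.toFunctor.obj x = y) :
    ∃ (x' : X.Ob) (m : x ⟶ x'), P.verTot ⟨m⟩ = ⟨v⟩ := by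
  subst h
  obtain ⟨⟨m⟩, hm, -⟩ := hP.existsUnique_ver x ⟨v⟩
  exact ⟨_, m, congrArg (fun u : Y.VerFrom _ => VerTot.mk u.f) hm⟩

theorem IsDiscreteOpfibration.ver_unique (hP : P.IsDiscreteOpfibration) {x x₁ x₂ : X.Ob}
    {m₁ : x ⟶ x₁} {m₂ : x ⟶ x₂} (h : P.verTot ⟨m₁⟩ = P.verTot ⟨m₂⟩) :
    VerFrom.mk m₁ = VerFrom.mk m₂ := by
  refine (hP.existsUnique_ver x (P.verFrom x ⟨m₁⟩)).unique rfl ?_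
  have key : ∀ {a b b' : Y.Ob} (f : a ⟶ b) (g : a ⟶ b'), VerTot.mk f = VerTot.mk g →
      VerFrom.mk g = VerFrom.mk f := by
    intro a b b' f g h
    cases h; rfl
  exact key _ _ h

theorem IsDiscreteOpfibration.cell_lift (hP : P.IsDiscreteOpfibration) {a b c d : Y.Ob}
    {p : HPath Y.Hor a b} {u : a ⟶ c} {u' : b ⟶ d} {Δ : Y.Hor c d} (ν : Y.Cell p u u' Δ)
    {x x' : X.Ob} (q : HPath X.Hor x x') (h : PathTot.mk (P.path q) = PathTot.mk p) :
    ∃ χ : X.CellFrom q, P.cellTot ⟨χ.θ⟩ = ⟨ν⟩ := by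
  cases h
  obtain ⟨χ, hχ, -⟩ := hP.existsUnique_cell q ⟨ν⟩
  exact ⟨χ, congrArg (fun u : Y.CellFrom _ => CellTot.mk u.θ) hχ⟩

theorem IsDiscreteOpfibration.cell_unique (hP : P.IsDiscreteOpfibration) {x x' : X.Ob}
    {q : HPath X.Hor x x'} {χ₁ χ₂ : X.CellFrom q} (h : P.cellTot ⟨χ₁.θ⟩ = P.cellTot ⟨χ₂.θ⟩) :
    χ₁ = χ₂ := by
  refine (hP.existsUnique_cell q (P.cellFrom q χ₁)).unique rfl ?_
  have key : ∀ {a b c d c' d' : Y.Ob} {p : HPath Y.Hor a b} {u : a ⟶ c} {u' : b ⟶ d}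
      {Δ : Y.Hor c d} (f : Y.Cell p u u' Δ) {v : a ⟶ c'} {v' : b ⟶ d'}
      {Δ' : Y.Hor c' d'} (g : Y.Cell p v v' Δ'), CellTot.mk f = CellTot.mk g →
      CellFrom.mk g = CellFrom.mk f := by
    intro a b c d c' d' p u u' Δ f v v' Δ' g h
    cases h; rfl
  exact key _ _ h

end VDFunctor

theorem SetSpan.exists_el {I I' : Type u} (T : SetSpan I I') (s : T.S) {i : I} {i' : I'}
    (h : T.left s = i) (h' : T.right s = i') : ∃ e : T.El i i', e.elem = s := by
  subst h h'; exact ⟨.mk s, rfl⟩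

theorem SetSpan.El.left_elem {I I' : Type u} {T : SetSpan I I'} {i : I} {i' : I'}
    (e : T.El i i') : T.left e.elem = i := by cases e; rfl

theorem SetSpan.El.right_elem {I I' : Type u} {T : SetSpan I I'} {i : I} {i' : I'}
    (e : T.El i i') : T.right e.elem = i' := by cases e; rfl

theorem SetSpan.El.heq {I I' : Type u} {T : SetSpan I I'} {i j : I} {i' j' : I'}
    (e : T.El i i') (e' : T.El j j') (h : e.elem = e'.elem) : HEq e e' := by
  cases e; cases e'; cases h; rfl

theorem SetSpan.El.elem_inj {I I' : Type u} {T : SetSpan I I'} {i : I} {i' : I'}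
    {e e' : T.El i i'} (h : e.elem = e'.elem) : e = e' := eq_of_heq (heq e e' h)

/-- Transport of a horizontal morphism along equalities of its ends. -/
def castHor {A : VDGraph.{w}} {a b : A.Ob} (T : A.HorTot) (h : T.a = a) (h' : T.b = b) :
    A.Hor a b := h ▸ h' ▸ T.Γ

theorem tot_castHor {A : VDGraph.{w}} {a b : A.Ob} (T : A.HorTot) (h : T.a = a) (h' : T.b = b) :
    VDGraph.HorTot.mk (castHor T h h') = T := by
  subst h h'; rfl

namespace Bar
open VDGraph VDFunctor IndexGraph

variable {X Y : VDC.{w}} {P : VDFunctor X Y}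

/-- The fibre at an object, as a type in `Type u`. -/
def SOb (hs : HasSmallFibres.{u} P)
    (y : Y.Ob) : Type u := @Shrink.{u} (P.ObFib y) (hs.small_ob y)

/-- The bijection between the fibre at an object and its small copy. -/
noncomputable def eOb (hs : HasSmallFibres.{u} P)
    (y : Y.Ob) : P.ObFib y ≃ SOb hs y :=
  @equivShrink.{u} (P.ObFib y) (hs.small_ob y)

/-- The fibre at a horizontal morphism, as a type in `Type u`. -/
def SHor (hs : HasSmallFibres.{u} P)
    {y y' : Y.Ob} (Ψ : Y.Hor y y') : Type u := @Shrink.{u} (P.HorFib Ψ) (hs.small_hor Ψ)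

/-- The bijection between the fibre at a horizontal morphism and its small copy. -/
noncomputable def eHor (hs : HasSmallFibres.{u} P)
    {y y' : Y.Ob} (Ψ : Y.Hor y y') : P.HorFib Ψ ≃ SHor hs Ψ :=
  @equivShrink.{u} (P.HorFib Ψ) (hs.small_hor Ψ)

/-- The family of the objects of `X` over `y`, indexed by themselves. -/
noncomputable def ob (hs : HasSmallFibres.{u} P)
    (y : Y.Ob) : setIndex.{u}.FOb X := ⟨SOb hs y, fun s => ((eOb hs y).symm s).1⟩

theorem map_ob (hs : HasSmallFibres.{u} P)
    (y : Y.Ob) (s : SOb hs y) : P.toFunctor.obj ((ob hs y).a s) = y :=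
  ((eOb hs y).symm s).2

theorem exists_ob (hs : HasSmallFibres.{u} P)
    {y : Y.Ob} (x : X.Ob) (h : P.toFunctor.obj x = y) :
    ∃ s : SOb hs y, (ob hs y).a s = x :=
  ⟨eOb hs y ⟨x, h⟩, congrArg Subtype.val ((eOb hs y).symm_apply_apply ⟨x, h⟩)⟩

theorem ob_inj (hs : HasSmallFibres.{u} P)
    {y : Y.Ob} {s s' : SOb hs y} (h : (ob hs y).a s = (ob hs y).a s') : s = s' :=
  (eOb hs y).symm.injective (Subtype.ext h)

theorem val_eq (hs : HasSmallFibres.{u} P) {y : Y.Ob} (x : P.ObFib y) {s : SOb hs y}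
    (h : eOb hs y x = s) : x.1 = (ob hs y).a s := by
  subst h
  exact (congrArg Subtype.val ((eOb hs y).symm_apply_apply x)).symm

/-- The span of the fibres. -/
noncomputable def span (hs : HasSmallFibres.{u} P)
    {y y' : Y.Ob} (Ψ : Y.Hor y y') : SetSpan (SOb hs y) (SOb hs y') :=
  ⟨SHor hs Ψ, fun s => eOb hs y ((eHor hs Ψ).symm s).src,
    fun s => eOb hs y' ((eHor hs Ψ).symm s).tgt⟩

/-- The family of the horizontal morphisms of `X` over `Ψ`, indexed by themselves. -/
noncomputable def hor (hs : HasSmallFibres.{u} P)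
    {y y' : Y.Ob} (Ψ : Y.Hor y y') : FHor (ob hs y) (ob hs y') :=
  ⟨span hs Ψ, fun s => castHor ((eHor hs Ψ).symm (SetSpan.El.elem s)).1
    (val_eq hs ((eHor hs Ψ).symm (SetSpan.El.elem s)).src (SetSpan.El.left_elem s))
    (val_eq hs ((eHor hs Ψ).symm (SetSpan.El.elem s)).tgt (SetSpan.El.right_elem s))⟩

theorem tot_hor (hs : HasSmallFibres.{u} P)
    {y y' : Y.Ob} (Ψ : Y.Hor y y') {i : SOb hs y} {j : SOb hs y'}
    (s : (span hs Ψ).El i j) :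
    HorTot.mk ((hor hs Ψ).Γ s) = ((eHor hs Ψ).symm s.elem).1 := tot_castHor _ _ _

theorem map_hor (hs : HasSmallFibres.{u} P)
    {y y' : Y.Ob} (Ψ : Y.Hor y y') {i : SOb hs y} {j : SOb hs y'}
    (s : (span hs Ψ).El i j) : P.horTot ⟨(hor hs Ψ).Γ s⟩ = ⟨Ψ⟩ :=
  (congrArg P.horTot (tot_hor hs Ψ s)).trans ((eHor hs Ψ).symm s.elem).2

theorem exists_hor (hs : HasSmallFibres.{u} P)
    {y y' : Y.Ob} (Ψ : Y.Hor y y') {i : SOb hs y} {j : SOb hs y'}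
    (Φ : X.Hor ((ob hs y).a i) ((ob hs y').a j)) (h : P.horTot ⟨Φ⟩ = ⟨Ψ⟩) :
    ∃ s : (span hs Ψ).El i j, (hor hs Ψ).Γ s = Φ := by
  obtain ⟨e, he⟩ := (span hs Ψ).exists_el (eHor hs Ψ ⟨⟨Φ⟩, h⟩) (i := i) (i' := j)
    (by
      change eOb hs y (HorFib.src ((eHor hs Ψ).symm (eHor hs Ψ ⟨⟨Φ⟩, h⟩))) = i
      rw [Equiv.symm_apply_apply]
      exact (eOb hs y).apply_symm_apply i)
    (by
      change eOb hs y' (HorFib.tgt ((eHor hs Ψ).symm (eHor hs Ψ ⟨⟨Φ⟩, h⟩))) = j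
      rw [Equiv.symm_apply_apply]
      exact (eOb hs y').apply_symm_apply j)
  refine ⟨e, ?_⟩
  have k := tot_hor hs Ψ e
  rw [he, Equiv.symm_apply_apply] at k
  cases k; rfl

theorem hor_inj (hs : HasSmallFibres.{u} P)
    {y y' : Y.Ob} {Ψ : Y.Hor y y'} {i : SOb hs y} {j : SOb hs y'}
    {s s' : (span hs Ψ).El i j} (h : (hor hs Ψ).Γ s = (hor hs Ψ).Γ s') : s = s' := by
  have k := (tot_hor hs Ψ s).symm.trans ((congrArg HorTot.mk h).trans (tot_hor hs Ψ s'))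
  exact SetSpan.El.elem_inj ((eHor hs Ψ).symm.injective (Subtype.ext k))

theorem exists_ver (hP : P.IsDiscreteOpfibration) (hs : HasSmallFibres.{u} P)
    {y y' : Y.Ob} (v : y ⟶ y') (s : SOb hs y) :
    ∃ (s' : SOb hs y') (m : (ob hs y).a s ⟶ (ob hs y').a s'), P.verTot ⟨m⟩ = ⟨v⟩ := by
  obtain ⟨x', m, hm⟩ := hP.ver_lift v _ (map_ob hs y s)
  obtain ⟨s', rfl⟩ := exists_ob hs x' (congrArg VerTot.b hm)
  exact ⟨s', m, hm⟩

theorem ver_ext (hP : P.IsDiscreteOpfibration) (hs : HasSmallFibres.{u} P)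
    {y y' : Y.Ob} {f g : ob hs y ⟶ ob hs y'}
    (h : ∀ s, P.verTot ⟨f.mor s⟩ = P.verTot ⟨g.mor s⟩) : f = g := by
  obtain ⟨fn, mor⟩ := f
  obtain ⟨fn', mor'⟩ := g
  have h₁ : fn = fn' := funext fun s => ob_inj hs (congrArg VerFrom.b (hP.ver_unique (h s)))
  subst h₁
  refine congrArg (FVer.mk fn) (funext fun s => ?_)
  have k := hP.ver_unique (h s)
  simpa using k

/-- The lifts of a vertical morphism. -/
noncomputable def ver (hP : P.IsDiscreteOpfibration) (hs : HasSmallFibres.{u} P)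
    {y y' : Y.Ob} (v : y ⟶ y') : ob hs y ⟶ ob hs y' :=
  FVer.mk (fun s => (exists_ver hP hs v s).choose)
    (fun s => (exists_ver hP hs v s).choose_spec.choose)

theorem map_ver (hP : P.IsDiscreteOpfibration) (hs : HasSmallFibres.{u} P)
    {y y' : Y.Ob} (v : y ⟶ y') (s : SOb hs y) :
    P.verTot ⟨(ver hP hs v).mor s⟩ = ⟨v⟩ :=
  (exists_ver hP hs v s).choose_spec.choose_spec

/-- The functor between the vertical categories. -/
noncomputable def functor (hP : P.IsDiscreteOpfibration) (hs : HasSmallFibres.{u} P)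
    : Y.Ob ⥤ setIndex.{u}.FOb X where
  obj := ob hs
  map := ver hP hs
  map_id y := ver_ext hP hs fun s => by
    refine (map_ver hP hs _ s).trans ?_
    refine Eq.trans ?_ (congrArg VerTot.mk (P.toFunctor.map_id ((ob hs y).a s))).symm
    rw [map_ob hs y s]
  map_comp v v' := ver_ext hP hs fun s => by
    refine (map_ver hP hs _ s).trans ?_
    refine Eq.trans ?_ (congrArg VerTot.mk (P.toFunctor.map_comp _ _)).symm
    exact verTot_comp (map_ver hP hs v s).symm (map_ver hP hs v' _).symm

theorem map_path (hs : HasSmallFibres.{u} P)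
    {y y' : Y.Ob} (p : HPath Y.Hor y y') {i : SOb hs y} {j : SOb hs y'}
    (t : Tup (p.map (ob hs) (hor hs)) i j) : PathTot.mk (P.path t.path) = PathTot.mk p := by
  induction p with
  | nil y =>
    obtain rfl := Tup.nil_eq (X := ob hs y) t
    obtain rfl := Tup.eq_nil (X := ob hs y) t
    exact pathTot_nil (map_ob hs y i)
  | cons Ψ p ih =>
    obtain ⟨l, s, t, rfl⟩ := Tup.exists_cons (S := hor hs Ψ) t
    exact pathTot_cons (map_hor hs Ψ s) (ih t)

theorem exists_cell (hP : P.IsDiscreteOpfibration) (hs : HasSmallFibres.{u} P)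
    {a b c d : Y.Ob} {p : HPath Y.Hor a b} {v : a ⟶ c} {v' : b ⟶ d}
    {Ψ : Y.Hor c d} (ν : Y.Cell p v v' Ψ) {i : SOb hs a} {j : SOb hs b}
    (t : Tup (p.map (ob hs) (hor hs)) i j) :
    ∃ (s : (span hs Ψ).El ((ver hP hs v).fn i) ((ver hP hs v').fn j))
      (χ : X.Cell t.path ((ver hP hs v).mor i) ((ver hP hs v').mor j) ((hor hs Ψ).Γ s)),
      P.cellTot ⟨χ⟩ = ⟨ν⟩ := by
  obtain ⟨⟨χ⟩, hχ⟩ := hP.cell_lift ν t.path (map_path hs p t)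
  have h₁ := hP.ver_unique ((congrArg (fun θ : Y.CellTot => VerTot.mk θ.u) hχ).trans
    (map_ver hP hs v i).symm)
  have h₂ := hP.ver_unique ((congrArg (fun θ : Y.CellTot => VerTot.mk θ.u') hχ).trans
    (map_ver hP hs v' j).symm)
  cases h₁; cases h₂
  obtain ⟨s, rfl⟩ := exists_hor hs Ψ _ (congrArg (fun θ : Y.CellTot => HorTot.mk θ.Δ) hχ)
  exact ⟨s, χ, hχ⟩

theorem cell_ext (hP : P.IsDiscreteOpfibration) (hs : HasSmallFibres.{u} P)
    {I I' : setIndex.{u}.FOb X} {c d : Y.Ob} {p : HPath FHor I I'} {f : I ⟶ ob hs c}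
    {f' : I' ⟶ ob hs d} {Ψ : Y.Hor c d} {θ θ' : FCell p f f' (hor hs Ψ)} {ν : Y.CellTot}
    (h : COver P θ ν) (h' : COver P θ' ν) : θ = θ' := by
  obtain ⟨fn, cell⟩ := θ
  obtain ⟨fn', cell'⟩ := θ'
  have k : ∀ {i : I.z} {j : I'.z} (t : Tup p i j),
      CellFrom.mk (cell t) = CellFrom.mk (cell' t) := fun t =>
    hP.cell_unique ((h t).trans (h' t).symm)
  have h₁ : @fn = @fn' := by
    funext i j t
    refine hor_inj hs ?_
    have := congrArg (fun χ : X.CellFrom _ => HorTot.mk χ.Δ) (k t)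
    simpa using this
  subst h₁
  congr 1
  funext i j t
  simpa using k t

/-- The lifts of a multicell. -/
noncomputable def cell (hP : P.IsDiscreteOpfibration) (hs : HasSmallFibres.{u} P)
    {a b c d : Y.Ob} {p : HPath Y.Hor a b} {v : a ⟶ c} {v' : b ⟶ d}
    {Ψ : Y.Hor c d} (ν : Y.Cell p v v' Ψ) :
    FCell (p.map (ob hs) (hor hs)) (ver hP hs v) (ver hP hs v') (hor hs Ψ) where
  fn t := (exists_cell hP hs ν t).choose
  cell t := (exists_cell hP hs ν t).choose_spec.choose

theorem map_cell (hP : P.IsDiscreteOpfibration) (hs : HasSmallFibres.{u} P)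
    {a b c d : Y.Ob} {p : HPath Y.Hor a b} {v : a ⟶ c} {v' : b ⟶ d}
    {Ψ : Y.Hor c d} (ν : Y.Cell p v v' Ψ) : COver P (cell hP hs ν) ⟨ν⟩ := fun t =>
  (exists_cell hP hs ν t).choose_spec.choose_spec

/-- The map of graphs that is given by the families of fibres. -/
noncomputable def graph {X Y : VDC.{max (u + 1) w}} {P : VDFunctor X Y}
    (hP : P.IsDiscreteOpfibration) (hs : HasSmallFibres.{u} P) :
    VDGraphHom Y.toVDGraph (Fam.{u} X).toVDGraph where
  toFunctor := functor hP hs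
  hor := hor hs
  cell := cell hP hs

theorem map_seq {X Y : VDC.{max (u + 1) w}} {P : VDFunctor X Y} (hP : P.IsDiscreteOpfibration) (hs : HasSmallFibres.{u} P) {a b c d : Y.Ob}
    {p : HPath Y.Hor a b} {v : a ⟶ c} {v' : b ⟶ d} {q : HPath Y.Hor c d}
    (N : Y.CellSeq p v v' q) : SOver P ((graph hP hs).seq N) ⟨N⟩ := by
  induction N with
  | nil v => exact sOver_nil P _ v (map_ver hP hs v)
  | cons ν N hp ih => exact sOver_cons P _ _ _ ν N hp (map_cell hP hs ν) ih

theorem map_comp {X Y : VDC.{max (u + 1) w}} {P : VDFunctor X Y} (hP : P.IsDiscreteOpfibration)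
    (hs : HasSmallFibres.{u} P) {a b c d e f : Y.Ob}
    {p : HPath Y.Hor a b} {v : a ⟶ c} {v' : b ⟶ d} {q : HPath Y.Hor c d} {z : c ⟶ e} {z' : d ⟶ f}
    {Ψ : Y.Hor e f} (N : Y.CellSeq p v v' q) (ν : Y.Cell q z z' Ψ)
    {x : ob hs a ⟶ ob hs e} {x' : ob hs b ⟶ ob hs f} (h : ver hP hs v ≫ ver hP hs z = x)
    (h' : ver hP hs v' ≫ ver hP hs z' = x') :
    COver P (famComp ((graph hP hs).seq N) (cell hP hs ν) h h') ⟨Y.comp N ν rfl rfl⟩ :=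
  cOver_famComp P ((graph hP hs).seq N) (cell hP hs ν) h h' N ν rfl rfl (map_seq hP hs N)
    (map_cell hP hs ν)

end Bar

/-- The virtual double functor `Y ⟶ Fam X` of a discrete opfibration `P : X ⟶ Y` with small fibres. It
sends an object `y` to the family of all objects of `X` over `y`, indexed by themselves, and a
horizontal morphism `Ψ` to the family of all horizontal morphisms of `X` over `Ψ`, indexed by
themselves. A vertical morphism and a multicell are sent to the families of their lifts. -/
noncomputable def bar {X Y : VDC.{max (u + 1) w}} (P : X ⟶ Y)
    (hP : VDFunctor.IsDiscreteOpfibration P) (hs : VDFunctor.HasSmallFibres.{u} P) :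
    Y ⟶ Fam.{u} X where
  toVDGraphHom := Bar.graph hP hs
  cell_hid Ψ := Bar.cell_ext hP hs (Bar.map_cell hP hs _)
    (IndexGraph.cOver_famId P _ _ _ rfl rfl fun s => Bar.map_hor hs Ψ s)
  cell_comp N ν := Bar.cell_ext hP hs (Bar.map_cell hP hs (Y.comp N ν rfl rfl))
    (Bar.map_comp hP hs N ν _ _)

/-- The virtual double functor from `Y` to the virtual double category of spans that corresponds to
a discrete opfibration `P : X ⟶ Y` with small fibres. It sends `y` to the set of objects of `X` over
`y`, a vertical morphism `v` to the function that sends `x` to the codomain of the lift of `v` at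
`x`, a horizontal morphism `Ψ` to the span of the horizontal morphisms of `X` over `Ψ`, and a
multicell `ν` to the function that sends a tuple to the bottom edge of the lift of `ν` at it. -/
noncomputable def fibreSpan {X Y : VDC.{max (u + 1) w}} (P : X ⟶ Y)
    (hP : VDFunctor.IsDiscreteOpfibration P) (hs : VDFunctor.HasSmallFibres.{u} P) :
    Y ⟶ SpanVDC.{u, max (u + 1) w} := bar P hP hs ≫ Fam.map (toTerminal X)

/-- `η` is the unit at `D : Y ⟶ Fam 1` of the adjunction between `A ↦ (Fam A ⟶ Fam 1)`, as a functor
to virtual double categories over `Fam 1`, and its left adjoint, the virtual double category of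
elements, where `X` is the value of the left adjoint at `D`. That is, `η` is a morphism over `Fam 1`
from `D` to `Fam X ⟶ Fam 1`, and it is universal among such morphisms. -/
structure IsFamUnit {X Y : VDC.{max (u + 1) w}} (D : Y ⟶ SpanVDC.{u, max (u + 1) w})
    (η : Y ⟶ Fam.{u} X) : Prop where
  comp_map : η ≫ Fam.map (toTerminal X) = D
  existsUnique : ∀ {A : VDC.{max (u + 1) w}} (G : Y ⟶ Fam.{u} A),
    G ≫ Fam.map (toTerminal A) = D → ∃! K : X ⟶ A, η ≫ Fam.map K = G

/-! Both statements express that `X` is recovered from `bar` as its virtual double category of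
elements: an object of `X` is an object of `Y` with an element of its fibre, a horizontal morphism
likewise, and the vertical morphisms and multicells of `X` are the lifts of those of `Y`.

For the pullback, the point is uniqueness of lifts. A vertical morphism or multicell of `Fam X`
between the tautological families on fibres is determined by the vertical morphism or multicell of
`Y` over which all its members lie (`Bar.verTot_eq_ver`, `Bar.cellTot_eq_cell`). So a datum of `Fam
A` with the same image in `Fam X` as a datum of `Y` is a family over a fibre whose members are sent
by `F` to the objects, horizontal morphisms or lifts that index them, and this is a datum of the
dependent product. Hence the square is a pullback separately on objects and, for fixed boundary, on
vertical morphisms, horizontal morphisms and multicells (`Bar.isLevelwisePullback`). That this gives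
a strict 2-pullback is formal: values are chosen level by level, and every law is checked after the
two projections, which are jointly injective (`exists_lift`, `functor_ext`, `existsUnique_trans`).
The remaining work is a matter of size. The dependent product is indexed by the actual fibres and
`Fam` by their small copies, so `T` forgets down to families over fibres and then reindexes along
bijections. Reindexing respects composition by `Reindex.act_graph`, and it loses nothing by the
lemmas `exists_r*` and `r*_inj`.

For the unit, a `Marking` assigns to each object and horizontal morphism of `X` an element of the
index set that `M : Y ⟶ Fam B` gives to its image in `Y`. If the marking exhibits `X` as the
elements of `M` (`IsElements`), then reading off the members of `M` at the marked elements defines a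
virtual double functor `K : X ⟶ B` (`exists_realizes`). Conversely `M` is determined by its index
data, the marking and `K` (`functor_eq_of_realizes`). Now `bar` has a canonical marking, realized by
the identity of `X`. Being a marking by elements depends only on index data, that is, on the
composite to spans. A `G` over the same spans therefore inherits the marking, and its realization is
the required `K`.

Throughout, equalities between data whose boundaries agree only propositionally are stated for the
data bundled with their boundaries (`CellTot`, `VerTot`, `HorTot`, `PathTot`); casts vanish there,
and `cases` identifies a whole boundary at once. -/

/-! ### Bundled boundaries and extensionality of virtual double functors. -/

namespace VDGraph

variable {A : VDGraph.{w}}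

/-- The boundary of a multicell. -/
structure Bd (A : VDGraph.{w}) : Type w where
  {a b c d : A.Ob}
  p : HPath A.Hor a b
  u : a ⟶ c
  u' : b ⟶ d
  Δ : A.Hor c d

/-- The boundary of a multicell. -/
def CellTot.bd (θ : A.CellTot) : A.Bd := ⟨θ.p, θ.u, θ.u', θ.Δ⟩

/-- This is how a multicell is moved to a prescribed boundary without a cast: a single equation in
`Bd` identifies all parts of the boundary simultaneously. -/
theorem CellTot.exists_cell (θ : A.CellTot) {a b c d : A.Ob} {p : HPath A.Hor a b} {u : a ⟶ c}
    {u' : b ⟶ d} {Δ : A.Hor c d} (h : θ.bd = ⟨p, u, u', Δ⟩) :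
    ∃ χ : A.Cell p u u' Δ, CellTot.mk χ = θ := by
  obtain ⟨θ⟩ := θ
  cases h
  exact ⟨θ, rfl⟩

theorem VerTot.exists_ver (f : A.VerTot) {a b : A.Ob} (ha : f.a = a) (hb : f.b = b) :
    ∃ g : a ⟶ b, VerTot.mk g = f := by
  subst ha hb
  exact ⟨f.f, rfl⟩

theorem HorTot.exists_hor (Γ : A.HorTot) {a b : A.Ob} (ha : Γ.a = a) (hb : Γ.b = b) :
    ∃ Δ : A.Hor a b, HorTot.mk Δ = Γ := by
  subst ha hb
  exact ⟨Γ.Γ, rfl⟩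

theorem eq_of_verTot {a b : A.Ob} {f g : a ⟶ b} (h : VerTot.mk f = VerTot.mk g) : f = g := by
  cases h; rfl

theorem eq_of_horTot {a b : A.Ob} {Γ Δ : A.Hor a b} (h : HorTot.mk Γ = HorTot.mk Δ) : Γ = Δ := by
  cases h; rfl

theorem verTot_id {a b : A.Ob} (h : a = b) : VerTot.mk (𝟙 a) = VerTot.mk (𝟙 b) := by
  cases h; rfl

theorem verTot_of_verFrom {a b c : A.Ob} {f : a ⟶ b} {g : a ⟶ c}
    (h : VerFrom.mk f = VerFrom.mk g) : VerTot.mk f = VerTot.mk g := by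
  cases h; rfl

open VDFunctor in
theorem Bd.ext_tot {a b c d a' b' c' d' : A.Ob} {p : HPath A.Hor a b} {u : a ⟶ c} {u' : b ⟶ d}
    {Δ : A.Hor c d} {q : HPath A.Hor a' b'} {v : a' ⟶ c'} {v' : b' ⟶ d'} {Γ : A.Hor c' d'}
    (hp : PathTot.mk p = PathTot.mk q) (hu : VerTot.mk u = VerTot.mk v)
    (hu' : VerTot.mk u' = VerTot.mk v') (hΔ : HorTot.mk Δ = HorTot.mk Γ) :
    Bd.mk p u u' Δ = Bd.mk q v v' Γ := by
  cases hp; cases hu; cases hu'; cases hΔ; rfl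

end VDGraph

namespace VDFunctor
open VDGraph

variable {A B C : VDC.{w}}

/-- Once the object maps are identified, the vertical maps become parallel, then the horizontal
ones, then those on multicells, so bundled equality suffices at each stage and no heterogeneous
equality has to be supplied. -/
theorem ext_tot {F G : VDFunctor A B} (ho : ∀ a, F.toFunctor.obj a = G.toFunctor.obj a)
    (hv : ∀ {a b : A.Ob} (f : a ⟶ b), F.verTot ⟨f⟩ = G.verTot ⟨f⟩)
    (hh : ∀ {a b : A.Ob} (Γ : A.Hor a b), F.horTot ⟨Γ⟩ = G.horTot ⟨Γ⟩)
    (hc : ∀ {a b c d : A.Ob} {p : HPath A.Hor a b} {u : a ⟶ c} {u' : b ⟶ d} {Δ : A.Hor c d}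
      (θ : A.Cell p u u' Δ), F.cellTot ⟨θ⟩ = G.cellTot ⟨θ⟩) : F = G := by
  obtain ⟨⟨⟨obj, map, h₁, h₂⟩, hor, cell⟩, h₃, h₄⟩ := F
  obtain ⟨⟨⟨obj', map', h₁', h₂'⟩, hor', cell'⟩, h₃', h₄'⟩ := G
  obtain rfl : obj = obj' := funext ho
  obtain rfl : @map = @map' := by
    funext a b f
    exact eq_of_verTot (hv f)
  obtain rfl : @hor = @hor' := by
    funext a b Γ
    exact eq_of_horTot (hh Γ)
  exact ext_graph (VDGraphHom.ext_cell hc)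

theorem pathTot_map {W : VDGraph.{w}} {A : VDGraph.{w}} {f g : W.Ob → A.Ob}
    {h : ∀ {a b : W.Ob}, W.Hor a b → A.Hor (f a) (f b)}
    {h' : ∀ {a b : W.Ob}, W.Hor a b → A.Hor (g a) (g b)} (ho : ∀ a, f a = g a)
    (hh : ∀ {a b : W.Ob} (Γ : W.Hor a b), HorTot.mk (h Γ) = HorTot.mk (h' Γ)) {a b : W.Ob}
    (p : HPath W.Hor a b) : PathTot.mk (p.map f h) = PathTot.mk (p.map g h') := by
  induction p with
  | nil a => exact pathTot_nil (ho a)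
  | cons Γ p ih => exact pathTot_cons (hh Γ) ih

theorem verTot_congr {F G : VDFunctor A B} (h : F = G) {a b : A.Ob} (f : a ⟶ b) :
    F.verTot ⟨f⟩ = G.verTot ⟨f⟩ := by subst h; rfl

theorem horTot_congr {F G : VDFunctor A B} (h : F = G) {a b : A.Ob} (Γ : A.Hor a b) :
    F.horTot ⟨Γ⟩ = G.horTot ⟨Γ⟩ := by subst h; rfl

theorem ob_congr {F G : VDFunctor A B} (h : F = G) (a : A.Ob) :
    F.toFunctor.obj a = G.toFunctor.obj a := by subst h; rfl

theorem cellTot_congr {F G : VDFunctor A B} (h : F = G) {a b c d : A.Ob} {p : HPath A.Hor a b}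
    {u : a ⟶ c} {u' : b ⟶ d} {Δ : A.Hor c d} (θ : A.Cell p u u' Δ) :
    F.cellTot ⟨θ⟩ = G.cellTot ⟨θ⟩ := by subst h; rfl

/-- A composite acts on multicells through a `castTop` along `path_comp`, which is invisible after
bundling. -/
theorem cellTot_comp (F : VDFunctor A B) (G : VDFunctor B C) {a b c d : A.Ob}
    {p : HPath A.Hor a b} {u : a ⟶ c} {u' : b ⟶ d} {Δ : A.Hor c d} (θ : A.Cell p u u' Δ) :
    (F.comp G).cellTot ⟨θ⟩ = G.cellTot (F.cellTot ⟨θ⟩) :=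
  VDGraphHom.tot_comp F.toVDGraphHom G.toVDGraphHom θ

end VDFunctor

/-! ### Levelwise pullbacks and their universal property for virtual double functors. -/

/-- A commutative square of virtual double functors that is a pullback on objects, and on vertical
morphisms, horizontal morphisms and multicells with a given boundary. -/
structure IsLevelwisePullback {Q A B C : VDC.{w}} (T : VDFunctor Q A) (S : VDFunctor Q B)
    (f : VDFunctor A C) (g : VDFunctor B C) : Prop where
  comm : T.comp f = S.comp g
  ob : ∀ (a : A.Ob) (b : B.Ob), f.toFunctor.obj a = g.toFunctor.obj b →
    ∃! q, T.toFunctor.obj q = a ∧ S.toFunctor.obj q = b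
  ver : ∀ {q q' : Q.Ob} (α : T.toFunctor.obj q ⟶ T.toFunctor.obj q')
    (β : S.toFunctor.obj q ⟶ S.toFunctor.obj q'), f.verTot ⟨α⟩ = g.verTot ⟨β⟩ →
    ∃! χ : q ⟶ q', T.toFunctor.map χ = α ∧ S.toFunctor.map χ = β
  hor : ∀ {q q' : Q.Ob} (α : A.Hor (T.toFunctor.obj q) (T.toFunctor.obj q'))
    (β : B.Hor (S.toFunctor.obj q) (S.toFunctor.obj q')), f.horTot ⟨α⟩ = g.horTot ⟨β⟩ →
    ∃! χ : Q.Hor q q', T.hor χ = α ∧ S.hor χ = β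
  cell : ∀ {a b c d : Q.Ob} {p : HPath Q.Hor a b} {u : a ⟶ c} {u' : b ⟶ d} {Δ : Q.Hor c d}
    (α : A.Cell (T.path p) (T.toFunctor.map u) (T.toFunctor.map u') (T.hor Δ))
    (β : B.Cell (S.path p) (S.toFunctor.map u) (S.toFunctor.map u') (S.hor Δ)),
    f.cellTot ⟨α⟩ = g.cellTot ⟨β⟩ → ∃! χ : Q.Cell p u u' Δ, T.cell χ = α ∧ S.cell χ = β

namespace IsLevelwisePullback
open VDGraph VDFunctor

variable {Q A B C W : VDC.{w}} {T : VDFunctor Q A} {S : VDFunctor Q B}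
    {f : VDFunctor A C} {g : VDFunctor B C} (hQ : IsLevelwisePullback T S f g)
include hQ

/-- Since the square commutes, the images of `q'` form a compatible pair, and both `q` and `q'` lie
over it. The same argument makes the projections jointly injective on parallel morphisms and on
multicells with a common boundary. -/
theorem ob_ext {q q' : Q.Ob} (h : T.toFunctor.obj q = T.toFunctor.obj q')
    (h' : S.toFunctor.obj q = S.toFunctor.obj q') : q = q' :=
  (hQ.ob _ _ (ob_congr hQ.comm q')).unique ⟨h, h'⟩ ⟨rfl, rfl⟩

theorem ver_ext {q q' : Q.Ob} {χ χ' : q ⟶ q'} (h : T.verTot ⟨χ⟩ = T.verTot ⟨χ'⟩)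
    (h' : S.verTot ⟨χ⟩ = S.verTot ⟨χ'⟩) : χ = χ' :=
  (hQ.ver _ _ (verTot_congr hQ.comm χ')).unique ⟨eq_of_verTot h, eq_of_verTot h'⟩ ⟨rfl, rfl⟩

theorem hor_ext {q q' : Q.Ob} {χ χ' : Q.Hor q q'} (h : T.horTot ⟨χ⟩ = T.horTot ⟨χ'⟩)
    (h' : S.horTot ⟨χ⟩ = S.horTot ⟨χ'⟩) : χ = χ' :=
  (hQ.hor _ _ (horTot_congr hQ.comm χ')).unique ⟨eq_of_horTot h, eq_of_horTot h'⟩ ⟨rfl, rfl⟩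

theorem cellTot_comm {a b c d : Q.Ob} {p : HPath Q.Hor a b} {u : a ⟶ c} {u' : b ⟶ d}
    {Δ : Q.Hor c d} (χ : Q.Cell p u u' Δ) :
    f.cellTot ⟨T.cell χ⟩ = g.cellTot ⟨S.cell χ⟩ :=
  (cellTot_comp T f χ).symm.trans ((cellTot_congr hQ.comm χ).trans (cellTot_comp S g χ))

theorem cell_ext {a b c d : Q.Ob} {p : HPath Q.Hor a b} {u : a ⟶ c} {u' : b ⟶ d} {Δ : Q.Hor c d}
    {χ χ' : Q.Cell p u u' Δ} (h : T.cellTot ⟨χ⟩ = T.cellTot ⟨χ'⟩)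
    (h' : S.cellTot ⟨χ⟩ = S.cellTot ⟨χ'⟩) : χ = χ' :=
  (hQ.cell _ _ (hQ.cellTot_comm χ')).unique ⟨eq_of_tot h, eq_of_tot h'⟩ ⟨rfl, rfl⟩

/-- The bundled form is needed because, when a lift is built, the ends of the given morphisms are
equal to the images of `q` and `q'` only propositionally. -/
theorem exists_ver {q q' : Q.Ob} (α : A.VerTot) (β : B.VerTot) (h : f.verTot α = g.verTot β)
    (ha : α.a = T.toFunctor.obj q) (ha' : α.b = T.toFunctor.obj q')
    (hb : β.a = S.toFunctor.obj q) (hb' : β.b = S.toFunctor.obj q') :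
    ∃ χ : q ⟶ q', T.verTot ⟨χ⟩ = α ∧ S.verTot ⟨χ⟩ = β := by
  obtain ⟨α, rfl⟩ := α.exists_ver ha ha'
  obtain ⟨β, rfl⟩ := β.exists_ver hb hb'
  obtain ⟨χ, ⟨rfl, rfl⟩, -⟩ := hQ.ver α β h
  exact ⟨χ, rfl, rfl⟩

theorem exists_hor {q q' : Q.Ob} (α : A.HorTot) (β : B.HorTot) (h : f.horTot α = g.horTot β)
    (ha : α.a = T.toFunctor.obj q) (ha' : α.b = T.toFunctor.obj q')
    (hb : β.a = S.toFunctor.obj q) (hb' : β.b = S.toFunctor.obj q') :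
    ∃ χ : Q.Hor q q', T.horTot ⟨χ⟩ = α ∧ S.horTot ⟨χ⟩ = β := by
  obtain ⟨α, rfl⟩ := α.exists_hor ha ha'
  obtain ⟨β, rfl⟩ := β.exists_hor hb hb'
  obtain ⟨χ, ⟨rfl, rfl⟩, -⟩ := hQ.hor α β h
  exact ⟨χ, rfl, rfl⟩

theorem exists_cell {a b c d : Q.Ob} {p : HPath Q.Hor a b} {u : a ⟶ c} {u' : b ⟶ d}
    {Δ : Q.Hor c d} (α : A.CellTot) (β : B.CellTot) (h : f.cellTot α = g.cellTot β)
    (hα : α.bd = ⟨T.path p, T.toFunctor.map u, T.toFunctor.map u', T.hor Δ⟩)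
    (hβ : β.bd = ⟨S.path p, S.toFunctor.map u, S.toFunctor.map u', S.hor Δ⟩) :
    ∃ χ : Q.Cell p u u' Δ, T.cellTot ⟨χ⟩ = α ∧ S.cellTot ⟨χ⟩ = β := by
  obtain ⟨α, rfl⟩ := α.exists_cell hα
  obtain ⟨β, rfl⟩ := β.exists_cell hβ
  obtain ⟨χ, ⟨rfl, rfl⟩, -⟩ := hQ.cell α β h
  exact ⟨χ, rfl, rfl⟩

/-- Joint injectivity of the projections, applied level by level; each level first needs the
boundaries identified by the previous ones. -/
theorem functor_ext {K K' : VDFunctor W Q} (hT : K.comp T = K'.comp T)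
    (hS : K.comp S = K'.comp S) : K = K' := by
  have ho : ∀ a, K.toFunctor.obj a = K'.toFunctor.obj a := fun a =>
    hQ.ob_ext (ob_congr hT a) (ob_congr hS a)
  have hv : ∀ {a b : W.Ob} (v : a ⟶ b), K.verTot ⟨v⟩ = K'.verTot ⟨v⟩ := by
    intro a b v
    -- `χ` is the value of `K'` moved to the ends of the value of `K`; `ver_ext` only compares
    -- parallel morphisms.
    obtain ⟨χ, hχ⟩ := VerTot.exists_ver (K'.verTot ⟨v⟩) (ho a).symm (ho b).symm
    refine Eq.trans (congrArg VerTot.mk (hQ.ver_ext ?_ ?_)) hχ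
    · exact (verTot_congr hT v).trans (congrArg T.verTot hχ.symm)
    · exact (verTot_congr hS v).trans (congrArg S.verTot hχ.symm)
  have hh : ∀ {a b : W.Ob} (Γ : W.Hor a b), K.horTot ⟨Γ⟩ = K'.horTot ⟨Γ⟩ := by
    intro a b Γ
    obtain ⟨χ, hχ⟩ := HorTot.exists_hor (K'.horTot ⟨Γ⟩) (ho a).symm (ho b).symm
    refine Eq.trans (congrArg HorTot.mk (hQ.hor_ext ?_ ?_)) hχ
    · exact (horTot_congr hT Γ).trans (congrArg T.horTot hχ.symm)
    · exact (horTot_congr hS Γ).trans (congrArg S.horTot hχ.symm)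
  refine ext_tot ho hv hh fun {a b c d p u u' Δ} θ => ?_
  obtain ⟨χ, hχ⟩ := CellTot.exists_cell (K'.cellTot ⟨θ⟩)
    (Bd.ext_tot (pathTot_map ho hh p).symm (hv u).symm (hv u').symm (hh Δ).symm)
  refine Eq.trans (congrArg CellTot.mk (hQ.cell_ext ?_ ?_)) hχ
  · exact (cellTot_comp K T θ).symm.trans ((cellTot_congr hT θ).trans
      ((cellTot_comp K' T θ).trans (congrArg T.cellTot hχ.symm)))
  · exact (cellTot_comp K S θ).symm.trans ((cellTot_congr hS θ).trans
      ((cellTot_comp K' S θ).trans (congrArg S.cellTot hχ.symm)))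

/-- The values are chosen level by level from compatible pairs. Every law of the resulting
assignment holds because its two projections are the corresponding laws of `H` and `L`, and the
projections are jointly injective. -/
theorem exists_lift (H : VDFunctor W A) (L : VDFunctor W B) (h : H.comp f = L.comp g) :
    ∃ K : VDFunctor W Q, K.comp T = H ∧ K.comp S = L := by
  choose ob hoT hoS using fun a => (hQ.ob _ _ (ob_congr h a)).exists
  have hv := fun (a b : W.Ob) (v : a ⟶ b) => hQ.exists_ver (H.verTot ⟨v⟩) (L.verTot ⟨v⟩)
    (verTot_congr h v) (hoT a).symm (hoT b).symm (hoS a).symm (hoS b).symm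
  choose ver hvT hvS using hv
  have hh := fun (a b : W.Ob) (Γ : W.Hor a b) => hQ.exists_hor (H.horTot ⟨Γ⟩) (L.horTot ⟨Γ⟩)
    (horTot_congr h Γ) (hoT a).symm (hoT b).symm (hoS a).symm (hoS b).symm
  choose hor hhT hhS using hh
  let Φ : W.Ob ⥤ Q.Ob :=
    { obj := ob
      map := fun v => ver _ _ v
      map_id := fun a => by
        refine hQ.ver_ext ((hvT _ _ _).trans ?_) ((hvS _ _ _).trans ?_)
        · refine (congrArg VerTot.mk (H.toFunctor.map_id a)).trans ?_
          exact (verTot_id (hoT a).symm).trans (congrArg VerTot.mk (T.toFunctor.map_id _)).symm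
        · refine (congrArg VerTot.mk (L.toFunctor.map_id a)).trans ?_
          exact (verTot_id (hoS a).symm).trans (congrArg VerTot.mk (S.toFunctor.map_id _)).symm
      map_comp := fun v v' => by
        refine hQ.ver_ext ((hvT _ _ _).trans ?_) ((hvS _ _ _).trans ?_)
        · refine (congrArg VerTot.mk (H.toFunctor.map_comp v v')).trans ?_
          exact (verTot_comp (hvT _ _ v).symm (hvT _ _ v').symm).trans
            (congrArg VerTot.mk (T.toFunctor.map_comp _ _)).symm
        · refine (congrArg VerTot.mk (L.toFunctor.map_comp v v')).trans ?_
          exact (verTot_comp (hvS _ _ v).symm (hvS _ _ v').symm).trans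
            (congrArg VerTot.mk (S.toFunctor.map_comp _ _)).symm }
  -- Multicells can be lifted only over a boundary in `Q`, so the top paths of the images must first
  -- be recognised as images of the lifted path.
  have hpT : ∀ {a b : W.Ob} (p : HPath W.Hor a b),
      PathTot.mk (H.path p) = PathTot.mk (T.path (p.map ob (hor _ _))) := by
    intro a b p
    induction p with
    | nil a => exact pathTot_nil (hoT a).symm
    | cons Γ p ih => exact pathTot_cons (hhT _ _ Γ).symm ih
  have hpS : ∀ {a b : W.Ob} (p : HPath W.Hor a b),
      PathTot.mk (L.path p) = PathTot.mk (S.path (p.map ob (hor _ _))) := by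
    intro a b p
    induction p with
    | nil a => exact pathTot_nil (hoS a).symm
    | cons Γ p ih => exact pathTot_cons (hhS _ _ Γ).symm ih
  have hc := fun (a b c d : W.Ob) (p : HPath W.Hor a b) (u : a ⟶ c) (u' : b ⟶ d)
      (Δ : W.Hor c d) (θ : W.Cell p u u' Δ) =>
    hQ.exists_cell (p := p.map ob (hor _ _)) (u := ver _ _ u) (u' := ver _ _ u')
      (Δ := hor _ _ Δ) (H.cellTot ⟨θ⟩) (L.cellTot ⟨θ⟩)
      ((cellTot_comp H f θ).symm.trans ((cellTot_congr h θ).trans (cellTot_comp L g θ)))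
      (Bd.ext_tot (hpT p) (hvT _ _ u).symm (hvT _ _ u').symm (hhT _ _ Δ).symm)
      (Bd.ext_tot (hpS p) (hvS _ _ u).symm (hvS _ _ u').symm (hhS _ _ Δ).symm)
  choose cell hcT hcS using hc
  let N : VDGraphHom W.toVDGraph Q.toVDGraph :=
    { toFunctor := Φ
      hor := fun Γ => hor _ _ Γ
      cell := fun θ => cell _ _ _ _ _ _ _ _ θ }
  -- Preservation of composites also needs the comparison for whole sequences of multicells, before
  -- `N` is known to be a virtual double functor.
  have hsT : ∀ {a b c d : W.Ob} {p : HPath W.Hor a b} {u : a ⟶ c} {u' : b ⟶ d}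
      {q : HPath W.Hor c d} (Θ : W.CellSeq p u u' q),
      SeqTot.mk (H.seq Θ) = SeqTot.mk (T.seq (N.seq Θ)) := by
    intro a b c d p u u' q Θ
    induction Θ with
    | nil u => exact seqTot_nil (hvT _ _ u).symm
    | cons θ Θ hp ih => exact seqTot_cons _ _ _ _ _ _ (hcT _ _ _ _ _ _ _ _ θ).symm ih
  have hsS : ∀ {a b c d : W.Ob} {p : HPath W.Hor a b} {u : a ⟶ c} {u' : b ⟶ d}
      {q : HPath W.Hor c d} (Θ : W.CellSeq p u u' q),
      SeqTot.mk (L.seq Θ) = SeqTot.mk (S.seq (N.seq Θ)) := by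
    intro a b c d p u u' q Θ
    induction Θ with
    | nil u => exact seqTot_nil (hvS _ _ u).symm
    | cons θ Θ hp ih => exact seqTot_cons _ _ _ _ _ _ (hcS _ _ _ _ _ _ _ _ θ).symm ih
  refine ⟨⟨N, fun Γ => hQ.cell_ext ?_ ?_, fun Θ κ => hQ.cell_ext ?_ ?_⟩, ?_, ?_⟩
  · refine (hcT _ _ _ _ _ _ _ _ _).trans ((H.cellTot_hid Γ rfl rfl).trans ?_)
    exact (tot_hid_congr (hhT _ _ Γ).symm).trans (T.cellTot_hid _ _ _).symm
  · refine (hcS _ _ _ _ _ _ _ _ _).trans ((L.cellTot_hid Γ rfl rfl).trans ?_)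
    exact (tot_hid_congr (hhS _ _ Γ).symm).trans (S.cellTot_hid _ _ _).symm
  · refine (hcT _ _ _ _ _ _ _ _ _).trans ((congrArg CellTot.mk (H.cell_comp Θ κ)).trans ?_)
    refine Eq.trans ?_ (congrArg CellTot.mk (T.cell_comp' (N.seq Θ) (N.cell κ) _ _)).symm
    exact A.tot_comp _ _ _ _ _ _ _ _ (hsT Θ) (hcT _ _ _ _ _ _ _ _ κ).symm
  · refine (hcS _ _ _ _ _ _ _ _ _).trans ((congrArg CellTot.mk (L.cell_comp Θ κ)).trans ?_)
    refine Eq.trans ?_ (congrArg CellTot.mk (S.cell_comp' (N.seq Θ) (N.cell κ) _ _)).symm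
    exact B.tot_comp _ _ _ _ _ _ _ _ (hsS Θ) (hcS _ _ _ _ _ _ _ _ κ).symm
  · exact ext_tot hoT (hvT _ _) (hhT _ _) fun θ =>
      (cellTot_comp _ T θ).trans (hcT _ _ _ _ _ _ _ _ θ)
  · exact ext_tot hoS (hvS _ _) (hhS _ _) fun θ =>
      (cellTot_comp _ S θ).trans (hcS _ _ _ _ _ _ _ _ θ)

end IsLevelwisePullback

/-! ### Vertical transformations into a levelwise pullback. -/

namespace VDTrans
open VDGraph VDFunctor

theorem ext_tot {A B : VDC.{w}} {F G : VDFunctor A B} {α β : VDTrans F G}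
    (hn : ∀ a, VerTot.mk (α.nat.app a) = VerTot.mk (β.nat.app a))
    (hc : ∀ {a b : A.Ob} (Γ : A.Hor a b), CellTot.mk (α.cell Γ) = CellTot.mk (β.cell Γ)) :
    α = β := by
  obtain ⟨n, c, h⟩ := α
  obtain ⟨n', c', h'⟩ := β
  obtain rfl : n = n' := NatTrans.ext (funext fun a => eq_of_verTot (hn a))
  obtain rfl : @c = @c' := by
    funext a b Γ
    exact eq_of_tot (hc Γ)
  rfl

/-- The two whiskerings around a commutative square have types that agree only up to the
commutativity equation. This turns their heterogeneous equality into bundled equalities of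
components. -/
theorem app_of_heq {A B : VDC.{w}} {F G F' G' : VDFunctor A B} {α : VDTrans F G}
    {β : VDTrans F' G'} (hF : F = F') (hG : G = G') (h : HEq α β) (a : A.Ob) :
    VerTot.mk (α.nat.app a) = VerTot.mk (β.nat.app a) := by
  subst hF hG; cases h; rfl

theorem cell_of_heq {A B : VDC.{w}} {F G F' G' : VDFunctor A B} {α : VDTrans F G}
    {β : VDTrans F' G'} (hF : F = F') (hG : G = G') (h : HEq α β) {a b : A.Ob} (Γ : A.Hor a b) :
    CellTot.mk (α.cell Γ) = CellTot.mk (β.cell Γ) := by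
  subst hF hG; cases h; rfl

/-- The sequences of cells of two transformations on a path agree if the cells do. -/
theorem seqTot_transSeq {W A Q : VDC.{w}} {H K : VDFunctor W Q} {T : VDFunctor Q A}
    (α : VDTrans (H.comp T) (K.comp T)) (nat : H.toFunctor ⟶ K.toFunctor)
    (cell : ∀ {a b : W.Ob} (Γ : W.Hor a b),
      Q.Cell (.single (H.hor Γ)) (nat.app a) (nat.app b) (K.hor Γ))
    (hn : ∀ a, T.toFunctor.map (nat.app a) = α.nat.app a)
    (hc : ∀ {a b : W.Ob} (Γ : W.Hor a b), T.cellTot ⟨cell Γ⟩ = ⟨α.cell Γ⟩)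
    {a b : W.Ob} (p : HPath W.Hor a b) :
    SeqTot.mk (T.seq (transSeq nat cell p)) = SeqTot.mk (transSeq α.nat α.cell p) := by
  induction p with
  | nil a => exact seqTot_nil (congrArg VerTot.mk (hn a))
  | cons Γ p ih => exact seqTot_cons _ _ _ _ _ _ (hc Γ) ih

/-- The images of both sides of the naturality condition at a multicell agree if the images of the
cells of `nat` and `cell` are the cells of a transformation. -/
theorem map_naturality {W A Q : VDC.{w}} {H K : VDFunctor W Q} {T : VDFunctor Q A}
    (α : VDTrans (H.comp T) (K.comp T)) (nat : H.toFunctor ⟶ K.toFunctor)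
    (cell : ∀ {a b : W.Ob} (Γ : W.Hor a b),
      Q.Cell (.single (H.hor Γ)) (nat.app a) (nat.app b) (K.hor Γ))
    (hn : ∀ a, T.toFunctor.map (nat.app a) = α.nat.app a)
    (hc : ∀ {a b : W.Ob} (Γ : W.Hor a b), T.cellTot ⟨cell Γ⟩ = ⟨α.cell Γ⟩)
    {a b c d : W.Ob} {p : HPath W.Hor a b} {u : a ⟶ c} {u' : b ⟶ d} {Δ : W.Hor c d}
    (θ : W.Cell p u u' Δ) :
    T.cellTot ⟨Q.comp (VDGraph.CellSeq.single (H.cell θ)) (cell Δ) (nat.naturality u)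
      (nat.naturality u')⟩ = T.cellTot ⟨Q.comp (transSeq nat cell p) (K.cell θ) rfl rfl⟩ := by
  refine (congrArg CellTot.mk (T.cell_comp' _ _ _ _)).trans
    (Eq.trans ?_ (congrArg CellTot.mk (T.cell_comp' _ _ _ _)).symm)
  refine Eq.trans ?_ ((congrArg CellTot.mk (α.naturality θ)).trans ?_)
  · refine A.tot_comp _ _ _ _ _ _ _ _ ?_ (hc Δ)
    exact seqTot_cons _ _ _ _ _ _ (VDGraphHom.tot_comp _ _ θ).symm
      (seqTot_nil (congrArg VerTot.mk rfl))
  · exact A.tot_comp _ _ _ _ _ _ _ _ (seqTot_transSeq α nat cell hn hc p).symm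
      (VDGraphHom.tot_comp _ _ θ)

end VDTrans

namespace IsLevelwisePullback
open VDGraph VDFunctor

variable {Q A B C W : VDC.{w}} {T : VDFunctor Q A} {S : VDFunctor Q B}
    {f : VDFunctor A C} {g : VDFunctor B C}

theorem comp_congr {D : VDC.{w}} {F : VDFunctor A B} {F' : VDFunctor A C} {G : VDFunctor B D}
    {G' : VDFunctor C D} (h : F.comp G = F'.comp G') (H : VDFunctor W A) :
    (H.comp F).comp G = (H.comp F').comp G' :=
  (Category.assoc (obj := VDC.{w}) H F G).trans ((congrArg (VDFunctor.comp H) h).trans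
    (Category.assoc (obj := VDC.{w}) H F' G').symm)

/-- A transformation has vertical morphisms and multicells of `Q` as components, so the components
are lifted one at a time; naturality is an equation between parallel data and can be tested after
each projection. -/
theorem existsUnique_trans (hQ : IsLevelwisePullback T S f g) {H K : VDFunctor W Q}
    (α : VDTrans (H.comp T) (K.comp T)) (β : VDTrans (H.comp S) (K.comp S))
    (h : HEq (α.whiskerRight f) (β.whiskerRight g)) :
    ∃! σ : VDTrans H K, σ.whiskerRight T = α ∧ σ.whiskerRight S = β := by
  have hH : (H.comp T).comp f = (H.comp S).comp g := comp_congr hQ.comm H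
  have hK : (K.comp T).comp f = (K.comp S).comp g := comp_congr hQ.comm K
  have ha := VDTrans.app_of_heq hH hK h
  have hc := fun (a b : W.Ob) (Γ : W.Hor a b) => VDTrans.cell_of_heq hH hK h Γ
  choose app happ using fun a => (hQ.ver (α.nat.app a) (β.nat.app a) (ha a)).exists
  let nat : H.toFunctor ⟶ K.toFunctor :=
    { app := app
      naturality := fun a b u => by
        refine hQ.ver_ext (congrArg VerTot.mk ?_) (congrArg VerTot.mk ?_)
        · rw [Functor.map_comp, Functor.map_comp, (happ a).1, (happ b).1]
          exact α.nat.naturality u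
        · rw [Functor.map_comp, Functor.map_comp, (happ a).2, (happ b).2]
          exact β.nat.naturality u }
  have hc' := fun (a b : W.Ob) (Γ : W.Hor a b) =>
    hQ.exists_cell (p := .single (H.hor Γ)) (u := app a) (u' := app b) (Δ := K.hor Γ)
      ⟨α.cell Γ⟩ ⟨β.cell Γ⟩ (hc a b Γ)
      (Bd.ext_tot rfl (congrArg VerTot.mk (happ a).1).symm (congrArg VerTot.mk (happ b).1).symm rfl)
      (Bd.ext_tot rfl (congrArg VerTot.mk (happ a).2).symm (congrArg VerTot.mk (happ b).2).symm rfl)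
  choose cell hcell using hc'
  refine ⟨⟨nat, fun Γ => cell _ _ Γ, fun {_ _ _ _ p u u' Δ} θ => hQ.cell_ext ?_ ?_⟩,
    ⟨?_, ?_⟩, ?_⟩
  · exact VDTrans.map_naturality α nat (fun Γ => cell _ _ Γ) (fun a => (happ a).1)
      (fun Γ => (hcell _ _ Γ).1) θ
  · exact VDTrans.map_naturality β nat (fun Γ => cell _ _ Γ) (fun a => (happ a).2)
      (fun Γ => (hcell _ _ Γ).2) θ
  · exact VDTrans.ext_tot (fun a => congrArg VerTot.mk (happ a).1) fun Γ => (hcell _ _ Γ).1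
  · exact VDTrans.ext_tot (fun a => congrArg VerTot.mk (happ a).2) fun Γ => (hcell _ _ Γ).2
  · rintro σ ⟨rfl, rfl⟩
    have hn : ∀ a, σ.nat.app a = app a := fun a =>
      hQ.ver_ext (congrArg VerTot.mk (happ a).1).symm (congrArg VerTot.mk (happ a).2).symm
    refine VDTrans.ext_tot (fun a => congrArg VerTot.mk (hn a)) fun {a b} Γ => ?_
    -- The chosen cell has edges `app`; it is moved to the edges of `σ`, which equal them by `hn`,
    -- before the two are compared.
    obtain ⟨χ, hχ⟩ := CellTot.exists_cell ⟨cell _ _ Γ⟩ (p := .single (H.hor Γ))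
      (u := σ.nat.app a) (u' := σ.nat.app b) (Δ := K.hor Γ)
      (Bd.ext_tot rfl (congrArg VerTot.mk (hn a)).symm (congrArg VerTot.mk (hn b)).symm rfl)
    refine Eq.trans (congrArg CellTot.mk (hQ.cell_ext ?_ ?_)) hχ
    · exact (hcell _ _ Γ).1.symm.trans (congrArg T.cellTot hχ.symm)
    · exact (hcell _ _ Γ).2.symm.trans (congrArg S.cellTot hχ.symm)

theorem is2Pullback {Q A B C : VDC.{w}} {T : Q ⟶ A} {S : Q ⟶ B} {f : A ⟶ C} {g : B ⟶ C}
    (hQ : IsLevelwisePullback T S f g) : Is2Pullback T S f g where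
  isPullback :=
    { w := hQ.comm
      isLimit' := ⟨Limits.PullbackCone.IsLimit.mk hQ.comm
        (fun s => (hQ.exists_lift s.fst s.snd s.condition).choose)
        (fun s => (hQ.exists_lift s.fst s.snd s.condition).choose_spec.1)
        (fun s => (hQ.exists_lift s.fst s.snd s.condition).choose_spec.2)
        (fun s _ h h' => hQ.functor_ext
          (h.trans (hQ.exists_lift s.fst s.snd s.condition).choose_spec.1.symm)
          (h'.trans (hQ.exists_lift s.fst s.snd s.condition).choose_spec.2.symm))⟩ }
  existsUnique_trans _ _ α β h := hQ.existsUnique_trans α β h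

end IsLevelwisePullback

/-! ### Reindexing families along bijections of index sets. -/

namespace IndexGraph
open VDGraph

section Totals

variable {J : IndexGraph.{i, k}} {A : VDC.{w}}

theorem tot_comp_eqToHom {a b c : A.Ob} (f : a ⟶ b) (h : b = c) :
    VerTot.mk (f ≫ eqToHom h) = VerTot.mk f := by
  subst h; rw [eqToHom_refl, Category.comp_id]

/-- A tuple over a path together with its ends. -/
structure TupAt {X Y : J.FOb A} (p : HPath FHor X Y) : Type (max i k w) where
  {i : J.El X.z}
  {j : J.El Y.z}
  t : Tup p i j

/-- An element of an edge together with its ends. -/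
structure HElAt {z z' : J.Ob} (Ψ : J.Hor z z') : Type (max i k) where
  {i : J.El z}
  {j : J.El z'}
  s : J.HEl Ψ i j

theorem tupAt_nil {X : J.FOb A} {i j : J.El X.z} (h : i = j) :
    TupAt.mk (Tup.nil i) = TupAt.mk (Tup.nil (X := X) j) := by
  subst h; rfl

theorem tupAt_cons {X Y Z : J.FOb A} {S : FHor X Y} {p : HPath FHor Y Z}
    {i i' : J.El X.z} {j j' : J.El Y.z} {l l' : J.El Z.z} {s : J.HEl S.Ψ i j} {t : Tup p j l}
    {s' : J.HEl S.Ψ i' j'} {t' : Tup p j' l'} (h : HElAt.mk s = HElAt.mk s')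
    (h' : TupAt.mk t = TupAt.mk t') : TupAt.mk (Tup.cons s t) = TupAt.mk (Tup.cons s' t') := by
  cases h; cases h'; rfl

theorem val_eq_of_tupAt {X Y X' Y' : J.FOb A} {p : HPath FHor X Y} {f : X ⟶ X'} {f' : Y ⟶ Y'}
    {S : FHor X' Y'} (θ : FCell p f f' S) {i i' : J.El X.z} {j j' : J.El Y.z} {t : Tup p i j}
    {t' : Tup p i' j'} (h : TupAt.mk t = TupAt.mk t') : θ.val t = θ.val t' := by
  cases h; rfl

/-- The element of a value. -/
def Val.elAt {X' Y' : J.FOb A} {S : FHor X' Y'} (v : Val S) : HElAt S.Ψ := ⟨v.s⟩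

/-- The multicell of a value. -/
def Val.tot {X' Y' : J.FOb A} {S : FHor X' Y'} (v : Val S) : A.CellTot := ⟨v.θ⟩

theorem val_comp_congr {X' Y' : J.FOb A} {S : FHor X' Y'} {i j : J.El X'.z} {i' j' : J.El Y'.z}
    {s : J.HEl S.Ψ i i'} {s₁ : J.HEl S.Ψ j j'} {a b c d a₁ b₁ c₁ d₁ : A.Ob}
    {p : HPath A.Hor a b} {v : a ⟶ c} {v' : b ⟶ d} {q : HPath A.Hor c d} {v₁ : a₁ ⟶ c₁}
    {v₁' : b₁ ⟶ d₁} {p₁ : HPath A.Hor a₁ b₁} {q₁ : HPath A.Hor c₁ d₁}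
    {u : c ⟶ X'.a i} {u' : d ⟶ Y'.a i'} {θ : A.Cell q u u' (S.Γ s)}
    {u₁ : c₁ ⟶ X'.a j} {u₁' : d₁ ⟶ Y'.a j'} {θ₁ : A.Cell q₁ u₁ u₁' (S.Γ s₁)}
    {Θ : A.CellSeq p v v' q} {Θ₁ : A.CellSeq p₁ v₁ v₁' q₁}
    (h : Val.mk s θ = Val.mk s₁ θ₁) (h' : SeqTot.mk Θ = SeqTot.mk Θ₁) :
    Val.mk s (A.comp Θ θ rfl rfl) = Val.mk s₁ (A.comp Θ₁ θ₁ rfl rfl) := by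
  cases h; cases h'; rfl

end Totals

/-- A map of graphs of index sets that is bijective on elements. -/
structure Reindex (J : IndexGraph.{w, k}) (J' : IndexGraph.{i, w'}) where
  /-- The map on vertices. -/
  ob : J.Ob → J'.Ob
  /-- The map on edges. -/
  hor : {z z' : J.Ob} → J.Hor z z' → J'.Hor (ob z) (ob z')
  /-- The bijection between the elements of vertices. -/
  el : (z : J.Ob) → J'.El (ob z) ≃ J.El z
  /-- The bijection between the elements of edges. -/
  hel : {z z' : J.Ob} → (Ψ : J.Hor z z') → {i : J'.El (ob z)} → {j : J'.El (ob z')} →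
    J'.HEl (hor Ψ) i j ≃ J.HEl Ψ (el z i) (el z' j)

namespace Reindex

variable {J : IndexGraph.{max (u + 1) w, max (u + 1) w}} {J' : IndexGraph.{u, u + 1}}
  {A : VDC.{max (u + 1) w}} (R : Reindex J J')

/-- The reindexed family of objects. -/
def rOb (X : J.FOb A) : J'.FOb A := ⟨R.ob X.z, fun i => X.a (R.el X.z i)⟩

/-- The reindexed family of horizontal morphisms. -/
def rHor {X Y : J.FOb A} (S : FHor X Y) : FHor (R.rOb X) (R.rOb Y) :=
  ⟨R.hor S.Ψ, fun s => S.Γ (R.hel S.Ψ s)⟩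

/-- The reindexed family of vertical morphisms. -/
def rVer {X Y : J.FOb A} (f : X ⟶ Y) : R.rOb X ⟶ R.rOb Y :=
  FVer.mk (fun i => (R.el Y.z).symm (f.fn (R.el X.z i)))
    (fun i => f.mor (R.el X.z i) ≫
      eqToHom (congrArg Y.a ((R.el Y.z).apply_symm_apply (f.fn (R.el X.z i))).symm))

theorem el_fn {X Y : J.FOb A} (f : X ⟶ Y) (i : J'.El (R.rOb X).z) :
    R.el Y.z ((R.rVer f).fn i) = f.fn (R.el X.z i) :=
  (R.el Y.z).apply_symm_apply _

/-- The inverse bijection in `rVer` undoes `R.el` only propositionally, hence the `eqToHom` there;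
it disappears after bundling. -/
theorem tot_mor {X Y : J.FOb A} (f : X ⟶ Y) (i : J'.El (R.rOb X).z) :
    VerTot.mk ((R.rVer f).mor i) = VerTot.mk (f.mor (R.el X.z i)) :=
  tot_comp_eqToHom _ _

theorem ver_ext {X : J'.FOb A} {Y : J.FOb A} {f g : X ⟶ R.rOb Y}
    (hfn : ∀ i, R.el Y.z (f.fn i) = R.el Y.z (g.fn i))
    (h : ∀ i, VerTot.mk (f.mor i) = VerTot.mk (g.mor i)) : f = g := by
  obtain ⟨fn, mor⟩ := f
  obtain ⟨fn', mor'⟩ := g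
  obtain rfl : fn = fn' := funext fun i => (R.el Y.z).injective (hfn i)
  exact congrArg (FVer.mk fn) (funext fun i => eq_of_verTot (h i))

/-- Reindexing of families of objects and of vertical morphisms. -/
def functor (A : VDC.{max (u + 1) w}) : J.FOb A ⥤ J'.FOb A where
  obj := R.rOb
  map f := R.rVer f
  map_id X := R.ver_ext (fun i => R.el_fn (𝟙 X) i) (fun i => R.tot_mor (𝟙 X) i)
  map_comp {X Y Z} f g := R.ver_ext
    (fun i => (R.el_fn (f ≫ g) i).trans
      (((R.el_fn g _).trans (congrArg g.fn (R.el_fn f i))).symm))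
    (fun i => (R.tot_mor (f ≫ g) i).trans <| by
      refine verTot_comp (R.tot_mor f i).symm (Eq.trans ?_ (R.tot_mor g _).symm)
      rw [R.el_fn f i])

/-- The tuple of the original families that corresponds to a tuple of the reindexed families. -/
def untup : {X Y : J.FOb A} → (p : HPath FHor X Y) → {i : J'.El (R.rOb X).z} →
    {j : J'.El (R.rOb Y).z} → Tup (p.map R.rOb R.rHor) i j → Tup p (R.el X.z i) (R.el Y.z j)
  | X, _, .nil _, i, _, t => Tup.nil_eq (X := R.rOb X) t ▸ .nil (X := X) (R.el X.z i)
  | _, _, .cons S p, _, _, t =>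
    .cons (S := S) (R.hel S.Ψ (Tup.uncons (S := R.rHor S) t).s)
      (untup p (Tup.uncons (S := R.rHor S) t).t)

/-- An unbundled equality is possible here because the members of the reindexed families are by
definition the original members at the images of the indices. -/
theorem untup_path {X Y : J.FOb A} (p : HPath FHor X Y) {i : J'.El (R.rOb X).z}
    {j : J'.El (R.rOb Y).z} (t : Tup (p.map R.rOb R.rHor) i j) :
    (R.untup p t).path = t.path := by
  induction p with
  | nil X =>
    obtain rfl := Tup.nil_eq (X := R.rOb X) t
    obtain rfl := Tup.eq_nil (X := R.rOb X) t
    rfl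
  | cons S p ih =>
    obtain ⟨j, s, t, rfl⟩ := Tup.exists_cons (S := R.rHor S) t
    exact congrArg (HPath.cons (S.Γ (R.hel S.Ψ s))) (ih t)

/-- `act` splits a tuple along a concatenation of top paths, so `untup` must be compatible with
splitting. Reindexing preserves concatenation of paths only propositionally, which accounts for the
`HEq`. -/
theorem untup_append {X Y Z : J.FOb A} (p₁ : HPath FHor X Y) (p₂ : HPath FHor Y Z)
    {i : J'.El (R.rOb X).z} {l : J'.El (R.rOb Z).z}
    (t : Tup ((p₁.append p₂).map R.rOb R.rHor) i l) :
    ∃ (j : J'.El (R.rOb Y).z) (t₁ : Tup (p₁.map R.rOb R.rHor) i j)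
      (t₂ : Tup (p₂.map R.rOb R.rHor) j l), HEq (t₁.append t₂) t ∧
      R.untup (p₁.append p₂) t = (R.untup p₁ t₁).append (R.untup p₂ t₂) := by
  induction p₁ with
  | nil X => exact ⟨i, .nil (X := R.rOb X) i, t, HEq.rfl, rfl⟩
  | cons S p ih =>
    obtain ⟨j, s, t, rfl⟩ := Tup.exists_cons (S := R.rHor S) t
    obtain ⟨j, t₁, t₂, h₁, h₂⟩ := ih p₂ t
    refine ⟨j, .cons (S := R.rHor S) s t₁, t₂,
      cons_heq (HPath.map_append _ _ p p₂) s h₁, ?_⟩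
    exact congrArg (Tup.cons (S := S) (R.hel S.Ψ s)) h₂

theorem exists_untup {X Y : J.FOb A} (p : HPath FHor X Y) {i : J'.El (R.rOb X).z}
    {j : J'.El (R.rOb Y).z} (t : Tup p (R.el X.z i) (R.el Y.z j)) :
    ∃ t', R.untup p (i := i) (j := j) t' = t := by
  induction p with
  | nil X =>
    obtain rfl : i = j := (R.el X.z).injective (Tup.nil_eq t)
    exact ⟨.nil (X := R.rOb X) i, (Tup.eq_nil t).symm⟩
  | @cons X Y Z S p ih =>
    obtain ⟨l, s, t, rfl⟩ := Tup.exists_cons t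
    obtain ⟨l, rfl⟩ := (R.el Y.z).surjective l
    obtain ⟨s, rfl⟩ := (R.hel S.Ψ).surjective s
    obtain ⟨t, rfl⟩ := ih t
    exact ⟨.cons (S := R.rHor S) s t, rfl⟩

/-- The value of the original families that corresponds to a value of the reindexed families. -/
def unVal {X Y : J.FOb A} {S : FHor X Y} (v : Val (R.rHor S)) : Val S :=
  ⟨R.hel S.Ψ v.s, v.θ⟩

/-- Injectivity of `R.el` recovers the ends of the index, and then injectivity of `R.hel` recovers
the index itself. The components are kept as variables so that each can be substituted in turn. -/
theorem unVal_inj {X Y : J.FOb A} {S : FHor X Y} {i i' : J'.El (R.rOb X).z}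
    {j j' : J'.El (R.rOb Y).z} {s : J'.HEl (R.hor S.Ψ) i j} {s' : J'.HEl (R.hor S.Ψ) i' j'}
    {a b a' b' : A.Ob} {p : HPath A.Hor a b} {u : a ⟶ X.a (R.el X.z i)}
    {u' : b ⟶ Y.a (R.el Y.z j)} {θ : A.Cell p u u' (S.Γ (R.hel S.Ψ s))}
    {p' : HPath A.Hor a' b'} {v : a' ⟶ X.a (R.el X.z i')}
    {v' : b' ⟶ Y.a (R.el Y.z j')} {θ' : A.Cell p' v v' (S.Γ (R.hel S.Ψ s'))}
    (h : Val.mk (S := S) (R.hel S.Ψ s) θ = Val.mk (R.hel S.Ψ s') θ') :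
    Val.mk (S := R.rHor S) s θ = Val.mk s' θ' := by
  obtain rfl : i = i' := (R.el X.z).injective (congrArg Val.i h)
  obtain rfl : j = j' := (R.el Y.z).injective (congrArg Val.j h)
  obtain rfl : s = s' := by
    refine (R.hel S.Ψ).injective ?_
    have := congrArg Val.elAt h
    simpa [Val.elAt] using this
  exact val_congr (S := R.rHor S) s (congrArg Val.tot h)

theorem eq_of_unVal {X Y : J.FOb A} {S : FHor X Y} {v v' : Val (R.rHor S)}
    (h : R.unVal v = R.unVal v') : v = v' := R.unVal_inj h

/-- With all boundary data as free variables the transport is mere substitution, and surjectivity of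
`R.hel` provides the index. -/
theorem exists_val {X Y : J.FOb A} {S : FHor X Y} {i : J.El X.z} {j : J.El Y.z}
    {s : J.HEl S.Ψ i j} {a b : A.Ob} {p p' : HPath A.Hor a b} {u : a ⟶ X.a i} {u' : b ⟶ Y.a j}
    (θ : A.Cell p u u' (S.Γ s)) {i' : J'.El (R.rOb X).z} {j' : J'.El (R.rOb Y).z}
    (hi : R.el X.z i' = i) (hj : R.el Y.z j' = j) {v : a ⟶ X.a (R.el X.z i')}
    {v' : b ⟶ Y.a (R.el Y.z j')} (hp : p = p') (hv : VerTot.mk v = VerTot.mk u)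
    (hv' : VerTot.mk v' = VerTot.mk u') :
    ∃ (s' : J'.HEl (R.hor S.Ψ) i' j') (θ' : A.Cell p' v v' (S.Γ (R.hel S.Ψ s'))),
      Val.mk (S := S) (R.hel S.Ψ s') θ' = Val.mk s θ := by
  subst hi hj hp
  obtain rfl := eq_of_verTot hv
  obtain rfl := eq_of_verTot hv'
  obtain ⟨s, rfl⟩ := (R.hel S.Ψ).surjective s
  exact ⟨s, θ, rfl⟩

/-- The member of `θ` at the original tuple has the right edges only up to `el_fn` and `tot_mor`.
Hence a member of the reindexed family is specified by its value and chosen, instead of being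
written with casts. -/
theorem exists_cell {X Y X' Y' : J.FOb A} {p : HPath FHor X Y} {f : X ⟶ X'} {f' : Y ⟶ Y'}
    {S : FHor X' Y'} (θ : FCell p f f' S) {i : J'.El (R.rOb X).z} {j : J'.El (R.rOb Y).z}
    (t : Tup (p.map R.rOb R.rHor) i j) :
    ∃ (s : J'.HEl (R.hor S.Ψ) ((R.rVer f).fn i) ((R.rVer f').fn j))
      (χ : A.Cell t.path ((R.rVer f).mor i) ((R.rVer f').mor j) (S.Γ (R.hel S.Ψ s))),
      Val.mk (S := S) (R.hel S.Ψ s) χ = θ.val (R.untup p t) :=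
  R.exists_val (θ.cell (R.untup p t)) (R.el_fn f i) (R.el_fn f' j) (R.untup_path p t)
    (R.tot_mor f i) (R.tot_mor f' j)

/-- The reindexed family of multicells. -/
noncomputable def rCell {X Y X' Y' : J.FOb A} {p : HPath FHor X Y} {f : X ⟶ X'} {f' : Y ⟶ Y'}
    {S : FHor X' Y'} (θ : FCell p f f' S) :
    FCell (p.map R.rOb R.rHor) (R.rVer f) (R.rVer f') (R.rHor S) where
  fn t := (R.exists_cell θ t).choose
  cell t := (R.exists_cell θ t).choose_spec.choose

theorem unVal_rCell {X Y X' Y' : J.FOb A} {p : HPath FHor X Y} {f : X ⟶ X'} {f' : Y ⟶ Y'}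
    {S : FHor X' Y'} (θ : FCell p f f' S) {i : J'.El (R.rOb X).z} {j : J'.El (R.rOb Y).z}
    (t : Tup (p.map R.rOb R.rHor) i j) :
    R.unVal ((R.rCell θ).val t) = θ.val (R.untup p t) :=
  (R.exists_cell θ t).choose_spec.choose_spec

theorem tot_rCell {X Y X' Y' : J.FOb A} {p : HPath FHor X Y} {f : X ⟶ X'} {f' : Y ⟶ Y'}
    {S : FHor X' Y'} (θ : FCell p f f' S) {i : J'.El (R.rOb X).z} {j : J'.El (R.rOb Y).z}
    (t : Tup (p.map R.rOb R.rHor) i j) :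
    CellTot.mk ((R.rCell θ).cell t) = CellTot.mk (θ.cell (R.untup p t)) :=
  congrArg Val.tot (R.unVal_rCell θ t)

/-- Reindexing as a map of graphs. -/
noncomputable def graph (A : VDC.{max (u + 1) w}) :
    VDGraphHom (J.fam A).toVDGraph (J'.fam A).toVDGraph where
  toFunctor := R.functor A
  hor := R.rHor
  cell := R.rCell

/-- The heart of functoriality: a composite of families acts by splitting the tuple and applying
each factor, and both operations commute with `untup`. The two conclusions are the effect on indices
and on members. -/
theorem act_graph {X Y X' Y' : (J.famGraph A).Ob} {p : HPath FHor X Y} {f : X ⟶ X'}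
    {f' : Y ⟶ Y'} {q : HPath FHor X' Y'} (Θ : (J.famGraph A).CellSeq p f f' q)
    {i : J'.El (R.rOb X).z} {j : J'.El (R.rOb Y).z} (t : Tup (p.map R.rOb R.rHor) i j) :
    TupAt.mk (R.untup q (act ((R.graph A).seq Θ) t).res) =
      TupAt.mk (act Θ (R.untup p t)).res ∧
    SeqTot.mk (act ((R.graph A).seq Θ) t).cells =
      SeqTot.mk (act Θ (R.untup p t)).cells := by
  induction Θ with
  | nil f =>
    rename_i X _
    obtain rfl := Tup.nil_eq (X := R.rOb X) t
    obtain rfl := Tup.eq_nil (X := R.rOb X) t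
    exact ⟨tupAt_nil (R.el_fn f i), seqTot_nil (R.tot_mor f i)⟩
  | cons θ Θ hp ih =>
    rename_i p₁ _ _ _ p₂ _ _ _
    subst hp
    obtain ⟨l, t₁, t₂, h₁, h₂⟩ := R.untup_append p₁ p₂ t
    have hp := HPath.map_append R.rOb R.rHor p₁ p₂
    have e₁ := split_eq hp t t₁ t₂ h₁
    have e₂ := split_path _ hp t
    rw [e₁] at e₂
    have a₁ := act_cons (R.rCell θ) ((R.graph A).seq Θ) hp t t₁ t₂ e₁ e₂
    have a₂ := act_cons θ Θ rfl ((R.untup p₁ t₁).append (R.untup p₂ t₂)) _ _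
      (split_append _ _) (Tup.path_append _ _)
    obtain ⟨k₁, k₂⟩ := ih t₂
    rw [h₂, a₂]
    constructor
    · refine (congrArg (fun r => TupAt.mk (R.untup (.cons _ _) (Act.res r))) a₁).trans ?_
      exact tupAt_cons (congrArg Val.elAt (R.unVal_rCell θ t₁)) k₁
    · refine (congrArg (fun r => SeqTot.mk r.cells) a₁).trans ?_
      exact seqTot_cons _ _ _ _ _ _ (R.tot_rCell θ t₁) k₂

/-- Reindexing as a virtual double functor. -/
noncomputable def vdFunctor (A : VDC.{max (u + 1) w}) : VDFunctor (J.fam A) (J'.fam A) where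
  toVDGraphHom := R.graph A
  cell_hid {X Y} S := FCell.ext_val (fun t => R.eq_of_unVal (by
    obtain ⟨j, s, t, rfl⟩ := Tup.exists_cons (S := R.rHor S) t
    obtain rfl := Tup.nil_eq (X := R.rOb Y) t
    obtain rfl := Tup.eq_nil (X := R.rOb Y) t
    refine (R.unVal_rCell _ _).trans (Eq.trans ?_
      (congrArg R.unVal (val_famId (R.rHor S) _ _ s).symm))
    -- On a tuple of length one `untup` computes to the single index `R.hel S.Ψ s`.
    exact val_famId S rfl rfl (R.hel S.Ψ s)))
  cell_comp Θ κ := FCell.ext_val (fun t => R.eq_of_unVal (by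
    refine (R.unVal_rCell _ _).trans (Eq.trans ?_
      (congrArg R.unVal (val_famComp _ _ _ _ t).symm))
    refine (val_famComp (J := J) Θ κ rfl rfl (R.untup _ t)).trans ?_
    obtain ⟨h₁, h₂⟩ := R.act_graph Θ t
    refine (val_comp_congr (Eq.trans ?_ (val_eq_of_tupAt κ h₁)) h₂).symm
    exact R.unVal_rCell κ _))

end Reindex

end IndexGraph

/-! ### Reindexing is bijective on data with fixed boundary. -/

namespace IndexGraph
open VDGraph

section

variable {J : IndexGraph.{i, k}} {A B C : VDC.{w}}

theorem tot_eqToHom_comp {a b c : A.Ob} (h : a = b) (f : b ⟶ c) :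
    VerTot.mk (eqToHom h ≫ f) = VerTot.mk f := by
  subst h; rw [eqToHom_refl, Category.id_comp]

theorem exists_val_of_eq {X Y : J.FOb A} {S : FHor X Y} {i : J.El X.z} {j : J.El Y.z}
    {s : J.HEl S.Ψ i j} {a b a' b' : A.Ob} {p : HPath A.Hor a b} {p' : HPath A.Hor a' b'}
    {u : a ⟶ X.a i} {u' : b ⟶ Y.a j} (θ : A.Cell p u u' (S.Γ s)) {i' : J.El X.z} {j' : J.El Y.z}
    (hi : i' = i) (hj : j' = j) {v : a' ⟶ X.a i'} {v' : b' ⟶ Y.a j'}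
    (hp : VDFunctor.PathTot.mk p = VDFunctor.PathTot.mk p')
    (hv : VerTot.mk v = VerTot.mk u) (hv' : VerTot.mk v' = VerTot.mk u') :
    ∃ (s' : J.HEl S.Ψ i' j') (θ' : A.Cell p' v v' (S.Γ s')), Val.mk s' θ' = Val.mk s θ := by
  subst hi hj
  cases hp
  obtain rfl := eq_of_verTot hv
  obtain rfl := eq_of_verTot hv'
  exact ⟨s, θ, rfl⟩

theorem horTot_ext {z z' : J.Ob} {a a₁ : J.El z → A.Ob} {b b₁ : J.El z' → A.Ob} {Ψ : J.Hor z z'}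
    {Γ : ∀ {i j}, J.HEl Ψ i j → A.Hor (a i) (b j)} {Γ₁ : ∀ {i j}, J.HEl Ψ i j → A.Hor (a₁ i) (b₁ j)}
    (ha : a = a₁) (hb : b = b₁)
    (h : ∀ {i j} (s : J.HEl Ψ i j), HorTot.mk (Γ s) = HorTot.mk (Γ₁ s)) :
    HorTot.mk (A := J.famGraph A) (a := ⟨z, a⟩) (b := ⟨z', b⟩) ⟨Ψ, Γ⟩ =
      HorTot.mk (A := J.famGraph A) (a := ⟨z, a₁⟩) (b := ⟨z', b₁⟩) ⟨Ψ, Γ₁⟩ := by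
  subst ha hb
  obtain rfl : @Γ = @Γ₁ := by
    funext i j s
    exact eq_of_horTot (h s)
  rfl

theorem edge_eq_of_horTot {z z' : J.Ob} {a a₁ : J.El z → A.Ob} {b b₁ : J.El z' → A.Ob}
    {S : FHor (A := A) ⟨z, a⟩ ⟨z', b⟩} {S₁ : FHor (A := A) ⟨z, a₁⟩ ⟨z', b₁⟩}
    (h : HorTot.mk (A := J.famGraph A) S = HorTot.mk (A := J.famGraph A) S₁) : S.Ψ = S₁.Ψ := by
  cases h; rfl

theorem horTot_eq_of_horTot {z z' : J.Ob} {a a₁ : J.El z → A.Ob} {b b₁ : J.El z' → A.Ob}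
    {S : FHor (A := A) ⟨z, a⟩ ⟨z', b⟩} {S₁ : FHor (A := A) ⟨z, a₁⟩ ⟨z', b₁⟩}
    (h : HorTot.mk (A := J.famGraph A) S = HorTot.mk (A := J.famGraph A) S₁) {i : J.El z}
    {j : J.El z'} {s : J.HEl S.Ψ i j} {s₁ : J.HEl S₁.Ψ i j} (hs : HEq s s₁) :
    HorTot.mk (S.Γ s) = HorTot.mk (S₁.Γ s₁) := by
  cases h; cases hs; rfl

theorem FHor.ext_heq {X Y : J.FOb A} {S S' : FHor X Y} (hΨ : S.Ψ = S'.Ψ)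
    (h : ∀ {i j} (s : J.HEl S.Ψ i j) (s' : J.HEl S'.Ψ i j), HEq s s' → S.Γ s = S'.Γ s') :
    S = S' := by
  obtain ⟨Ψ, Γ⟩ := S
  obtain ⟨Ψ', Γ'⟩ := S'
  dsimp only at hΨ
  subst hΨ
  obtain rfl : @Γ = @Γ' := by
    funext i j s
    exact h s s HEq.rfl
  rfl

/-- All members of a family of vertical morphisms are mapped to `v`. -/
def VOver (G : VDFunctor A B) (f : (J.famGraph A).VerTot) (v : B.VerTot) : Prop :=
  ∀ i : J.El f.a.z, G.verTot ⟨f.f.mor i⟩ = v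

/-- All members of a family of multicells are mapped to `ν`. -/
def TOver (G : VDFunctor A B) (θ : (J.famGraph A).CellTot) (ν : B.CellTot) : Prop :=
  COver G θ.θ ν

/-- The tuple of the images that corresponds to a tuple. -/
def mapTup (F : VDFunctor A B) : {X Y : J.FOb A} → {p : HPath FHor X Y} → {i : J.El X.z} →
    {j : J.El Y.z} → Tup p i j → Tup (X := mapOb F X) (Y := mapOb F Y)
      (p.map (mapOb F) (mapHor F)) i j
  | _, _, _, _, _, .nil (X := X) i => .nil (X := mapOb F X) i
  | _, _, _, _, _, .cons (S := S) s t => .cons (S := mapHor F S) s (mapTup F t)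

theorem unmapTup_mapTup (F : VDFunctor A B) {X Y : J.FOb A} {p : HPath FHor X Y} {i : J.El X.z}
    {j : J.El Y.z} (t : Tup p i j) : unmapTup F p (mapTup F t) = t := by
  induction t with
  | nil i => rfl
  | cons s t ih => exact congrArg (Tup.cons s) ih

/-- The members of `mapCell F θ` are the images of the members of `θ` at `unmapTup t`. Every tuple
of `p` has this form by `unmapTup_mapTup`, so the two conditions concern the same multicells. -/
theorem cOver_mapCell (F : VDFunctor A B) (G : VDFunctor B C) {X Y X' Y' : J.FOb A}
    {p : HPath FHor X Y} {f : X ⟶ X'} {f' : Y ⟶ Y'} {S : FHor X' Y'} (θ : FCell p f f' S)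
    (ν : C.CellTot) : COver G (mapCell F θ) ν ↔ COver (F.comp G) θ ν := by
  have key : ∀ {i : J.El X.z} {j : J.El Y.z} (t : Tup (p.map (mapOb F) (mapHor F)) i j),
      G.cellTot ⟨(mapCell F θ).cell t⟩ = (F.comp G).cellTot ⟨θ.cell (unmapTup F p t)⟩ :=
    fun t => (congrArg G.cellTot (tot_castTop _ _)).trans (VDFunctor.cellTot_comp F G _).symm
  constructor
  · intro h i j t
    refine Eq.trans ?_ (h (mapTup F t))
    rw [key, unmapTup_mapTup]
  · intro h i j t
    exact (key t).trans (h _)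

end

namespace Reindex

variable {J : IndexGraph.{max (u + 1) w, max (u + 1) w}} {J' : IndexGraph.{u, u + 1}}
  {A : VDC.{max (u + 1) w}} (R : Reindex J J')

/-- The preimage is `α` conjugated by the bijections on elements. -/
theorem exists_rVer {X Y : J.FOb A} (α : R.rOb X ⟶ R.rOb Y) : ∃ f : X ⟶ Y, R.rVer f = α := by
  refine ⟨FVer.mk (fun x => R.el Y.z (α.fn ((R.el X.z).symm x)))
    (fun x => eqToHom (congrArg X.a ((R.el X.z).apply_symm_apply x).symm) ≫
      α.mor ((R.el X.z).symm x)), R.ver_ext (fun i => ?_) (fun i => ?_)⟩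
  · refine (R.el_fn _ i).trans ?_
    exact congrArg (fun i => R.el Y.z (α.fn i)) ((R.el X.z).symm_apply_apply i)
  · refine (R.tot_mor _ i).trans ((tot_eqToHom_comp _ _).trans ?_)
    exact congrArg (fun i => VerTot.mk (α.mor i)) ((R.el X.z).symm_apply_apply i)

theorem rVer_inj {X Y : J.FOb A} {f g : X ⟶ Y} (h : R.rVer f = R.rVer g) : f = g := by
  have h₁ : ∀ x, f.fn x = g.fn x := fun x => by
    obtain ⟨i, rfl⟩ := (R.el X.z).surjective x
    rw [← R.el_fn f i, ← R.el_fn g i, h]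
  have h₂ : ∀ x, VerTot.mk (f.mor x) = VerTot.mk (g.mor x) := fun x => by
    obtain ⟨i, rfl⟩ := (R.el X.z).surjective x
    rw [← R.tot_mor f i, ← R.tot_mor g i, h]
  obtain ⟨fn, mor⟩ := f
  obtain ⟨fn', mor'⟩ := g
  obtain rfl : fn = fn' := funext h₁
  exact congrArg (FVer.mk fn) (funext fun i => eq_of_verTot (h₂ i))

theorem el_injective_hElAt {z z' : J.Ob} {Ψ : J.Hor z z'} {i i₁ : J'.El (R.ob z)}
    {j j₁ : J'.El (R.ob z')} {s : J'.HEl (R.hor Ψ) i j} {s₁ : J'.HEl (R.hor Ψ) i₁ j₁}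
    (h : HElAt.mk (R.hel Ψ s) = HElAt.mk (R.hel Ψ s₁)) : HElAt.mk s = HElAt.mk s₁ := by
  obtain rfl : i = i₁ := (R.el z).injective (congrArg HElAt.i h)
  obtain rfl : j = j₁ := (R.el z').injective (congrArg HElAt.j h)
  obtain rfl : s = s₁ := by
    refine (R.hel Ψ).injective ?_
    simpa using h
  rfl

/-- The inverse of `R.hel` is available only over ends of the form `R.el z i`. The member at `Φ` is
therefore characterised by agreeing with `Γ s` for every `s` over `Φ`; such `s` exists by
surjectivity and is unique, with its ends, by `el_injective_hElAt`. -/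
theorem exists_rHor {X Y : J.FOb A} {Ψ : J.Hor X.z Y.z}
    (Γ : ∀ {i j}, J'.HEl (R.hor Ψ) i j → A.Hor ((R.rOb X).a i) ((R.rOb Y).a j)) :
    ∃ Γ' : ∀ {x x'}, J.HEl Ψ x x' → A.Hor (X.a x) (Y.a x'),
      R.rHor (X := X) (Y := Y) ⟨Ψ, Γ'⟩ = ⟨R.hor Ψ, Γ⟩ := by
  have h : ∀ (x : J.El X.z) (x' : J.El Y.z) (Φ : J.HEl Ψ x x'), ∃ Δ : A.Hor (X.a x) (Y.a x'),
      ∀ {i j} (s : J'.HEl (R.hor Ψ) i j), HElAt.mk (R.hel Ψ s) = HElAt.mk Φ →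
        HorTot.mk Δ = HorTot.mk (Γ s) := by
    intro x x' Φ
    obtain ⟨i, rfl⟩ := (R.el X.z).surjective x
    obtain ⟨j, rfl⟩ := (R.el Y.z).surjective x'
    obtain ⟨s, rfl⟩ := (R.hel Ψ).surjective Φ
    refine ⟨Γ s, fun s₁ h => ?_⟩
    cases R.el_injective_hElAt h
    rfl
  choose Γ' hΓ' using h
  refine ⟨fun Φ => Γ' _ _ Φ, FHor.ext_heq rfl fun s s' h => ?_⟩
  cases h
  exact eq_of_horTot (hΓ' _ _ (R.hel Ψ s) s rfl)

/-- `R.hor` need not be injective, so the edges have to be compared separately. For the dependent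
product this comparison is supplied by the projection to `Y`. -/
theorem rHor_inj {X Y : J.FOb A} {S S' : FHor X Y} (hΨ : S.Ψ = S'.Ψ)
    (h : R.rHor S = R.rHor S') : S = S' := by
  obtain ⟨Ψ, Γ⟩ := S
  obtain ⟨Ψ', Γ'⟩ := S'
  dsimp only at hΨ
  subst hΨ
  refine FHor.ext_heq rfl fun {x x'} Φ Φ' hΦ => ?_
  cases hΦ
  obtain ⟨i, rfl⟩ := (R.el X.z).surjective x
  obtain ⟨j, rfl⟩ := (R.el Y.z).surjective x'
  obtain ⟨s, rfl⟩ := (R.hel Ψ).surjective Φ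
  exact eq_of_horTot (horTot_eq_of_horTot (congrArg HorTot.mk h) (s := s) HEq.rfl)

theorem untup_inj {X Y : J.FOb A} (p : HPath FHor X Y) {i i₁ : J'.El (R.rOb X).z}
    {j j₁ : J'.El (R.rOb Y).z} {t : Tup (p.map R.rOb R.rHor) i j}
    {t₁ : Tup (p.map R.rOb R.rHor) i₁ j₁}
    (h : TupAt.mk (R.untup p t) = TupAt.mk (R.untup p t₁)) : TupAt.mk t = TupAt.mk t₁ := by
  induction p with
  | nil X =>
    obtain rfl := Tup.nil_eq (X := R.rOb X) t
    obtain rfl := Tup.eq_nil (X := R.rOb X) t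
    obtain rfl := Tup.nil_eq (X := R.rOb X) t₁
    obtain rfl := Tup.eq_nil (X := R.rOb X) t₁
    exact tupAt_nil ((R.el X.z).injective (congrArg TupAt.i h))
  | @cons X Y Z S p ih =>
    obtain ⟨l, s, t, rfl⟩ := Tup.exists_cons (S := R.rHor S) t
    obtain ⟨l₁, s₁, t₁, rfl⟩ := Tup.exists_cons (S := R.rHor S) t₁
    have key : ∀ {x x₁ : J.El X.z} {y y₁ : J.El Y.z} {z z₁ : J.El Z.z} {s : J.HEl S.Ψ x y}
        {s₁ : J.HEl S.Ψ x₁ y₁} {t : Tup p y z} {t₁ : Tup p y₁ z₁},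
        TupAt.mk (Tup.cons s t) = TupAt.mk (Tup.cons s₁ t₁) →
        HElAt.mk s = HElAt.mk s₁ ∧ TupAt.mk t = TupAt.mk t₁ := by
      intro x x₁ y y₁ z z₁ s s₁ t t₁ h
      cases h; exact ⟨rfl, rfl⟩
    obtain ⟨h₁, h₂⟩ := key h
    exact tupAt_cons (S := R.rHor S) (R.el_injective_hElAt h₁) (ih h₂)

/-- As for horizontal morphisms, the member at a tuple is specified by its agreement with `α` at all
reindexed tuples above it; `exists_untup` and `untup_inj` make this well defined. -/
theorem exists_rCell {X Y X' Y' : J.FOb A} {p : HPath FHor X Y} {f : X ⟶ X'} {f' : Y ⟶ Y'}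
    {S : FHor X' Y'} (α : FCell (p.map R.rOb R.rHor) (R.rVer f) (R.rVer f') (R.rHor S)) :
    ∃ θ : FCell p f f' S, R.rCell θ = α := by
  have h : ∀ (x : J.El X.z) (x' : J.El Y.z) (t : Tup p x x'),
      ∃ (s : J.HEl S.Ψ (f.fn x) (f'.fn x')) (χ : A.Cell t.path (f.mor x) (f'.mor x') (S.Γ s)),
      ∀ {i j} (t' : Tup (p.map R.rOb R.rHor) i j), TupAt.mk (R.untup p t') = TupAt.mk t →
        R.unVal (α.val t') = Val.mk s χ := by
    intro x x' t
    obtain ⟨i, rfl⟩ := (R.el X.z).surjective x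
    obtain ⟨j, rfl⟩ := (R.el Y.z).surjective x'
    obtain ⟨t, rfl⟩ := R.exists_untup p t
    obtain ⟨s, χ, h⟩ := exists_val_of_eq (S := S) (s := R.hel S.Ψ (α.fn t)) (α.cell t)
      (R.el_fn f i).symm (R.el_fn f' j).symm (congrArg VDFunctor.PathTot.mk (R.untup_path p t).symm)
      (R.tot_mor f i).symm (R.tot_mor f' j).symm
    refine ⟨s, χ, fun t' ht' => Eq.trans ?_ h.symm⟩
    exact congrArg R.unVal (val_eq_of_tupAt α (R.untup_inj p ht'))
  choose fn cell hcell using h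
  refine ⟨⟨fun t => fn _ _ t, fun t => cell _ _ t⟩, FCell.ext_val fun t => R.eq_of_unVal ?_⟩
  exact (R.unVal_rCell _ t).trans (hcell _ _ _ t rfl).symm

theorem rCell_inj {X Y X' Y' : J.FOb A} {p : HPath FHor X Y} {f : X ⟶ X'} {f' : Y ⟶ Y'}
    {S : FHor X' Y'} {θ θ' : FCell p f f' S} (h : R.rCell θ = R.rCell θ') : θ = θ' := by
  refine FCell.ext_val fun {x x'} t => ?_
  obtain ⟨i, rfl⟩ := (R.el X.z).surjective x
  obtain ⟨j, rfl⟩ := (R.el Y.z).surjective x'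
  obtain ⟨t, rfl⟩ := R.exists_untup p t
  rw [← R.unVal_rCell θ t, ← R.unVal_rCell θ' t, h]

end Reindex

end IndexGraph

/-! ### The dependent product square is a levelwise pullback. -/

namespace PiProd
open VDGraph VDFunctor IndexGraph

variable {X Y A : VDC.{w}}

/-- The underlying families of the dependent product, as a virtual double functor. -/
def families (P : VDFunctor X Y) (F : VDFunctor A X) :
    VDFunctor (PiProd (X := X) (Y := Y) (A := A) P F) ((fibIndex P).fam A) where
  toVDGraphHom := toFam P F
  cell_hid _ := rfl
  cell_comp _ _ := rfl

end PiProd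

namespace Bar
open VDGraph VDFunctor IndexGraph

/-- The fibres of `P` and their small copies. -/
noncomputable def reindex {X Y : VDC.{w}} {P : VDFunctor X Y} (hs : HasSmallFibres.{u} P) :
    Reindex (fibIndex P) setIndex.{u} where
  ob := SOb hs
  hor := span hs
  el y := (eOb hs y).symm
  hel Ψ := Equiv.ofBijective (fun s => ⟨(hor hs Ψ).Γ s, map_hor hs Ψ s⟩)
    ⟨fun _ _ h => hor_inj hs (congrArg Subtype.val h), fun Φ => by
      obtain ⟨s, hs⟩ := exists_hor hs Ψ Φ.1 Φ.2
      exact ⟨s, Subtype.ext hs⟩⟩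

variable {X Y A : VDC.{max (u + 1) w}}

/-- The virtual double functor from the dependent product to families. -/
noncomputable def piProj (P : VDFunctor X Y) (hs : HasSmallFibres.{u} P) (F : VDFunctor A X) :
    VDFunctor (PiProd (X := X) (Y := Y) (A := A) P F) (Fam.{u} A) :=
  (PiProd.families P F).comp ((reindex hs).vdFunctor A)

end Bar

namespace Bar
open VDGraph VDFunctor IndexGraph

variable {X Y A : VDC.{max (u + 1) w}} {P : VDFunctor X Y} {hs : HasSmallFibres.{u} P}
  {F : VDFunctor A X}

theorem _root_.IndexGraph.FOb.a_eq {J : IndexGraph.{i, k}} {A : VDC.{w}} {z : J.Ob}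
    {a b : J.El z → A.Ob} (h : FOb.mk z a = FOb.mk z b) : a = b := by
  cases h; rfl

/-- `map_a` says that `F` sends the member at `x` to `x`, so the image of the family is the
tautological family on the fibre. -/
theorem map_rOb (q : PiProd.PiOb P F) :
    mapOb F ((reindex hs).rOb q.toFOb) = ob hs q.base :=
  congrArg (FOb.mk (J := setIndex.{u}) (A := X) (SOb hs q.base))
    (funext fun s => q.map_a ((eOb hs q.base).symm s))

theorem map_rHor {q q' : PiProd.PiOb P F} (S : PiProd.PiHor q q') :
    HorTot.mk (A := setIndex.{u}.famGraph X) (mapHor F ((reindex hs).rHor S.toFHor)) =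
      HorTot.mk (A := setIndex.{u}.famGraph X) (hor hs S.base) :=
  horTot_ext (funext fun s => q.map_a ((eOb hs q.base).symm s))
    (funext fun s => q'.map_a ((eOb hs q'.base).symm s))
    fun s => S.map_Γ ((reindex hs).hel S.Ψ s)

theorem vOver_rVer {q q' : PiProd.PiOb P F} (f : PiProd.PiVer q q') :
    VOver P ⟨(mapFunctor F).map ((reindex hs).rVer f.toFVer)⟩ ⟨f.v⟩ := fun i =>
  (congrArg (F.comp P).verTot ((reindex hs).tot_mor f.toFVer i)).trans (f.map_mor _)

/-- Unique lifting enters here: both families consist of lifts of `v` with the same domains, and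
this determines the function on indices as well as the members. -/
theorem verTot_eq_ver (hP : P.IsDiscreteOpfibration) (f : (setIndex.{u}.famGraph X).VerTot)
    {y y' : Y.Ob} (v : y ⟶ y') (ha : f.a = ob hs y) (hb : f.b = ob hs y') (h : VOver P f ⟨v⟩) :
    f = ⟨ver hP hs v⟩ := by
  obtain ⟨f, rfl⟩ := f.exists_ver ha hb
  exact congrArg VerTot.mk (ver_ext hP hs fun s => (h s).trans (map_ver hP hs v s).symm)

/-- Both families consist of lifts of `ν` along the same top paths. -/
theorem cellTot_eq_cell (hP : P.IsDiscreteOpfibration) (θ : (setIndex.{u}.famGraph X).CellTot)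
    {a b c d : Y.Ob} {p : HPath Y.Hor a b} {v : a ⟶ c} {v' : b ⟶ d} {Ψ : Y.Hor c d}
    (ν : Y.Cell p v v' Ψ)
    (hb : θ.bd = ⟨p.map (ob hs) (hor hs), ver hP hs v, ver hP hs v', hor hs Ψ⟩)
    (h : TOver P θ ⟨ν⟩) : θ = ⟨cell hP hs ν⟩ := by
  obtain ⟨θ, rfl⟩ := θ.exists_cell hb
  exact congrArg CellTot.mk (cell_ext hP hs h (map_cell hP hs ν))

theorem map_rVer (hP : P.IsDiscreteOpfibration) {q q' : PiProd.PiOb P F}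
    (f : PiProd.PiVer q q') :
    VerTot.mk (A := setIndex.{u}.famGraph X) ((mapFunctor F).map ((reindex hs).rVer f.toFVer)) =
      ⟨ver hP hs f.v⟩ :=
  verTot_eq_ver hP _ f.v (map_rOb q) (map_rOb q') (vOver_rVer f)

theorem tOver_piProj {a b c d : PiProd.PiOb P F} {p : HPath PiProd.PiHor a b} {f : a ⟶ c}
    {f' : b ⟶ d} {S : PiProd.PiHor c d} (θ : PiProd.PiCell p f f' S) :
    TOver P (((piProj P hs F).comp (Fam.map.{u} F)).cellTot ⟨θ⟩) ⟨θ.ν⟩ := by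
  have e : ((piProj P hs F).comp (Fam.map.{u} F)).cellTot ⟨θ⟩ =
      ⟨mapCell F ((reindex hs).rCell θ.toFCell)⟩ :=
    (cellTot_comp (piProj P hs F) (Fam.map.{u} F) θ).trans
      (congrArg (Fam.map.{u} F).cellTot
        (cellTot_comp (PiProd.families P F) ((reindex hs).vdFunctor A) θ))
  rw [e]
  intro i j t
  refine (cOver_mapCell F P ((reindex hs).rCell θ.toFCell) ⟨θ.ν⟩).2 (fun {i j} t => ?_) t
  exact (congrArg (F.comp P).cellTot ((reindex hs).tot_rCell θ.toFCell t)).trans (θ.map_cell _)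

/-- On objects and horizontal morphisms this is the condition that `F` sends each member to its
index. On vertical morphisms and multicells both composites lie over the same datum of `Y`, so
uniqueness of lifts identifies them. -/
theorem piProj_comm (hP : P.IsDiscreteOpfibration) :
    (piProj P hs F).comp (Fam.map.{u} F) =
      VDFunctor.comp (PiProd.proj (X := X) (Y := Y) P F) (bar (X := X) (Y := Y) P hP hs) :=
  ext_tot map_rOb (fun f => map_rVer hP f) (fun S => map_rHor S) fun {a b c d p f f' S} θ => by
    refine Eq.trans ?_ (cellTot_comp _ _ _).symm
    refine cellTot_eq_cell hP _ θ.ν (Bd.ext_tot ?_ (map_rVer hP f) (map_rVer hP f') (map_rHor S))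
      (tOver_piProj θ)
    refine Eq.trans ?_ (congrArg PathTot.mk (VDGraphHom.path_comp
      (PiProd.proj (X := X) (Y := Y) P F).toVDGraphHom
      (bar (X := X) (Y := Y) P hP hs).toVDGraphHom p)).symm
    exact pathTot_map (W := PiProd.graph P F) (A := setIndex.{u}.famGraph X) map_rOb
      (fun S => map_rHor S) p

theorem piProj_ob (a : setIndex.{u}.FOb A) (y : Y.Ob) (h : mapOb F a = ob hs y) :
    ∃! q : PiProd.PiOb P F, (reindex hs).rOb q.toFOb = a ∧ q.base = y := by
  obtain ⟨z, a⟩ := a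
  -- The equation in `Fam X` already determines the index set of the family in `A`, because `F` acts
  -- on the members only.
  obtain rfl : z = SOb hs y := congrArg FOb.z h
  have h' : (fun s => F.toFunctor.obj (a s)) = fun s => ((eOb hs y).symm s).1 := FOb.a_eq h
  -- The family `a`, reindexed from the small copy back to the fibre itself.
  refine ⟨⟨⟨y, fun x => a (eOb hs y x)⟩, fun x => ?_⟩, ⟨?_, rfl⟩, ?_⟩
  · refine (congrFun h' _).trans ?_
    rw [Equiv.symm_apply_apply]
  · refine congrArg (FOb.mk (J := setIndex.{u}) (A := A) (SOb hs y)) (funext fun s => ?_)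
    exact congrArg a ((eOb hs y).apply_symm_apply s)
  · rintro ⟨⟨y, b⟩, hb⟩ ⟨h₁, rfl⟩
    have h₂ : (fun s => b ((eOb hs y).symm s)) = a := by
      exact FOb.a_eq h₁
    subst h₂
    simp only [PiProd.PiOb.mk.injEq, FOb.mk.injEq, heq_eq_eq, true_and]
    exact funext fun x => (congrArg b ((eOb hs y).symm_apply_apply x)).symm

theorem piProj_ver (hP : P.IsDiscreteOpfibration) {q q' : PiProd.PiOb P F}
    (α : (reindex hs).rOb q.toFOb ⟶ (reindex hs).rOb q'.toFOb) (β : q.base ⟶ q'.base)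
    (h : VerTot.mk (A := setIndex.{u}.famGraph X) ((mapFunctor F).map α) = ⟨ver hP hs β⟩) :
    ∃! χ : PiProd.PiVer q q', (reindex hs).rVer χ.toFVer = α ∧ χ.v = β := by
  have h' : VOver P ⟨(mapFunctor F).map α⟩ ⟨β⟩ := by
    rw [h]; exact map_ver hP hs β
  obtain ⟨f, rfl⟩ := (reindex hs).exists_rVer α
  -- The hypothesis enters only through `h'`: lying over `β` is all that the dependent product
  -- demands of the members.
  refine ⟨⟨f, β, fun x => ?_⟩, ⟨rfl, rfl⟩, ?_⟩
  · obtain ⟨i, rfl⟩ := ((reindex hs).el q.z).surjective x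
    exact (congrArg (F.comp P).verTot ((reindex hs).tot_mor f i).symm).trans (h' i)
  · rintro ⟨g, β', hg⟩ ⟨h₁, rfl⟩
    exact PiProd.PiVer.ext_ver ((reindex hs).rVer_inj h₁) rfl

theorem piProj_hor {q q' : PiProd.PiOb P F}
    (α : FHor ((reindex hs).rOb q.toFOb) ((reindex hs).rOb q'.toFOb)) (β : Y.Hor q.base q'.base)
    (h : HorTot.mk (A := setIndex.{u}.famGraph X) (mapHor F α) = ⟨hor hs β⟩) :
    ∃! χ : PiProd.PiHor q q', (reindex hs).rHor χ.toFHor = α ∧ χ.base = β := by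
  obtain ⟨Ψ, Γ⟩ := α
  obtain rfl : Ψ = span hs β := edge_eq_of_horTot h
  obtain ⟨Γ', hΓ'⟩ := (reindex hs).exists_rHor (X := q.toFOb) (Y := q'.toFOb) (Ψ := β) Γ
  refine ⟨⟨⟨β, Γ'⟩, fun {x x'} Φ => ?_⟩, ⟨hΓ', rfl⟩, ?_⟩
  · obtain ⟨i, rfl⟩ := ((reindex hs).el q.z).surjective x
    obtain ⟨j, rfl⟩ := ((reindex hs).el q'.z).surjective x'
    obtain ⟨s, rfl⟩ := ((reindex hs).hel β).surjective Φ
    have h₁ := horTot_eq_of_horTot (congrArg HorTot.mk hΓ') (i := i) (j := j) (s := s) HEq.rfl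
    exact (congrArg F.horTot h₁).trans (horTot_eq_of_horTot h (s := s) HEq.rfl)
  · rintro ⟨S, hS⟩ ⟨h₁, h₂⟩
    -- The span of fibres alone might not determine `β`; the component `h₂` in `Y` does.
    obtain rfl := (reindex hs).rHor_inj (S := S) (S' := ⟨β, Γ'⟩) h₂ (h₁.trans hΓ'.symm)
    rfl

theorem piProj_cell (hP : P.IsDiscreteOpfibration) {a b c d : PiProd.PiOb P F}
    {p : HPath PiProd.PiHor a b} {f : a ⟶ c} {f' : b ⟶ d} {S : PiProd.PiHor c d}
    (α : FCell ((piProj P hs F).path p) ((reindex hs).rVer (PiProd.PiVer.toFVer f))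
      ((reindex hs).rVer (PiProd.PiVer.toFVer f')) ((reindex hs).rHor S.toFHor))
    (β : Y.Cell (PiProd.basePath p) (PiProd.PiVer.v f) (PiProd.PiVer.v f') S.base)
    (h : CellTot.mk (A := setIndex.{u}.famGraph X) (mapCell F α) = ⟨cell hP hs β⟩) :
    ∃! χ : PiProd.PiCell p f f' S, (piProj P hs F).cell χ = α ∧ χ.ν = β := by
  have h' : TOver P ⟨mapCell F α⟩ ⟨β⟩ := by
    rw [h]; exact map_cell hP hs β
  have hp := VDGraphHom.path_comp (PiProd.toFam P F) ((reindex hs).graph A) p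
  have h₂ : COver (F.comp P) α ⟨β⟩ := (cOver_mapCell F P α _).1 h'
  -- The path of `piProj` is taken along a composite, so `α` is first moved to the path obtained by
  -- mapping twice.
  obtain ⟨θ, hθ⟩ := (reindex hs).exists_rCell
    (castTop (A := setIndex.{u}.famGraph A) hp.symm α)
  have h₃ : CellTot.mk (A := setIndex.{u}.famGraph A) ((reindex hs).rCell θ) = ⟨α⟩ :=
    (congrArg CellTot.mk hθ).trans (tot_castTop _ _)
  have h₄ : TOver (F.comp P) ⟨(reindex hs).rCell θ⟩ ⟨β⟩ := by
    rw [h₃]; exact h₂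
  refine ⟨⟨θ, β, fun {x x'} t => ?_⟩, ⟨?_, rfl⟩, ?_⟩
  · obtain ⟨i, rfl⟩ := ((reindex hs).el a.z).surjective x
    obtain ⟨j, rfl⟩ := ((reindex hs).el b.z).surjective x'
    obtain ⟨t, rfl⟩ := (reindex hs).exists_untup _ t
    exact (congrArg (F.comp P).cellTot ((reindex hs).tot_rCell θ t).symm).trans (h₄ t)
  · exact eq_of_tot ((cellTot_comp (PiProd.families P F) ((reindex hs).vdFunctor A) _).trans h₃)
  · rintro ⟨θ', β', hθ'⟩ ⟨h₅, rfl⟩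
    refine PiProd.PiCell.ext_cell ((reindex hs).rCell_inj
      (eq_of_tot (A := setIndex.{u}.famGraph A) ?_)) rfl
    refine Eq.trans ?_ h₃.symm
    exact (cellTot_comp (PiProd.families P F) ((reindex hs).vdFunctor A) _).symm.trans
      (congrArg CellTot.mk h₅)

theorem isLevelwisePullback (hP : P.IsDiscreteOpfibration) :
    IsLevelwisePullback (piProj P hs F) (PiProd.proj (X := X) (Y := Y) P F) (Fam.map.{u} F)
      (bar (X := X) (Y := Y) P hP hs) where
  comm := piProj_comm hP
  ob := piProj_ob
  ver := piProj_ver hP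
  hor := piProj_hor
  cell := piProj_cell hP

end Bar

/-! ### Comparing families, elements and tuples across different boundaries. -/

namespace IndexGraph
open VDGraph VDFunctor

variable {J : IndexGraph.{i, k}} {A B : VDC.{w}}

/-- A tuple together with its path. -/
structure TupTot (J : IndexGraph.{i, k}) (A : VDC.{w}) : Type (max i k w) where
  {X Y : J.FOb A}
  {p : HPath FHor X Y}
  {i : J.El X.z}
  {j : J.El Y.z}
  t : Tup p i j

/-- An element of the edge of a family of horizontal morphisms together with the family. -/
structure ElTot (J : IndexGraph.{i, k}) (A : VDC.{w}) : Type (max i k w) where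
  {X Y : J.FOb A}
  {S : FHor X Y}
  {i : J.El X.z}
  {j : J.El Y.z}
  s : J.HEl S.Ψ i j

/-- An element of the vertex of a family of objects together with the family. -/
structure ObTot (J : IndexGraph.{i, k}) (A : VDC.{w}) : Type (max i k w) where
  {X : J.FOb A}
  i : J.El X.z

theorem tupTot_nil {X X' : J.FOb A} {i : J.El X.z} {i' : J.El X'.z}
    (h : ObTot.mk i = ObTot.mk i') : TupTot.mk (Tup.nil i) = TupTot.mk (Tup.nil i') := by
  cases h; rfl

theorem tupTot_cons {X Y Z X' Y' Z' : J.FOb A} {S : FHor X Y} {p : HPath FHor Y Z}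
    {S' : FHor X' Y'} {p' : HPath FHor Y' Z'} {i : J.El X.z} {j : J.El Y.z} {l : J.El Z.z}
    {i' : J.El X'.z} {j' : J.El Y'.z} {l' : J.El Z'.z} {s : J.HEl S.Ψ i j} {t : Tup p j l}
    {s' : J.HEl S'.Ψ i' j'} {t' : Tup p' j' l'} (h : ElTot.mk s = ElTot.mk s')
    (h' : TupTot.mk t = TupTot.mk t') :
    TupTot.mk (Tup.cons s t) = TupTot.mk (Tup.cons s' t') := by
  cases h; cases h'; rfl

theorem tupAt_of_tupTot {X Y : J.FOb A} {p : HPath FHor X Y} {i i' : J.El X.z} {j j' : J.El Y.z}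
    {t : Tup p i j} {t' : Tup p i' j'} (h : TupTot.mk t = TupTot.mk t') :
    TupAt.mk t = TupAt.mk t' := by
  cases h; rfl

theorem hElAt_of_elTot {X Y : J.FOb A} {S : FHor X Y} {i i' : J.El X.z} {j j' : J.El Y.z}
    {s : J.HEl S.Ψ i j} {s' : J.HEl S.Ψ i' j'} (h : ElTot.mk s = ElTot.mk s') :
    HElAt.mk s = HElAt.mk s' := by
  cases h; rfl

theorem elTot_of_hElAt {X Y : J.FOb A} {S : FHor X Y} {i i' : J.El X.z} {j j' : J.El Y.z}
    {s : J.HEl S.Ψ i j} {s' : J.HEl S.Ψ i' j'} (h : HElAt.mk s = HElAt.mk s') :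
    ElTot.mk s = ElTot.mk s' := by
  cases h; rfl

theorem eq_of_obTot {X : J.FOb A} {i i' : J.El X.z} (h : ObTot.mk i = ObTot.mk i') : i = i' := by
  cases h; rfl

theorem obTot_ext {X X' : J.FOb A} {i : J.El X.z} {i' : J.El X'.z} (h : X = X') (hi : HEq i i') :
    ObTot.mk i = ObTot.mk i' := by
  subst h; cases hi; rfl

theorem elTot_ext {X X' Y Y' : J.FOb A} {S : FHor X Y} {S' : FHor X' Y'} {i : J.El X.z}
    {i' : J.El X'.z} {j : J.El Y.z} {j' : J.El Y'.z} {s : J.HEl S.Ψ i j} {s' : J.HEl S'.Ψ i' j'}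
    (h : HorTot.mk (A := J.famGraph A) S = HorTot.mk (A := J.famGraph A) S') (hi : HEq i i')
    (hj : HEq j j') (hs : HEq s s') : ElTot.mk s = ElTot.mk s' := by
  cases h; cases hi; cases hj; cases hs; rfl

theorem fOb_ext {X X' : J.FOb A} (h : X.z = X'.z)
    (ha : ∀ (i : J.El X.z) (i' : J.El X'.z), HEq i i' → X.a i = X'.a i') : X = X' := by
  obtain ⟨z, a⟩ := X
  obtain ⟨z', a'⟩ := X'
  dsimp only at h
  subst h
  exact congrArg (FOb.mk z) (funext fun i => ha i i HEq.rfl)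

theorem verTot_ext {X X' Y Y' : J.FOb A} {f : X ⟶ Y} {f' : X' ⟶ Y'} (hX : X = X') (hY : Y = Y')
    (h : ∀ (i : J.El X.z) (i' : J.El X'.z), ObTot.mk i = ObTot.mk i' →
      ObTot.mk (f.fn i) = ObTot.mk (f'.fn i') ∧ VerTot.mk (f.mor i) = VerTot.mk (f'.mor i')) :
    VerTot.mk (A := J.famGraph A) f = VerTot.mk (A := J.famGraph A) f' := by
  subst hX hY
  obtain ⟨fn, mor⟩ := f
  obtain ⟨fn', mor'⟩ := f'
  obtain rfl : fn = fn' := funext fun i => eq_of_obTot (h i i rfl).1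
  exact congrArg (fun m => VerTot.mk (A := J.famGraph A) (FVer.mk fn m))
    (funext fun i => eq_of_verTot (h i i rfl).2)

theorem horTot_ext_heq {X X' Y Y' : J.FOb A} {S : FHor X Y} {S' : FHor X' Y'} (hX : X = X')
    (hY : Y = Y') (hΨ : HEq S.Ψ S'.Ψ)
    (h : ∀ {i : J.El X.z} {j : J.El Y.z} {i' : J.El X'.z} {j' : J.El Y'.z} (s : J.HEl S.Ψ i j)
      (s' : J.HEl S'.Ψ i' j'), ObTot.mk i = ObTot.mk i' → ObTot.mk j = ObTot.mk j' → HEq s s' →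
      HorTot.mk (S.Γ s) = HorTot.mk (S'.Γ s')) :
    HorTot.mk (A := J.famGraph A) S = HorTot.mk (A := J.famGraph A) S' := by
  subst hX hY
  exact congrArg HorTot.mk (FHor.ext_heq (eq_of_heq hΨ) fun s s' hs =>
    eq_of_horTot (h s s' rfl rfl hs))

theorem edge_heq_of_horTot {X X' Y Y' : J.FOb A} {S : FHor X Y} {S' : FHor X' Y'}
    (h : HorTot.mk (A := J.famGraph A) S = HorTot.mk (A := J.famGraph A) S') :
    HEq S.Ψ S'.Ψ := by
  cases h; rfl

/-- After the boundaries are identified, matching tuples may be taken equal; the indices then agree,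
and so do the members over them. -/
theorem cellTot_ext {X Y X' Y' X₁ Y₁ X₁' Y₁' : J.FOb A} {p : HPath FHor X Y} {f : X ⟶ X'}
    {f' : Y ⟶ Y'} {S : FHor X' Y'} {θ : FCell p f f' S} {p₁ : HPath FHor X₁ Y₁} {f₁ : X₁ ⟶ X₁'}
    {f₁' : Y₁ ⟶ Y₁'} {S₁ : FHor X₁' Y₁'} {θ₁ : FCell p₁ f₁ f₁' S₁}
    (hb : Bd.mk (A := J.famGraph A) p f f' S = Bd.mk (A := J.famGraph A) p₁ f₁ f₁' S₁)
    (h : ∀ {i : J.El X.z} {j : J.El Y.z} {i₁ : J.El X₁.z} {j₁ : J.El Y₁.z} (t : Tup p i j)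
      (t₁ : Tup p₁ i₁ j₁), TupTot.mk t = TupTot.mk t₁ →
      ElTot.mk (θ.fn t) = ElTot.mk (θ₁.fn t₁) ∧
        CellTot.mk (θ.cell t) = CellTot.mk (θ₁.cell t₁)) :
    CellTot.mk (A := J.famGraph A) θ = CellTot.mk (A := J.famGraph A) θ₁ := by
  cases hb
  refine congrArg CellTot.mk (FCell.ext_val fun t => ?_)
  obtain ⟨h₁, h₂⟩ := h t t rfl
  have key : ∀ {i j} {s s' : J.HEl S.Ψ i j} {a b : A.Ob} {p : HPath A.Hor a b} {v : a ⟶ X'.a i}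
      {v' : b ⟶ Y'.a j} {χ : A.Cell p v v' (S.Γ s)} {χ' : A.Cell p v v' (S.Γ s')},
      s = s' → CellTot.mk χ = CellTot.mk χ' → Val.mk s χ = Val.mk s' χ' := by
    intro i j s s' a b p v v' χ χ' hs h
    subst hs
    exact val_congr s h
  refine key ?_ h₂
  simpa using hElAt_of_elTot h₁

theorem val_castTop {X Y X' Y' : J.FOb A} {p p' : HPath FHor X Y} {f : X ⟶ X'} {f' : Y ⟶ Y'}
    {S : FHor X' Y'} (h : p = p') (θ : FCell p f f' S) {i : J.El X.z} {j : J.El Y.z}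
    {t : Tup p i j} {t' : Tup p' i j} (ht : HEq t t') :
    FCell.val (castTop (A := J.famGraph A) h θ) t' = θ.val t := by
  subst h; cases ht; rfl

theorem val_mapCell (N : VDFunctor A B) {X Y X' Y' : J.FOb A} {p : HPath FHor X Y} {f : X ⟶ X'}
    {f' : Y ⟶ Y'} {S : FHor X' Y'} (θ : FCell p f f' S) {i : J.El X.z} {j : J.El Y.z}
    (t : Tup p i j) : (mapCell N θ).val (mapTup N t) = mapVal N (θ.val t) := by
  -- Both the tuple and the target path of the cast are generalized, so that two substitutions
  -- remove the cast.
  have key : ∀ t', t' = t → ∀ (q : HPath B.Hor _ _) (h : N.path t'.path = q),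
      Val.mk (S := mapHor N S) (θ.fn t') (castTop h (N.cell (θ.cell t'))) =
        mapVal N (θ.val t) := by
    rintro t' rfl q rfl
    rfl
  exact key _ (unmapTup_mapTup N t) _ _

end IndexGraph

/-! ### Markings: virtual double categories of elements and their universal property. -/

/-- An element of the index set of `M (P x)` for each object `x`, and an element of the index set of
`M (P Φ)` for each horizontal morphism `Φ`. -/
structure Marking {X Y B : VDC.{max (u + 1) w}} (P : VDFunctor X Y)
    (M : VDFunctor Y (setIndex.{u}.fam B)) where
  /-- The element at an object. -/
  ob : (x : X.Ob) → setIndex.{u}.El (IndexGraph.FOb.z (M.toFunctor.obj (P.toFunctor.obj x)))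
  /-- The element at a horizontal morphism. -/
  hor : {x x' : X.Ob} → (Φ : X.Hor x x') →
    setIndex.{u}.HEl (IndexGraph.FHor.Ψ (M.hor (P.hor Φ))) (ob x) (ob x')

namespace Marking
open VDGraph VDFunctor IndexGraph

variable {X Y B C : VDC.{max (u + 1) w}} {P : VDFunctor X Y}
  {M M' : VDFunctor Y (setIndex.{u}.fam B)}

/-- The tuple at a path. -/
def tup (E : Marking P M) : {x x' : X.Ob} → (q : HPath X.Hor x x') →
    Tup (J := setIndex.{u}) (A := B) (M.path (P.path q)) (E.ob x) (E.ob x')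
  | _, _, .nil x => .nil (J := setIndex.{u}) (A := B) (X := M.toFunctor.obj (P.toFunctor.obj x))
      (E.ob x)
  | _, _, .cons Φ q => .cons (J := setIndex.{u}) (A := B) (S := M.hor (P.hor Φ))
      (E.hor Φ) (E.tup q)

theorem tup_append (E : Marking P M) {x x' x'' : X.Ob} (q : HPath X.Hor x x')
    (q' : HPath X.Hor x' x'') :
    HEq ((E.tup q).append (E.tup q')) (E.tup (q.append q')) := by
  induction q with
  | nil x => rfl
  | cons Φ q ih =>
    exact cons_heq (J := setIndex.{u}) (A := B) (S := M.hor (P.hor Φ))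
      ((HPath.map_append _ _ _ _).trans (congrArg M.path (HPath.map_append _ _ q q')))
      (E.hor Φ) (ih q')

/-- The objects and horizontal morphisms of `X` are the pairs of an object or horizontal morphism
of `Y` and an element of its index set, and the action of vertical morphisms and multicells on the
elements is determined by `X`. -/
structure IsElements (E : Marking P M) : Prop where
  ob_surj : ∀ (y : Y.Ob) (i : setIndex.{u}.El (FOb.z (M.toFunctor.obj y))),
    ∃ x, (⟨P.toFunctor.obj x, E.ob x⟩ :
      (y : Y.Ob) × setIndex.{u}.El (FOb.z (M.toFunctor.obj y))) = ⟨y, i⟩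
  hor_surj : ∀ {x x' : X.Ob} (Ψ : Y.Hor (P.toFunctor.obj x) (P.toFunctor.obj x'))
    (s : setIndex.{u}.HEl (FHor.Ψ (M.hor Ψ)) (E.ob x) (E.ob x')),
    ∃ Φ : X.Hor x x', (⟨P.hor Φ, E.hor Φ⟩ :
      (Ψ : Y.Hor (P.toFunctor.obj x) (P.toFunctor.obj x')) ×
        setIndex.{u}.HEl (FHor.Ψ (M.hor Ψ)) (E.ob x) (E.ob x')) = ⟨Ψ, s⟩
  ver : ∀ {x x' : X.Ob} (m : x ⟶ x'), FVer.fn (M.toFunctor.map (P.toFunctor.map m)) (E.ob x) =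
    E.ob x'
  cell : ∀ {a b c d : X.Ob} {q : HPath X.Hor a b} {m : a ⟶ c} {m' : b ⟶ d} {Φ : X.Hor c d}
    (χ : X.Cell q m m' Φ), HElAt.mk (FCell.fn (M.cell (P.cell χ)) (E.tup q)) =
      HElAt.mk (E.hor Φ)

/-- `K` sends each object, morphism and multicell of `X` to the member of the family given by `M` at
the corresponding element. -/
structure Realizes (K : VDFunctor X B) (E : Marking P M) : Prop where
  ob : ∀ x, K.toFunctor.obj x = FOb.a (M.toFunctor.obj (P.toFunctor.obj x)) (E.ob x)
  ver : ∀ {x x' : X.Ob} (m : x ⟶ x'),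
    K.verTot ⟨m⟩ = ⟨FVer.mor (M.toFunctor.map (P.toFunctor.map m)) (E.ob x)⟩
  hor : ∀ {x x' : X.Ob} (Φ : X.Hor x x'), K.horTot ⟨Φ⟩ = ⟨FHor.Γ (M.hor (P.hor Φ)) (E.hor Φ)⟩
  cell : ∀ {a b c d : X.Ob} {q : HPath X.Hor a b} {m : a ⟶ c} {m' : b ⟶ d} {Φ : X.Hor c d}
    (χ : X.Cell q m m' Φ), K.cellTot ⟨χ⟩ = ⟨FCell.cell (M.cell (P.cell χ)) (E.tup q)⟩

/-- A marking prescribes all values of a functor that realizes it; this is the uniqueness half of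
the universal property. -/
theorem Realizes.functor_eq {K K' : VDFunctor X B} {E : Marking P M} (h : E.Realizes K)
    (h' : E.Realizes K') : K = K' :=
  ext_tot (fun x => (h.ob x).trans (h'.ob x).symm) (fun m => (h.ver m).trans (h'.ver m).symm)
    (fun Φ => (h.hor Φ).trans (h'.hor Φ).symm) (fun χ => (h.cell χ).trans (h'.cell χ).symm)

/-- Marked tuples are carried to marked tuples by `hE.ver` and `hE.cell`, so acting by a sequence
amounts to applying `N` to it. `N` is only a map of graphs because the lemma serves to prove that it
preserves composition. -/
theorem IsElements.seq {E : Marking P M} (hE : E.IsElements)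
    (N : VDGraphHom X.toVDGraph B.toVDGraph)
    (hv : ∀ {x x' : X.Ob} (m : x ⟶ x'),
      N.verTot ⟨m⟩ = ⟨FVer.mor (M.toFunctor.map (P.toFunctor.map m)) (E.ob x)⟩)
    (hc : ∀ {a b c d : X.Ob} {q : HPath X.Hor a b} {m : a ⟶ c} {m' : b ⟶ d} {Φ : X.Hor c d}
      (χ : X.Cell q m m' Φ), N.cellTot ⟨χ⟩ = ⟨FCell.cell (M.cell (P.cell χ)) (E.tup q)⟩)
    {a b c d : X.Ob} {q : HPath X.Hor a b} {m : a ⟶ c} {m' : b ⟶ d} {r : HPath X.Hor c d}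
    (Θ : X.CellSeq q m m' r) :
    TupAt.mk (act (J := setIndex.{u}) (A := B) (M.seq (P.seq Θ)) (E.tup q)).res =
      TupAt.mk (E.tup r) ∧
    SeqTot.mk (act (J := setIndex.{u}) (A := B) (M.seq (P.seq Θ)) (E.tup q)).cells =
      SeqTot.mk (N.seq Θ) := by
  induction Θ with
  | nil m => exact ⟨tupAt_nil (hE.ver m), seqTot_nil (hv m).symm⟩
  | cons χ Θ hp ih =>
    rename_i q₁ _ _ _ q₂ _ _ _
    subst hp
    have hp := (HPath.map_append _ _ _ _).trans
      (congrArg M.path (HPath.map_append P.toFunctor.obj P.hor q₁ q₂))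
    have e₁ := split_eq hp _ _ _ (E.tup_append q₁ q₂)
    have e₂ := split_path _ hp (E.tup (q₁.append q₂))
    rw [e₁] at e₂
    have a₁ := act_cons (J := setIndex.{u}) (A := B) (M.cell (P.cell χ)) (M.seq (P.seq Θ)) hp
      _ _ _ e₁ e₂
    constructor
    · refine (congrArg (fun r => TupAt.mk (Act.res r)) a₁).trans ?_
      exact tupAt_cons (hE.cell χ) ih.1
    · refine (congrArg (fun r => SeqTot.mk r.cells) a₁).trans ?_
      exact seqTot_cons _ _ _ _ _ _ (hc χ).symm ih.2

/-- The members of `M` at the marked elements have compatible boundaries by `hE.ver` and `hE.cell`,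
and identities and composites in `Fam B` are formed memberwise along tuples, which by
`IsElements.seq` stay marked. -/
theorem IsElements.exists_realizes {E : Marking P M} (hE : E.IsElements) :
    ∃ K : VDFunctor X B, E.Realizes K := by
  -- The member of `M (P m)` ends at the element to which its function sends `E.ob x`; `hE.ver`
  -- identifies this with `E.ob x'`.
  have hv := fun (x x' : X.Ob) (m : x ⟶ x') =>
    VerTot.exists_ver (A := B.toVDGraph)
      ⟨FVer.mor (M.toFunctor.map (P.toFunctor.map m)) (E.ob x)⟩
      (a := FOb.a (M.toFunctor.obj (P.toFunctor.obj x)) (E.ob x))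
      (b := FOb.a (M.toFunctor.obj (P.toFunctor.obj x')) (E.ob x')) rfl
      (congrArg (FOb.a (M.toFunctor.obj (P.toFunctor.obj x'))) (hE.ver m))
  choose ver hver using hv
  let Φ : X.Ob ⥤ B.Ob :=
    { obj := fun x => FOb.a (M.toFunctor.obj (P.toFunctor.obj x)) (E.ob x)
      map := fun m => ver _ _ m
      map_id := fun x => by
        refine eq_of_verTot ((hver _ _ _).trans ?_)
        exact congrArg (fun f => VerTot.mk (FVer.mor f (E.ob x)))
          ((congrArg M.toFunctor.map (P.toFunctor.map_id x)).trans (M.toFunctor.map_id _))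
      map_comp := fun {x x' x''} m m' => by
        refine eq_of_verTot ((hver _ _ _).trans ?_)
        refine (congrArg (fun f => VerTot.mk (FVer.mor f (E.ob x)))
          ((congrArg M.toFunctor.map (P.toFunctor.map_comp m m')).trans
            (M.toFunctor.map_comp _ _))).trans ?_
        refine verTot_comp (hver _ _ m).symm (Eq.trans ?_ (hver _ _ m').symm)
        exact congrArg (fun i => VerTot.mk (FVer.mor (M.toFunctor.map (P.toFunctor.map m')) i))
          (hE.ver m) }
  let hor : ∀ {x x' : X.Ob}, X.Hor x x' → B.Hor (Φ.obj x) (Φ.obj x') := fun Γ =>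
    FHor.Γ (M.hor (P.hor Γ)) (E.hor Γ)
  have hpath : ∀ {x x' : X.Ob} (q : HPath X.Hor x x'), (E.tup q).path = q.map Φ.obj hor := by
    intro x x' q
    induction q with
    | nil x => rfl
    | cons Γ q ih => exact congrArg (HPath.cons (hor Γ)) ih
  have hc := fun (a b c d : X.Ob) (q : HPath X.Hor a b) (m : a ⟶ c) (m' : b ⟶ d)
      (Γ : X.Hor c d) (χ : X.Cell q m m' Γ) =>
    CellTot.exists_cell (A := B.toVDGraph) ⟨FCell.cell (M.cell (P.cell χ)) (E.tup q)⟩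
      (p := q.map Φ.obj hor) (u := ver _ _ m) (u' := ver _ _ m') (Δ := hor Γ)
      (Bd.ext_tot (congrArg PathTot.mk (hpath q)) (hver _ _ m).symm (hver _ _ m').symm
        (congrArg (fun s : HElAt _ => HorTot.mk (FHor.Γ (M.hor (P.hor Γ)) s.s)) (hE.cell χ)))
  choose cell hcell using hc
  let N : VDGraphHom X.toVDGraph B.toVDGraph :=
    { toFunctor := Φ
      hor := hor
      cell := fun χ => cell _ _ _ _ _ _ _ _ χ }
  refine ⟨⟨N, fun {x x'} Γ => ?_, fun {_ _ _ _ _ _ q _ _ _ _ _ _} Θ κ => ?_⟩, fun x => rfl,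
    fun m => hver _ _ m, fun Γ => rfl, fun χ => hcell _ _ _ _ _ _ _ _ χ⟩
  · refine eq_of_tot ((hcell _ _ _ _ _ _ _ _ _).trans (Eq.trans ?_ (B.tot_hid _ _ _).symm))
    have e₁ : M.cellTot (P.cellTot ⟨X.hid Γ rfl rfl⟩) =
        ⟨famId (J := setIndex.{u}) (A := B) (M.hor (P.hor Γ)) rfl rfl⟩ :=
      (congrArg M.cellTot (P.cellTot_hid Γ rfl rfl)).trans (M.cellTot_hid (P.hor Γ) rfl rfl)
    -- The image of an identity cell and the identity cell of the image have edges that agree only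
    -- propositionally, but the same top path, so their members can be compared at a common tuple.
    have key : ∀ {X₀ Y₀ X₁ Y₁ X₂ Y₂ : setIndex.{u}.FOb B} {p : HPath FHor X₀ Y₀} {f : X₀ ⟶ X₁}
        {f' : Y₀ ⟶ Y₁} {S : FHor X₁ Y₁} {g : X₀ ⟶ X₂} {g' : Y₀ ⟶ Y₂} {S' : FHor X₂ Y₂}
        (θ : FCell p f f' S) (θ' : FCell p g g' S')
        (_ : CellTot.mk (A := setIndex.{u}.famGraph B) θ = ⟨θ'⟩) {i j} (t : Tup p i j),
        CellTot.mk (θ.cell t) = CellTot.mk (θ'.cell t) := by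
      intro X₀ Y₀ X₁ Y₁ X₂ Y₂ p f f' S g g' S' θ θ' h i j t
      cases h; rfl
    refine (key _ _ e₁ (E.tup (HPath.single Γ))).trans ?_
    exact congrArg Val.tot (val_famId (M.hor (P.hor Γ)) rfl rfl (E.hor Γ))
  · refine eq_of_tot ((hcell _ _ _ _ _ _ _ _ _).trans ?_)
    have e := (congrArg (fun θ => M.cell θ) (P.cell_comp Θ κ)).trans (M.cell_comp' _ _ _ _)
    refine (congrArg (fun θ => CellTot.mk (FCell.cell θ (E.tup q))) e).trans ?_
    refine (congrArg Val.tot (val_famComp (J := setIndex.{u}) (M.seq (P.seq Θ))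
      (M.cell (P.cell κ)) _ _ (E.tup q))).trans ?_
    obtain ⟨h₁, h₂⟩ := hE.seq N (fun m => hver _ _ m) (fun χ => hcell _ _ _ _ _ _ _ _ χ) Θ
    refine B.tot_comp _ _ _ _ _ _ _ _ h₂ ?_
    exact (congrArg Val.tot (val_eq_of_tupAt (M.cell (P.cell κ)) h₁)).trans
      (hcell _ _ _ _ _ _ _ _ κ).symm

/-- A tuple is lifted from left to right: `ob_surj` supplies the next object and `hor_surj` a
horizontal morphism to it. The equation lives in a sigma type so that `cases` replaces path and
tuple together. -/
theorem IsElements.exists_path {E : Marking P M} (hE : E.IsElements) {y y' : Y.Ob}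
    (p : HPath Y.Hor y y') {i : setIndex.{u}.El (FOb.z (M.toFunctor.obj y))}
    {j : setIndex.{u}.El (FOb.z (M.toFunctor.obj y'))}
    (t : Tup (J := setIndex.{u}) (A := B) (M.path p) i j) (x : X.Ob)
    (hx : (⟨P.toFunctor.obj x, E.ob x⟩ :
      (y : Y.Ob) × setIndex.{u}.El (FOb.z (M.toFunctor.obj y))) = ⟨y, i⟩) :
    ∃ (x' : X.Ob) (q : HPath X.Hor x x'),
      (⟨PathTot.mk (P.path q), ⟨E.tup q⟩⟩ : (p : PathTot Y.toVDGraph) ×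
        TupAt (J := setIndex.{u}) (A := B) (M.path p.p)) = ⟨PathTot.mk p, ⟨t⟩⟩ := by
  induction p generalizing x with
  | nil y =>
    cases hx
    obtain rfl := Tup.nil_eq (J := setIndex.{u}) (A := B) (X := M.toFunctor.obj _) t
    obtain rfl := Tup.eq_nil (J := setIndex.{u}) (A := B) (X := M.toFunctor.obj _) t
    exact ⟨x, .nil x, rfl⟩
  | @cons y y₁ y' Ψ p ih =>
    cases hx
    obtain ⟨l, s, t, rfl⟩ := Tup.exists_cons (J := setIndex.{u}) (A := B) (S := M.hor Ψ) t
    obtain ⟨x₁, hx₁⟩ := hE.ob_surj y₁ l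
    cases hx₁
    obtain ⟨Φ, hΦ⟩ := hE.hor_surj Ψ s
    cases hΦ
    obtain ⟨x', q, hq⟩ := ih t x₁ rfl
    cases hq
    exact ⟨x', .cons Φ q, rfl⟩

/-- Every index of `M` is marked by something in `X`, and the member there is the value of `K`; the
same holds for `M'`. Index sets of objects and horizontal morphisms are assumed to agree, while the
functions on indices given by vertical morphisms and multicells are forced by `IsElements`. -/
theorem functor_eq_of_realizes (hP : P.IsDiscreteOpfibration) {E : Marking P M}
    {E' : Marking P M'} (hE : E.IsElements) (hE' : E'.IsElements) {K : VDFunctor X B}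
    (hK : E.Realizes K) (hK' : E'.Realizes K)
    (hz : ∀ y, FOb.z (M.toFunctor.obj y) = FOb.z (M'.toFunctor.obj y))
    (hΨ : ∀ {y y' : Y.Ob} (Ψ : Y.Hor y y'), HEq (FHor.Ψ (M.hor Ψ)) (FHor.Ψ (M'.hor Ψ)))
    (ho : ∀ x, HEq (E.ob x) (E'.ob x))
    (hh : ∀ {x x' : X.Ob} (Φ : X.Hor x x'), HEq (E.hor Φ) (E'.hor Φ)) : M = M' := by
  have hO : ∀ y, M.toFunctor.obj y = M'.toFunctor.obj y := fun y => by
    refine fOb_ext (J := setIndex.{u}) (A := B) (hz y) fun i i' hi => ?_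
    obtain ⟨x, hx⟩ := hE.ob_surj y i
    cases hx
    obtain rfl : E'.ob x = i' := eq_of_heq ((ho x).symm.trans hi)
    exact (hK.ob x).symm.trans (hK'.ob x)
  have ho' : ∀ x, ObTot.mk (J := setIndex.{u}) (A := B)
      (X := M.toFunctor.obj (P.toFunctor.obj x)) (E.ob x) =
      ObTot.mk (X := M'.toFunctor.obj (P.toFunctor.obj x)) (E'.ob x) := fun x =>
    obTot_ext (hO _) (ho x)
  have hH : ∀ {y y' : Y.Ob} (Ψ : Y.Hor y y'), M.horTot ⟨Ψ⟩ = M'.horTot ⟨Ψ⟩ := fun {y y'} Ψ => by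
    refine horTot_ext_heq (J := setIndex.{u}) (A := B) (hO y) (hO y') (hΨ Ψ)
      fun {i j i' j'} s s' hi hj hs => ?_
    obtain ⟨x, hx⟩ := hE.ob_surj y i
    cases hx
    obtain ⟨x', hx'⟩ := hE.ob_surj y' j
    cases hx'
    obtain ⟨Φ, hΦ⟩ := hE.hor_surj Ψ s
    cases hΦ
    obtain rfl := eq_of_obTot ((ho' x).symm.trans hi)
    obtain rfl := eq_of_obTot ((ho' x').symm.trans hj)
    obtain rfl := eq_of_heq ((hh Φ).symm.trans hs)
    exact (hK.hor Φ).symm.trans (hK'.hor Φ)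
  have hV : ∀ {y y' : Y.Ob} (v : y ⟶ y'), M.verTot ⟨v⟩ = M'.verTot ⟨v⟩ := fun {y y'} v => by
    refine verTot_ext (J := setIndex.{u}) (A := B) (hO y) (hO y') fun i i' hi => ?_
    obtain ⟨x, hx⟩ := hE.ob_surj y i
    cases hx
    -- The fields of `IsElements` and `Realizes` speak of images of morphisms of `X`, so `v` is
    -- replaced by the image of its lift at `x`.
    obtain ⟨⟨m⟩, hm, -⟩ := hP.existsUnique_ver x ⟨v⟩
    cases hm
    obtain rfl := eq_of_obTot ((ho' x).symm.trans hi)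
    refine ⟨?_, (hK.ver m).symm.trans (hK'.ver m)⟩
    refine (congrArg ObTot.mk (hE.ver m)).trans ((ho' _).trans ?_)
    exact (congrArg ObTot.mk (hE'.ver m)).symm
  have hE₁ : ∀ {x x' : X.Ob} (Φ : X.Hor x x'),
      ElTot.mk (J := setIndex.{u}) (A := B) (S := M.hor (P.hor Φ)) (E.hor Φ) =
        ElTot.mk (S := M'.hor (P.hor Φ)) (E'.hor Φ) := fun Φ =>
    elTot_ext (hH _) (ho _) (ho _) (hh Φ)
  have hT : ∀ {x x' : X.Ob} (q : HPath X.Hor x x'),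
      TupTot.mk (E.tup q) = TupTot.mk (E'.tup q) := by
    intro x x' q
    induction q with
    | nil x => exact tupTot_nil (ho' x)
    | cons Φ q ih => exact tupTot_cons (hE₁ Φ) ih
  refine ext_tot hO hV hH fun {a b c d p u u' Δ} ν => ?_
  refine cellTot_ext (J := setIndex.{u}) (A := B)
    (Bd.ext_tot (pathTot_map (A := setIndex.{u}.famGraph B) hO hH p) (hV u) (hV u') (hH Δ))
    fun {i j i₁ j₁} t t₁ ht => ?_
  obtain ⟨x, hx⟩ := hE.ob_surj a i
  obtain ⟨x', q, hq⟩ := hE.exists_path p t x hx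
  cases hq
  -- Likewise, `ν` becomes the image of its lift along the path `q` that the tuple marks.
  obtain ⟨⟨χ⟩, hχ, -⟩ := hP.existsUnique_cell q ⟨ν⟩
  cases hχ
  have e := val_eq_of_tupAt (M'.cell (P.cell χ)) (tupAt_of_tupTot (ht.symm.trans (hT q)))
  constructor
  · refine (elTot_of_hElAt (hE.cell χ)).trans ((hE₁ _).trans ?_)
    exact ((elTot_of_hElAt ((congrArg Val.elAt e).trans (hE'.cell χ)))).symm
  · exact (hK.cell χ).symm.trans ((hK'.cell χ).trans (congrArg Val.tot e).symm)

end Marking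

/-! ### Markings under change of the target of families. -/

namespace Marking
open VDGraph VDFunctor IndexGraph

variable {X Y B C : VDC.{max (u + 1) w}} {P : VDFunctor X Y}
  {M M' : VDFunctor Y (setIndex.{u}.fam B)}

/-- The composite with the virtual double functor between families that is induced by `N` has the
same index sets. -/
def map (N : VDFunctor B C) (E : Marking P M) : Marking P (M.comp (setIndex.{u}.famMap N)) where
  ob := E.ob
  hor := E.hor

/-- The composite with the virtual double functor between families that is induced by `N` has the
same index sets. -/
def unmap (N : VDFunctor B C) (E : Marking P (M.comp (setIndex.{u}.famMap N))) : Marking P M where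
  ob := E.ob
  hor := E.hor

theorem tup_map (N : VDFunctor B C) (E : Marking P M) {x x' : X.Ob} (q : HPath X.Hor x x') :
    HEq (mapTup N (E.tup q)) ((E.map N).tup q) := by
  induction q with
  | nil x => rfl
  | cons Φ q ih =>
    exact cons_heq (J := setIndex.{u}) (A := C) (S := mapHor N (M.hor (P.hor Φ)))
      (VDGraphHom.path_comp M.toVDGraphHom (famMapGraph setIndex.{u} N) (P.path q)) (E.hor Φ) ih

theorem val_map (N : VDFunctor B C) (E : Marking P M) {x x' : X.Ob} (q : HPath X.Hor x x')
    {c d : Y.Ob} {v : P.toFunctor.obj x ⟶ c} {v' : P.toFunctor.obj x' ⟶ d} {Ψ : Y.Hor c d}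
    (ν : Y.Cell (P.path q) v v' Ψ) :
    FCell.val (J := setIndex.{u}) (A := C) ((M.comp (setIndex.{u}.famMap N)).cell ν)
      ((E.map N).tup q) =
      mapVal N (FCell.val (J := setIndex.{u}) (A := B) (M.cell ν) (E.tup q)) :=
  (val_castTop (VDGraphHom.path_comp M.toVDGraphHom (famMapGraph setIndex.{u} N) (P.path q))
    (mapCell N (M.cell ν)) (tup_map N E q)).trans (val_mapCell N (M.cell ν) (E.tup q))

/-- `famMap N` changes the members only, and `IsElements` concerns the indices only. Taking `N` to
be the functor to the terminal object, the condition depends only on the composite to spans. -/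
theorem isElements_map_iff (N : VDFunctor B C) {E : Marking P M} :
    (E.map N).IsElements ↔ E.IsElements := by
  have key : ∀ {a b c d : X.Ob} {q : HPath X.Hor a b} {m : a ⟶ c} {m' : b ⟶ d} {Φ : X.Hor c d}
      (χ : X.Cell q m m' Φ),
      HElAt.mk (FCell.fn (J := setIndex.{u}) (A := C)
        ((M.comp (setIndex.{u}.famMap N)).cell (P.cell χ)) ((E.map N).tup q)) =
      HElAt.mk (FCell.fn (J := setIndex.{u}) (A := B) (M.cell (P.cell χ)) (E.tup q)) :=
    fun χ => congrArg Val.elAt (val_map N E _ (P.cell χ))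
  exact ⟨fun h => ⟨h.ob_surj, h.hor_surj, h.ver, fun χ => (key χ).symm.trans (h.cell χ)⟩,
    fun h => ⟨h.ob_surj, h.hor_surj, h.ver, fun χ => (key χ).trans (h.cell χ)⟩⟩

theorem Realizes.map {N : VDFunctor X B} {E : Marking P M} (h : E.Realizes N)
    (K : VDFunctor B C) : (E.map K).Realizes (N.comp K) where
  ob x := congrArg K.toFunctor.obj (h.ob x)
  ver m := congrArg K.verTot (h.ver m)
  hor Φ := congrArg K.horTot (h.hor Φ)
  cell {_ _ _ _ q _ _ _} χ := (cellTot_comp N K χ).trans ((congrArg K.cellTot (h.cell χ)).trans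
    (congrArg Val.tot (val_map K E q (P.cell χ))).symm)

/-- Transport along `h`, packaged with the facts about the result that are used, so that no cast of
a marking needs to be computed. -/
theorem exists_of_eq (h : M = M') (E : Marking P M) :
    ∃ E' : Marking P M', (∀ x, HEq (E.ob x) (E'.ob x)) ∧
      (∀ {x x' : X.Ob} (Φ : X.Hor x x'), HEq (E.hor Φ) (E'.hor Φ)) ∧
      (E.IsElements → E'.IsElements) := by
  subst h
  exact ⟨E, fun _ => HEq.rfl, fun _ => HEq.rfl, fun h => h⟩

theorem ext_heq {E E' : Marking P M} (ho : ∀ x, HEq (E.ob x) (E'.ob x))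
    (hh : ∀ {x x' : X.Ob} (Φ : X.Hor x x'), HEq (E.hor Φ) (E'.hor Φ)) : E = E' := by
  obtain ⟨ob, hor⟩ := E
  obtain ⟨ob', hor'⟩ := E'
  obtain rfl : ob = ob' := funext fun x => eq_of_heq (ho x)
  obtain rfl : @hor = @hor' := by
    funext x x' Φ
    exact eq_of_heq (hh Φ)
  rfl

end Marking

/-! ### The canonical marking of `bar` and the universal property of the unit. -/

namespace VDFunctor
open VDGraph

theorem IsDiscreteOpfibration.cellTot_unique {X Y : VDC.{w}} {P : VDFunctor X Y}
    (hP : P.IsDiscreteOpfibration) {χ χ' : X.CellTot} (h : PathTot.mk χ.p = PathTot.mk χ'.p)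
    (h' : P.cellTot χ = P.cellTot χ') : χ = χ' := by
  obtain ⟨χ⟩ := χ
  obtain ⟨χ'⟩ := χ'
  cases h
  exact congrArg (fun χ : X.CellFrom _ => CellTot.mk χ.θ)
    (hP.cell_unique (χ₁ := ⟨χ⟩) (χ₂ := ⟨χ'⟩) h')

end VDFunctor

namespace Bar
open VDGraph VDFunctor IndexGraph

variable {X Y : VDC.{max (u + 1) w}} {P : VDFunctor X Y}

/-- The index of an object of `X` in the family of the fibre that contains it. -/
noncomputable def code (hs : HasSmallFibres.{u} P) (x : X.Ob) : SOb hs (P.toFunctor.obj x) :=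
  eOb hs _ ⟨x, rfl⟩

theorem ob_code (hs : HasSmallFibres.{u} P) (x : X.Ob) :
    (ob hs (P.toFunctor.obj x)).a (code hs x) = x :=
  (val_eq hs ⟨x, rfl⟩ rfl).symm

theorem exists_horCode (hs : HasSmallFibres.{u} P) {x x' : X.Ob} (Φ : X.Hor x x') :
    ∃ s : (span hs (P.hor Φ)).El (code hs x) (code hs x'),
      HorTot.mk ((hor hs (P.hor Φ)).Γ s) = HorTot.mk Φ := by
  obtain ⟨Φ', h⟩ := HorTot.exists_hor ⟨Φ⟩ (ob_code hs x).symm (ob_code hs x').symm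
  obtain ⟨s, rfl⟩ := exists_hor hs (P.hor Φ) Φ' (congrArg P.horTot h)
  exact ⟨s, h⟩

variable (hP : P.IsDiscreteOpfibration) (hs : HasSmallFibres.{u} P)

/-- The objects and horizontal morphisms of `X` as elements of the index sets of the fibres that
contain them. -/
noncomputable def marking : Marking P (bar (X := X) (Y := Y) P hP hs) where
  ob := code hs
  hor Φ := (exists_horCode hs Φ).choose

theorem tot_marking_hor {x x' : X.Ob} (Φ : X.Hor x x') :
    HorTot.mk ((hor hs (P.hor Φ)).Γ ((marking hP hs).hor Φ)) = HorTot.mk Φ :=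
  (exists_horCode hs Φ).choose_spec

theorem pathTot_marking_tup {x x' : X.Ob} (q : HPath X.Hor x x') :
    PathTot.mk ((marking hP hs).tup q).path = PathTot.mk q := by
  induction q with
  | nil x => exact pathTot_nil (ob_code hs x)
  | cons Φ q ih => exact pathTot_cons (tot_marking_hor hP hs Φ) ih

theorem hElAt_inj {y y' : Y.Ob} {Ψ : Y.Hor y y'} {i i' : SOb hs y} {j j' : SOb hs y'}
    {s : (span hs Ψ).El i j} {s' : (span hs Ψ).El i' j'}
    (h : HorTot.mk ((hor hs Ψ).Γ s) = HorTot.mk ((hor hs Ψ).Γ s')) :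
    HElAt.mk (J := setIndex.{u}) (z := SOb hs y) (z' := SOb hs y') (Ψ := span hs Ψ) s =
      HElAt.mk s' := by
  obtain rfl := ob_inj hs (congrArg HorTot.a h)
  obtain rfl := ob_inj hs (congrArg HorTot.b h)
  exact congrArg (fun s => HElAt.mk (J := setIndex.{u}) (z := SOb hs y) (z' := SOb hs y')
    (Ψ := span hs Ψ) s)
    (hor_inj hs (eq_of_horTot h))

/-- `m` is itself a lift of `P m` at `x`, hence it is the lift chosen by `ver`. -/
theorem tot_ver_code {x x' : X.Ob} (m : x ⟶ x') :
    (ver hP hs (P.toFunctor.map m)).fn (code hs x) = code hs x' ∧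
      VerTot.mk ((ver hP hs (P.toFunctor.map m)).mor (code hs x)) = VerTot.mk m := by
  obtain ⟨m', h⟩ := VerTot.exists_ver ⟨m⟩ (ob_code hs x).symm (ob_code hs x').symm
  have e := hP.ver_unique ((map_ver hP hs (P.toFunctor.map m) (code hs x)).trans
    (congrArg P.verTot h).symm)
  exact ⟨ob_inj hs (congrArg VerFrom.b e), (verTot_of_verFrom e).trans h⟩

/-- Again by uniqueness of lifts: `χ` lifts `P χ` along `q`, which is the path of the marked tuple.
-/
theorem tot_cell_tup {a b c d : X.Ob} {q : HPath X.Hor a b} {m : a ⟶ c} {m' : b ⟶ d}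
    {Φ : X.Hor c d} (χ : X.Cell q m m' Φ) :
    CellTot.mk ((cell hP hs (P.cell χ)).cell ((marking hP hs).tup q)) = CellTot.mk χ :=
  hP.cellTot_unique (pathTot_marking_tup hP hs q) (map_cell hP hs (P.cell χ) _)

theorem marking_isElements : (marking hP hs).IsElements where
  ob_surj y i := by
    obtain ⟨⟨x, rfl⟩, rfl⟩ := (eOb hs y).surjective i
    exact ⟨x, rfl⟩
  hor_surj {x x'} Ψ s := by
    obtain ⟨Φ, h⟩ := HorTot.exists_hor ⟨(hor hs Ψ).Γ s⟩ (ob_code hs x) (ob_code hs x')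
    obtain rfl : P.hor Φ = Ψ := eq_of_horTot ((congrArg P.horTot h).trans (map_hor hs Ψ s))
    refine ⟨Φ, congrArg (Sigma.mk _) (hor_inj hs (eq_of_horTot ?_))⟩
    exact (tot_marking_hor hP hs Φ).trans h
  ver m := (tot_ver_code hP hs m).1
  cell {_ _ _ _ _ _ _ Φ} χ := hElAt_inj hs
    ((congrArg (fun θ : X.CellTot => HorTot.mk θ.Δ) (tot_cell_tup hP hs χ)).trans
      (tot_marking_hor hP hs Φ).symm)

/-- The families of `bar` are tautological, so the member at the index of a datum of `X` is that
datum. -/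
theorem marking_realizes : (marking hP hs).Realizes (VDFunctor.id X) where
  ob x := (ob_code hs x).symm
  ver m := (tot_ver_code hP hs m).2.symm
  hor Φ := (tot_marking_hor hP hs Φ).symm
  cell χ := (VDGraphHom.tot_id χ).trans (tot_cell_tup hP hs χ).symm

theorem marking_map_realizes {A : VDC.{max (u + 1) w}} (K : VDFunctor X A) :
    ((marking hP hs).map K).Realizes K := by
  have h := (marking_realizes hP hs).map K
  rwa [show (VDFunctor.id X).comp K = K from Category.id_comp (obj := VDC.{max (u + 1) w}) K] at h

/-- The equation over spans transfers the canonical marking from `bar` to `G`. `K` is the functor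
realizing it, and any competitor realizes the same marking. -/
theorem existsUnique_of_comp_eq {A : VDC.{max (u + 1) w}} (G : VDFunctor Y (Fam.{u} A))
    (hG : G.comp (Fam.map.{u} (toTerminal A)) =
      (bar (X := X) (Y := Y) P hP hs : VDFunctor Y (Fam.{u} X)).comp
        (Fam.map.{u} (toTerminal X))) :
    ∃! K : VDFunctor X A,
      (bar (X := X) (Y := Y) P hP hs : VDFunctor Y (Fam.{u} X)).comp (Fam.map.{u} K) = G := by
  obtain ⟨E₁, ho, hh, hE₁⟩ := Marking.exists_of_eq hG.symm
    ((marking hP hs).map (toTerminal X))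
  have hE : (E₁.unmap (M := G) (toTerminal A)).IsElements :=
    (Marking.isElements_map_iff (toTerminal A)).1
      (hE₁ ((Marking.isElements_map_iff (toTerminal X)).2 (marking_isElements hP hs)))
  obtain ⟨K, hK⟩ := hE.exists_realizes
  refine ⟨K, ?_, fun K' hK' => ?_⟩
  -- `K` realizes both the image of the canonical marking in the composite of `bar` with `Fam.map K`
  -- and the transferred marking of `G`. Their index data agree because both lie over the same
  -- functor to spans.
  · exact Marking.functor_eq_of_realizes hP
      ((Marking.isElements_map_iff K).2 (marking_isElements hP hs)) hE
      (marking_map_realizes hP hs K) hK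
      (fun y => (congrArg (FOb.z (J := setIndex.{u})) (ob_congr hG y)).symm)
      (fun Ψ => (edge_heq_of_horTot (horTot_congr hG Ψ)).symm) ho hh
  · subst hK'
    have e : (marking hP hs).map K' = E₁.unmap (toTerminal A) := Marking.ext_heq ho hh
    exact (e ▸ marking_map_realizes hP hs K').functor_eq hK

end Bar

theorem mainTheorem10 {X Y : VDC.{max (u + 1) w}} (P : X ⟶ Y)
    (hP : VDFunctor.IsDiscreteOpfibration P) (hs : VDFunctor.HasSmallFibres.{u} P) :
    IsFamUnit.{u, w} (fibreSpan.{u, w} P hP hs) (bar.{u, w} P hP hs) ∧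
      ∀ {A : VDC.{max (u + 1) w}} (F : A ⟶ X), ∃ T : PiProd P F ⟶ Fam.{u} A,
        Is2Pullback T (PiProd.proj P F) (Fam.map.{u} F) (bar.{u, w} P hP hs) :=
  -- The triangle over spans is `rfl` because `fibreSpan` is defined as this composite.
  ⟨⟨rfl, fun G hG => Bar.existsUnique_of_comp_eq hP hs G hG⟩, fun F =>
    ⟨Bar.piProj P hs F, (Bar.isLevelwisePullback (F := F) hP).is2Pullback⟩⟩
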